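/- **Setting.** Fix a finite relational signature $\sigma$ (arities in $\mathbb N$, arity $0$ allowed), a collection $\mathbb S$ of (unital) rings and/or abelian groups, a finite set $\mathbf W$ of weight symbols $\mathtt w$, each with an arity $\mathrm{ar}(\mathtt w)\ge 1$ and a type $\mathrm{type}(\mathtt w)\in\mathbb S$, and a countable set $\mathbb P$ of predicate names $\mathsf P$, each with an arity $m\ge 1$, a type $(S_1,\dots,S_m)\in\mathbb S^m$ and a semantics $[\![\mathsf P]\!]\subseteq S_1\times\cdots\times S_m$. A $(\sigma,\mathbf W)$-structure $\mathcal A$ is a $\sigma$-structure with finite non-empty universe $A$, together with functions $\mathtt w^{\mathcal A}:A^{\mathrm{ar}(\mathtt w)}\to\mathrm{type}(\mathtt w)$ such that $\mathtt w^{\mathcal A}(a_1,\dots,a_k)\neq 0$ implies that $k=1$, or $a_1=\dots=a_k$, or all $a_i$ occur in a common tuple of some relation of $\mathcal A$. Variables are taken from a countably infinite set. Terms are: constants $s\in S$ (type $S\in\mathbb S$); $\mathtt w(x_1,\dots,x_k)$ with pairwise distinct variables; $t_1+t_2$ and $t_1-t_2$ for terms of the same type; and $t_1\cdot t_2$ if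 this type is a ring. Formulas of $\mathrm{FOW}_1$ are built from $x=y$; $R(\bar x)$ with $R\in\sigma$; $(s=\mathtt w(\bar x))$ with $s\in\mathrm{type}(\mathtt w)$ and $\bar x$ pairwise distinct; and $\mathsf P(t_1,\dots,t_m)$ with terms $t_i$ of the right types in which altogether at most one variable occurs; by $\neg$, $\vee$, $\exists y$, and, for $\mathtt w$ of *finite* type $S$, $s\in S$ and pairwise distinct variables $\bar y$, the construct $\big(s=\sum\mathtt w(\bar y).\varphi\big)$, which binds $\bar y$ and says that the sum in $S$ of $\mathtt w^{\mathcal A}(\bar a)$ over all tuples $\bar a$ satisfying $\varphi$ (as values of $\bar y$) equals $s$. Two formulas are equivalent if they have the same truth value in every $(\sigma,\mathbf W)$-structure under every assignment. Distances are measured in the Gaifman graph of $\mathcal A$ (distinct elements are adjacent iff they occur in a common tuple of a relation), and $\mathcal N_r^{\mathcal A}(\bar a)$ is the restriction of the relations and weights of $\mathcal A$ to the set of elements at distance at most $r$ from some $a_i$. For a non-empty tuple $\bar x$ of variables containing the free variables of $\varphi$, the formula $\varphi(\bar x)$ is *$r$-local around $\bar x$* if for every $(\sigma,\mathbf W)$-structure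 $\mathcal A$ and all $\bar a$, $\mathcal A\models\varphi[\bar a]\iff\mathcal N_r^{\mathcal A}(\bar a)\models\varphi[\bar a]$; it is *local* if it has at least one free variable and is $r$-local around its free variables for some $r\in\mathbb N$. A *basic-local sentence* has the form $\exists x_1\cdots\exists x_\ell\big(\bigwedge_{i<j}\mathrm{dist}(x_i,x_j)>2r\wedge\bigwedge_i\lambda(x_i)\big)$ with $\ell\ge1$, $r\in\mathbb N$, pairwise distinct $x_i$, $\lambda(x)$ a $\mathrm{FOW}_1$-formula that is $r$-local around $x$, and $\mathrm{dist}(x_i,x_j)>2r$ the negation of a first-order formula over $\sigma$ that defines $\mathrm{dist}(x_i,x_j)\le 2r$. A *local aggregation sentence* has the form $\big(s=\sum\mathtt w(\bar y).\lambda(\bar y)\big)$ with $\mathtt w$ of finite type and $\lambda(\bar y)$ a $\mathrm{FOW}_1$-formula that is $r$-local around $\bar y$ for some $r$. A formula is in *Gaifman normal form* if it is a Boolean combination (by $\neg$ and $\vee$) of local $\mathrm{FOW}_1$-formulas, basic-local sentences and local aggregation sentences. **Theorem (Gaifman normal form for $\mathrm{FOW}_1$).** Every $\mathrm{FOW}_1$-formula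 $\varphi$ is equivalent to a $\mathrm{FOW}_1$-formula $\gamma$ in Gaifman normal form with $\mathrm{free}(\gamma)=\mathrm{free}(\varphi)$. Furthermore, there is an algorithm that computes $\gamma$ upon input of $\varphi$: there is such a map $\varphi\mapsto\gamma$ so that, for every coding of the predicate names and constants by natural numbers in which distinct predicate names have distinct codes, the zero of each $S\in\mathbb S$ has a code shared by no other element of $S$, and the elements of each finite $S\in\mathbb S$ have pairwise distinct codes, some computable function $\mathbb N\to\mathbb N$ sends the resulting code of the syntax tree of $\varphi$ to that of $\gamma$, for all $\varphi$. -/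

import Mathlib

universe u v w

/-- An abelian group or a (unital, not necessarily commutative) ring. -/
inductive Coeff : Type (u + 1)
  | group (S : Type u) (inst : AddCommGroup S) : Coeff
  | ring (S : Type u) (inst : Ring S) : Coeff

namespace Coeff

def Carrier : Coeff.{u} → Type u
  | group S _ => S
  | ring S _ => S

def IsRing : Coeff.{u} → Prop
  | group _ _ => False
  | ring _ _ => True

instance instAddCommGroup : (S : Coeff.{u}) → AddCommGroup S.Carrier
  | group _ inst => inst
  | ring _ inst => inst.toAddCommGroup

/-- Multiplication, available for rings only. -/
def mul : (S : Coeff.{u}) → S.IsRing → S.Carrier → S.Carrier → S.Carrier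
  | group _ _, h, _, _ => h.elim
  | ring _ inst, _, a, b => inst.mul a b

end Coeff

/-- The data over which the logic is built: a finite relational signature, a collection of
rings and/or abelian groups (indexed by `Ix`), a finite set of weight symbols, and a countable
predicate collection. -/
structure Vocabulary : Type (max (u + 1) (v + 1) (w + 1)) where
  numRel : ℕ
  relArity : Fin numRel → ℕ
  Ix : Type v
  coeff : Ix → Coeff.{u}
  numWt : ℕ
  wtArity : Fin numWt → ℕ
  wtArity_pos : ∀ a, 1 ≤ wtArity a
  wtType : Fin numWt → Ix
  Pred : Type w
  pred_countable : Countable Pred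
  predArity : Pred → ℕ
  predArity_pos : ∀ P, 1 ≤ predArity P
  predType : (P : Pred) → Fin (predArity P) → Ix
  predSem : (P : Pred) → Set ((j : Fin (predArity P)) → (coeff (predType P j)).Carrier)

namespace Vocabulary

/-- The set of elements of the `i`-th ring or group. -/
abbrev Elem (V : Vocabulary.{u, v, w}) (i : V.Ix) : Type u := (V.coeff i).Carrier

end Vocabulary

/-! ### Weighted structures -/

/-- A finite non-empty relational structure in which every weight symbol is interpreted by a
function. The locality condition on the weights is the separate predicate `IsWeighted`, because
it may fail in an induced substructure. As universes are finite, those in `Type` represent all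
structures up to isomorphism. -/
structure PreStructure (V : Vocabulary.{u, v, w}) : Type (max 1 u) where
  Univ : Type
  finite_univ : Finite Univ
  nonempty_univ : Nonempty Univ
  rel : (R : Fin V.numRel) → Set (Fin (V.relArity R) → Univ)
  wt : (a : Fin V.numWt) → (Fin (V.wtArity a) → Univ) → V.Elem (V.wtType a)

namespace PreStructure

variable {V : Vocabulary.{u, v, w}}

/-- The locality condition: `A` is a `(σ, W)`-structure. -/
def IsWeighted (A : PreStructure V) : Prop :=
  ∀ (a : Fin V.numWt) (t : Fin (V.wtArity a) → A.Univ), A.wt a t ≠ 0 →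
    V.wtArity a = 1 ∨ (∀ i j, t i = t j) ∨
      ∃ R, ∃ b ∈ A.rel R, Set.range t ⊆ Set.range b

/-- The Gaifman graph. -/
def gaifman (A : PreStructure V) : SimpleGraph A.Univ where
  Adj a b := a ≠ b ∧ ∃ R, ∃ t ∈ A.rel R, a ∈ Set.range t ∧ b ∈ Set.range t
  symm := ⟨fun _ _ h => ⟨h.1.symm, h.2.imp fun _ ⟨t, ht, ha, hb⟩ => ⟨t, ht, hb, ha⟩⟩⟩
  loopless := ⟨fun _ h => h.1 rfl⟩

/-- The `r`-ball around a set of elements. -/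
def ball (A : PreStructure V) (r : ℕ) (X : Set A.Univ) : Set A.Univ :=
  {b | ∃ a ∈ X, A.gaifman.edist a b ≤ r}

/-- The substructure induced on a non-empty set: relations and weights are restricted. -/
def induce (A : PreStructure V) (B : Set A.Univ) (hB : B.Nonempty) : PreStructure V where
  Univ := B
  finite_univ := by
    have := A.finite_univ
    infer_instance
  nonempty_univ := hB.to_subtype
  rel R := {t | (fun j => (t j : A.Univ)) ∈ A.rel R}
  wt a t := A.wt a fun j => (t j : A.Univ)

end PreStructure

/-! ### Syntax of the logic -/

/-- Terms; variables are natural numbers. Aggregation terms are not available in this logic. -/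
inductive WTerm (V : Vocabulary.{u, v, w}) : V.Ix → Type (max u v)
  | const {i : V.Ix} (s : V.Elem i) : WTerm V i
  | wt (a : Fin V.numWt) (xs : Fin (V.wtArity a) ↪ ℕ) : WTerm V (V.wtType a)
  | add {i : V.Ix} (t₁ t₂ : WTerm V i) : WTerm V i
  | sub {i : V.Ix} (t₁ t₂ : WTerm V i) : WTerm V i
  | mul {i : V.Ix} (h : (V.coeff i).IsRing) (t₁ t₂ : WTerm V i) : WTerm V i

namespace WTerm

variable {V : Vocabulary.{u, v, w}}

def free : {i : V.Ix} → WTerm V i → Finset ℕ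
  | _, const _ => ∅
  | _, wt _ xs => Finset.univ.image xs
  | _, add t₁ t₂ => t₁.free ∪ t₂.free
  | _, sub t₁ t₂ => t₁.free ∪ t₂.free
  | _, mul _ t₁ t₂ => t₁.free ∪ t₂.free

def eval (A : PreStructure V) (β : ℕ → A.Univ) : {i : V.Ix} → WTerm V i → V.Elem i
  | _, const s => s
  | _, wt a xs => A.wt a fun j => β (xs j)
  | _, add t₁ t₂ => t₁.eval A β + t₂.eval A β
  | _, sub t₁ t₂ => t₁.eval A β - t₂.eval A β
  | _, mul h t₁ t₂ => Coeff.mul _ h (t₁.eval A β) (t₂.eval A β)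

/-- Renaming of the variables by a permutation. -/
def rename (π : Equiv.Perm ℕ) : {i : V.Ix} → WTerm V i → WTerm V i
  | _, const s => const s
  | _, wt a xs => wt a (xs.trans π.toEmbedding)
  | _, add t₁ t₂ => add (t₁.rename π) (t₂.rename π)
  | _, sub t₁ t₂ => sub (t₁.rename π) (t₂.rename π)
  | _, mul h t₁ t₂ => mul h (t₁.rename π) (t₂.rename π)

theorem free_rename (π : Equiv.Perm ℕ) {i : V.Ix} (t : WTerm V i) :
    (t.rename π).free = t.free.image π := by
  induction t with
  | const s => simp [rename, free]
  | wt a xs =>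
    ext y
    simp [rename, free]
  | add t₁ t₂ h₁ h₂ => simp [rename, free, h₁, h₂, Finset.image_union]
  | sub t₁ t₂ h₁ h₂ => simp [rename, free, h₁, h₂, Finset.image_union]
  | mul h t₁ t₂ h₁ h₂ => simp [rename, free, h₁, h₂, Finset.image_union]

end WTerm

/-- Formulas of `FOW₁`. An embedding `Fin k ↪ ℕ` is a `k`-tuple of pairwise distinct variables.
* `wtEq a s xs` is `(s = a(xs))`;
* `sumEq a hfin s ys φ` is `(s = ∑ a(ys).φ)`, for a weight symbol whose type is finite;
* `pred P ts h` is `P(ts)`, where at most one variable is free in `ts`. -/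
inductive WFormula (V : Vocabulary.{u, v, w}) : Type (max u v w)
  | eq (x y : ℕ) : WFormula V
  | rel (R : Fin V.numRel) (xs : Fin (V.relArity R) → ℕ) : WFormula V
  | wtEq (a : Fin V.numWt) (s : V.Elem (V.wtType a)) (xs : Fin (V.wtArity a) ↪ ℕ) : WFormula V
  | not (φ : WFormula V) : WFormula V
  | or (φ ψ : WFormula V) : WFormula V
  | ex (y : ℕ) (φ : WFormula V) : WFormula V
  | sumEq (a : Fin V.numWt) (hfin : Finite (V.Elem (V.wtType a))) (s : V.Elem (V.wtType a))
      (ys : Fin (V.wtArity a) ↪ ℕ) (φ : WFormula V) : WFormula V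
  | pred (P : V.Pred) (ts : (j : Fin (V.predArity P)) → WTerm V (V.predType P j))
      (h : (Finset.univ.biUnion fun j => (ts j).free).card ≤ 1) : WFormula V

namespace WFormula

variable {V : Vocabulary.{u, v, w}}

def free : WFormula V → Finset ℕ
  | eq x y => {x, y}
  | rel _ xs => Finset.univ.image xs
  | wtEq _ _ xs => Finset.univ.image xs
  | not φ => φ.free
  | or φ ψ => φ.free ∪ ψ.free
  | ex y φ => φ.free \ {y}
  | sumEq _ _ _ ys φ => φ.free \ Finset.univ.image ys
  | pred _ ts _ => Finset.univ.biUnion fun j => (ts j).free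

/-- Satisfaction. `Function.extend ys b β` is the assignment that sends `ys j` to `b j` and
agrees with `β` elsewhere. -/
def Sat (A : PreStructure V) : WFormula V → (ℕ → A.Univ) → Prop
  | eq x y, β => β x = β y
  | rel R xs, β => (fun j => β (xs j)) ∈ A.rel R
  | wtEq a s xs, β => s = A.wt a fun j => β (xs j)
  | not φ, β => ¬ φ.Sat A β
  | or φ ψ, β => φ.Sat A β ∨ ψ.Sat A β
  | ex y φ, β => ∃ b : A.Univ, φ.Sat A (Function.update β y b)
  | sumEq a _ s ys φ, β =>
      s = ∑ᶠ b ∈ {b : Fin (V.wtArity a) → A.Univ | φ.Sat A (Function.extend ys b β)}, A.wt a b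
  | pred P ts _, β => (fun j => (ts j).eval A β) ∈ V.predSem P

/-- Equivalence: the same truth value in every `(σ, W)`-structure under every assignment. -/
def Equivalent (φ ψ : WFormula V) : Prop :=
  ∀ A : PreStructure V, A.IsWeighted → ∀ β : ℕ → A.Univ, φ.Sat A β ↔ ψ.Sat A β

/-- Renaming of all variables, free and bound, by a permutation. -/
def rename (π : Equiv.Perm ℕ) : WFormula V → WFormula V
  | eq x y => eq (π x) (π y)
  | rel R xs => rel R (fun j => π (xs j))
  | wtEq a s xs => wtEq a s (xs.trans π.toEmbedding)
  | not φ => not (φ.rename π)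
  | or φ ψ => or (φ.rename π) (ψ.rename π)
  | ex y φ => ex (π y) (φ.rename π)
  | sumEq a hfin s ys φ => sumEq a hfin s (ys.trans π.toEmbedding) (φ.rename π)
  | pred P ts h => pred P (fun j => (ts j).rename π) (by
      simp only [WTerm.free_rename, ← Finset.biUnion_image]
      exact Finset.card_image_le.trans h)

/-- The first-order formulas. -/
def IsFO : WFormula V → Prop
  | eq _ _ => True
  | rel _ _ => True
  | wtEq _ _ _ => False
  | not φ => φ.IsFO
  | or φ ψ => φ.IsFO ∧ ψ.IsFO
  | ex _ φ => φ.IsFO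
  | sumEq _ _ _ _ _ => False
  | pred _ _ _ => False

def and (φ ψ : WFormula V) : WFormula V := not (or (not φ) (not ψ))

/-- Conjunction of a list of formulas (a tautology for the empty list). -/
def conj : List (WFormula V) → WFormula V
  | [] => not (ex 0 (not (eq 0 0)))
  | [φ] => φ
  | φ :: ψ :: l => and φ (conj (ψ :: l))

/-- `∃ y₁ ⋯ ∃ yₗ φ`. -/
def exs (ys : List ℕ) (φ : WFormula V) : WFormula V := ys.foldr ex φ

/-! ### Locality and Gaifman normal form -/

/-- `φ` is `r`-local around the non-empty set `X` of variables, which contains its free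
variables: for all values of these variables, `φ` holds in the structure iff it holds in the
`r`-neighbourhood of the values. -/
def IsLocalAround (r : ℕ) (X : Finset ℕ) (φ : WFormula V) : Prop :=
  X.Nonempty ∧ φ.free ⊆ X ∧
    ∀ A : PreStructure V, A.IsWeighted → ∀ β : ℕ → A.Univ,
      ∀ (hB : (A.ball r (β '' X)).Nonempty) (β' : ℕ → (A.induce (A.ball r (β '' X)) hB).Univ),
        (∀ x ∈ X, (β' x).val = β x) →
          (φ.Sat A β ↔ φ.Sat (A.induce (A.ball r (β '' X)) hB) β')

/-- `φ` is local around its free variables (there has to be at least one). -/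
def IsLocal (φ : WFormula V) : Prop := ∃ r, φ.IsLocalAround r φ.free

/-- `δ` is a first-order formula `dist(x, y) ≤ r`. -/
def IsDistLE (r x y : ℕ) (δ : WFormula V) : Prop :=
  δ.IsFO ∧ δ.free ⊆ {x, y} ∧
    ∀ A : PreStructure V, A.IsWeighted → ∀ β : ℕ → A.Univ,
      (δ.Sat A β ↔ A.gaifman.edist (β x) (β y) ≤ r)

/-- The list of the formulas `¬ δ yᵢ yⱼ` for `i < j`. -/
def farApart (δ : ℕ → ℕ → WFormula V) : List ℕ → List (WFormula V)
  | [] => []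
  | y :: ys => ys.map (fun z => not (δ y z)) ++ farApart δ ys

/-- Basic-local sentences `∃ y₁ ⋯ ∃ yₗ (⋀_{i<j} dist(yᵢ, yⱼ) > 2r ∧ ⋀ᵢ lam(yᵢ))`. Since no variable
but `x` is free in `lam`, swapping `x` and `yᵢ` throughout `lam` is a capture-avoiding
substitution of `yᵢ` for `x`. -/
def IsBasicLocal (χ : WFormula V) : Prop :=
  ∃ (r x : ℕ) (lam : WFormula V) (ys : List ℕ) (δ : ℕ → ℕ → WFormula V),
    ys ≠ [] ∧ ys.Nodup ∧ lam.IsLocalAround r {x} ∧ (∀ y z, (δ y z).IsDistLE (2 * r) y z) ∧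
      χ = exs ys (conj (farApart δ ys ++ ys.map fun y => lam.rename (Equiv.swap x y)))

/-- Local aggregation sentences `(s = ∑ a(ys).lam(ys))`. -/
def IsLocalAggregation (χ : WFormula V) : Prop :=
  ∃ (a : Fin V.numWt) (hfin : Finite (V.Elem (V.wtType a))) (s : V.Elem (V.wtType a))
    (ys : Fin (V.wtArity a) ↪ ℕ) (lam : WFormula V) (r : ℕ),
      lam.IsLocalAround r (Finset.univ.image ys) ∧ χ = sumEq a hfin s ys lam

/-- Gaifman normal form: Boolean combinations of local formulas, basic-local sentences and local
aggregation sentences. -/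
inductive IsGaifmanNF : WFormula V → Prop
  | loc {φ : WFormula V} : φ.IsLocal → IsGaifmanNF φ
  | basicLocal {φ : WFormula V} : φ.IsBasicLocal → IsGaifmanNF φ
  | aggregation {φ : WFormula V} : φ.IsLocalAggregation → IsGaifmanNF φ
  | not {φ : WFormula V} : IsGaifmanNF φ → IsGaifmanNF (WFormula.not φ)
  | or {φ ψ : WFormula V} : IsGaifmanNF φ → IsGaifmanNF ψ → IsGaifmanNF (WFormula.or φ ψ)

end WFormula

/-! ### Coding of formulas for algorithms -/

/-- A coding of predicate names and constants by natural numbers. Since a ring or group may be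
uncountable, the constants need not be coded injectively; an algorithm only has to be able to
recognise the constant zero and to tell the elements of a finite ring or group apart. Every
injective coding has these properties. -/
structure SymbolCoding (V : Vocabulary.{u, v, w}) where
  pred : V.Pred → ℕ
  pred_injective : Function.Injective pred
  const : (i : V.Ix) → V.Elem i → ℕ
  const_zero : ∀ (i : V.Ix) (s : V.Elem i), const i s = const i 0 → s = 0
  const_injective : ∀ i : V.Ix, Finite (V.Elem i) → Function.Injective (const i)

namespace SymbolCoding

variable {V : Vocabulary.{u, v, w}}

/-- The code of a term: its syntax tree as a natural number. -/
def termCode (c : SymbolCoding V) : {i : V.Ix} → WTerm V i → ℕ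
  | i, .const s => Nat.pair 0 (c.const i s)
  | _, .wt a xs => Nat.pair 1 (Nat.pair a (Encodable.encode (List.ofFn fun j => xs j)))
  | _, .add t₁ t₂ => Nat.pair 2 (Nat.pair (c.termCode t₁) (c.termCode t₂))
  | _, .sub t₁ t₂ => Nat.pair 3 (Nat.pair (c.termCode t₁) (c.termCode t₂))
  | _, .mul _ t₁ t₂ => Nat.pair 4 (Nat.pair (c.termCode t₁) (c.termCode t₂))

/-- The code of a formula: its syntax tree as a natural number. -/
def code (c : SymbolCoding V) : WFormula V → ℕ
  | .eq x y => Nat.pair 0 (Nat.pair x y)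
  | .rel R xs => Nat.pair 1 (Nat.pair R (Encodable.encode (List.ofFn xs)))
  | .wtEq a s xs => Nat.pair 2 (Nat.pair a
      (Nat.pair (c.const _ s) (Encodable.encode (List.ofFn fun j => xs j))))
  | .not φ => Nat.pair 3 (c.code φ)
  | .or φ ψ => Nat.pair 4 (Nat.pair (c.code φ) (c.code ψ))
  | .ex y φ => Nat.pair 5 (Nat.pair y (c.code φ))
  | .sumEq a _ s ys φ => Nat.pair 6 (Nat.pair a (Nat.pair (c.const _ s)
      (Nat.pair (Encodable.encode (List.ofFn fun j => ys j)) (c.code φ))))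
  | .pred P ts _ => Nat.pair 7 (Nat.pair (c.pred P)
      (Encodable.encode (List.ofFn fun j => c.termCode (ts j))))

end SymbolCoding

/-! By induction on the formula one builds a radius r and a finite case distinction. Its guards are
sentences in Gaifman normal form, its bodies are r-local around the free variables, in every
structure some guard holds, and under each guard that holds the formula is equivalent to the body
(`isNormal_gnf`, `decides_gnf`). The disjunction of all "guard and body" is then a normal form.
Atoms are 0-local and connectives combine the lists, so the work lies in one binder in front of a
formula λ that is r-local around parameters X and the bound variables.

Far from X the formula λ decouples. If the two groups of variables have distance greater than 2r +
1, no tuple of a relation and no tuple of non-zero weight meets both r-balls. A Feferman–Vaught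
decomposition (`decides_split`, `satIn_splitBalls`) then yields cases whose guards speak about the
ball around X and whose bodies speak about the other ball. Three features of the logic make this
work: a predicate sees at most one variable, so it never mixes the parts; a mixed tuple has weight
zero; and a sum over both parts is the sum of two partial sums, whose values can be guessed because
the type is finite. Relativization to balls makes the resulting formulas local.

For a quantifier (`decides_exStep`), put R = 2r + 2. Witnesses within 3R of X are described locally.
For the others, compare scattered sets (pairwise distance greater than 2R) of elements satisfying
the decoupled body. Near X their size is at most |X|, and a witness beyond 3R extends each of them,
so for some k at most |X| there is a scattered set of size k + 1, but none near X
(`exists_scattered_not_near`). Conversely, such a k forces a witness far from X. The global half of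
this condition is a basic-local sentence, the other half is local.

For a sum (`decides_sumStep`), tuples of non-zero weight have diameter at most 1, so each of them
lies near X or is entirely far from X. Hence the sum over λ is the sum over the decoupled body,
minus its part near X, plus the part of λ near X. The first value is decided by local aggregation
sentences, the other two by local formulas.

For computability, each construction step is shown to be induced by a primitive recursive function
on codes (`Tracked`). Arithmetic is needed only in finite types, where finite tables suffice. -/

open Function

/-! ### Sums of weights, and satisfaction relative to a part of a structure -/

namespace PreStructure

variable {V : Vocabulary.{u, v, w}}

/-- The sum of the weights of the tuples in `P`. -/
noncomputable def wsum (A : PreStructure V) (a : Fin V.numWt)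
    (P : Set (Fin (V.wtArity a) → A.Univ)) : V.Elem (V.wtType a) :=
  ∑ᶠ b ∈ P, A.wt a b

variable {A : PreStructure V} {a : Fin V.numWt} {P Q : Set (Fin (V.wtArity a) → A.Univ)}

theorem finite_tuples (A : PreStructure V) {k : ℕ} (P : Set (Fin k → A.Univ)) : P.Finite := by
  have := A.finite_univ
  exact Set.toFinite P

/-- Tuples of weight zero do not contribute. Through this reduction the locality of weights enters
the treatment of sums. -/
theorem wsum_congr (h : ∀ b, A.wt a b ≠ 0 → (b ∈ P ↔ b ∈ Q)) : A.wsum a P = A.wsum a Q :=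
  finsum_mem_inter_support_eq' _ _ _ h

theorem wsum_inter_add_sdiff (P Q : Set (Fin (V.wtArity a) → A.Univ)) :
    A.wsum a (P ∩ Q) + A.wsum a (P \ Q) = A.wsum a P :=
  finsum_mem_inter_add_sdiff Q (A.finite_tuples P)

theorem wsum_union (h : Disjoint P Q) : A.wsum a (P ∪ Q) = A.wsum a P + A.wsum a Q :=
  finsum_mem_union h (A.finite_tuples P) (A.finite_tuples Q)

end PreStructure

theorem WTerm.eval_congr {V : Vocabulary.{u, v, w}} {A : PreStructure V} {i : V.Ix}
    (t : WTerm V i) {β β' : ℕ → A.Univ} (h : ∀ x ∈ t.free, β x = β' x) :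
    t.eval A β = t.eval A β' := by
  induction t with
  | const s => rfl
  | wt a xs =>
    simp only [eval]
    congr 1
    ext j
    exact h _ (by simp [free])
  | add t₁ t₂ h₁ h₂ | sub t₁ t₂ h₁ h₂ | mul _ t₁ t₂ h₁ h₂ =>
    simp only [free, Finset.mem_union] at h
    simp only [eval]
    rw [h₁ fun x hx => h x (.inl hx), h₂ fun x hx => h x (.inr hx)]

theorem WTerm.eval_rename {V : Vocabulary.{u, v, w}} {A : PreStructure V} {i : V.Ix}
    (π : Equiv.Perm ℕ) (t : WTerm V i) (β : ℕ → A.Univ) :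
    (t.rename π).eval A β = t.eval A (β ∘ π) := by
  induction t with
  | const s => rfl
  | wt a xs => rfl
  | add t₁ t₂ h₁ h₂ | sub t₁ t₂ h₁ h₂ | mul _ t₁ t₂ h₁ h₂ => simp only [rename, eval, h₁, h₂]

theorem WTerm.eval_induce {V : Vocabulary.{u, v, w}} {A : PreStructure V} {D : Set A.Univ}
    (hD : D.Nonempty) {i : V.Ix} (t : WTerm V i) (β : ℕ → (A.induce D hD).Univ) :
    t.eval (A.induce D hD) β = t.eval A (fun x => (β x).val) := by
  induction t with
  | const s => rfl
  | wt a xs => rfl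
  | add t₁ t₂ h₁ h₂ | sub t₁ t₂ h₁ h₂ | mul _ t₁ t₂ h₁ h₂ => simp only [eval, h₁, h₂]

theorem extend_congr_of_subset {α : Type*} {k : ℕ} (ys : Fin k ↪ ℕ) (b : Fin k → α)
    {β β' : ℕ → α} {s : Finset ℕ} (h : ∀ x ∈ s \ Finset.univ.image ys, β x = β' x) :
    ∀ x ∈ s, extend ys b β x = extend ys b β' x := by
  intro x hx
  by_cases hj : ∃ j, ys j = x
  · obtain ⟨j, rfl⟩ := hj
    simp [ys.injective.extend_apply]
  · rw [extend_apply' _ _ _ hj, extend_apply' _ _ _ hj]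
    exact h x (by simpa [hx] using hj)

theorem update_congr_of_subset {α : Type*} (y : ℕ) (b : α)
    {β β' : ℕ → α} {s : Finset ℕ} (h : ∀ x ∈ s \ {y}, β x = β' x) :
    ∀ x ∈ s, update β y b x = update β' y b x := by
  intro x hx
  by_cases hj : x = y
  · subst hj; simp
  · simpa [hj] using h x (by simp [hx, hj])

theorem extend_trans_comp {α : Type*} {k : ℕ} (ys : Fin k ↪ ℕ) (b : Fin k → α) (β : ℕ → α)
    (π : Equiv.Perm ℕ) :
    extend (ys.trans π.toEmbedding) b β ∘ π = extend ys b (β ∘ π) := by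
  ext x
  by_cases hj : ∃ j, ys j = x
  · obtain ⟨j, rfl⟩ := hj
    rw [ys.injective.extend_apply]
    exact (ys.trans π.toEmbedding).injective.extend_apply _ _ j
  · rw [extend_apply' _ _ _ hj, comp_apply, extend_apply' _ _ _ (by simpa using hj)]
    rfl

namespace WFormula

variable {V : Vocabulary.{u, v, w}} {A : PreStructure V} {D : Set A.Univ}

/-- Satisfaction in the part of `A` induced on `D`, for assignments into `A`. -/
def SatIn (A : PreStructure V) (D : Set A.Univ) : WFormula V → (ℕ → A.Univ) → Prop
  | eq x y, β => β x = β y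
  | rel R xs, β => (fun j => β (xs j)) ∈ A.rel R
  | wtEq a s xs, β => s = A.wt a fun j => β (xs j)
  | not φ, β => ¬ φ.SatIn A D β
  | or φ ψ, β => φ.SatIn A D β ∨ ψ.SatIn A D β
  | ex y φ, β => ∃ b ∈ D, φ.SatIn A D (update β y b)
  | sumEq a _ s ys φ, β =>
      s = A.wsum a {b | (∀ j, b j ∈ D) ∧ φ.SatIn A D (extend ys b β)}
  | pred P ts _, β => (fun j => (ts j).eval A β) ∈ V.predSem P

theorem satIn_univ (φ : WFormula V) (β : ℕ → A.Univ) :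
    φ.SatIn A Set.univ β ↔ φ.Sat A β := by
  induction φ generalizing β with
  | eq x y => rfl
  | rel R xs => rfl
  | wtEq a s xs => rfl
  | not φ ih => simp only [SatIn, Sat, ih]
  | or φ ψ ih₁ ih₂ => simp only [SatIn, Sat, ih₁, ih₂]
  | ex y φ ih => simp only [SatIn, Sat, ih, Set.mem_univ, true_and]
  | sumEq a hfin s ys φ ih =>
    simp only [SatIn, Sat, ih, Set.mem_univ, implies_true, true_and, PreStructure.wsum]
  | pred P ts h => rfl

theorem satIn_congr (φ : WFormula V) {β β' : ℕ → A.Univ} (h : ∀ x ∈ φ.free, β x = β' x) :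
    φ.SatIn A D β ↔ φ.SatIn A D β' := by
  induction φ generalizing β β' with
  | eq x y => simp only [SatIn]; rw [h x (by simp [free]), h y (by simp [free])]
  | rel R xs =>
    simp only [SatIn]
    rw [funext fun j => h (xs j) (by simp [free])]
  | wtEq a s xs =>
    simp only [SatIn]
    rw [funext fun j => h (xs j) (by simp [free])]
  | not φ ih => simp only [SatIn, ih h]
  | or φ ψ ih₁ ih₂ =>
    simp only [free, Finset.mem_union] at h
    simp only [SatIn, ih₁ fun x hx => h x (.inl hx), ih₂ fun x hx => h x (.inr hx)]
  | ex y φ ih =>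
    simp only [SatIn]
    refine exists_congr fun b => and_congr_right fun _ => ih (update_congr_of_subset y b h)
  | sumEq a hfin s ys φ ih =>
    simp only [SatIn]
    have : ∀ b, φ.SatIn A D (extend ys b β) ↔ φ.SatIn A D (extend ys b β') := fun b =>
      ih (extend_congr_of_subset ys b h)
    simp only [this]
  | pred P ts hP =>
    simp only [SatIn]
    rw [funext fun j => (ts j).eval_congr fun x hx => h x (by
      simp only [free, Finset.mem_biUnion]; exact ⟨j, Finset.mem_univ _, hx⟩)]

theorem satIn_rename (π : Equiv.Perm ℕ) (φ : WFormula V) (β : ℕ → A.Univ) :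
    (φ.rename π).SatIn A D β ↔ φ.SatIn A D (β ∘ π) := by
  induction φ generalizing β with
  | eq x y => rfl
  | rel R xs => rfl
  | wtEq a s xs => rfl
  | not φ ih => simp only [SatIn, rename, ih]
  | or φ ψ ih₁ ih₂ => simp only [SatIn, rename, ih₁, ih₂]
  | ex y φ ih =>
    simp only [SatIn, rename, ih]
    have : ∀ b, update β (π y) b ∘ π = update (β ∘ π) y b := fun b => by
      ext x
      simp [update_apply]
    simp only [this]
  | sumEq a hfin s ys φ ih =>
    simp only [SatIn, rename, ih, extend_trans_comp]
  | pred P ts h => simp only [SatIn, rename, WTerm.eval_rename]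

/-- Link between substructures and `SatIn`. The latter keeps assignments in the ambient universe, so
that several parts of one structure can be compared under one assignment, and it makes sense for
empty `D`, as needed for balls around an empty set of variables. -/
theorem sat_induce (hD : D.Nonempty) (φ : WFormula V) (β : ℕ → (A.induce D hD).Univ) :
    φ.Sat (A.induce D hD) β ↔ φ.SatIn A D (fun x => (β x).val) := by
  induction φ generalizing β with
  | eq x y => exact Subtype.ext_iff
  | rel R xs => rfl
  | wtEq a s xs => rfl
  | not φ ih => simp only [SatIn, Sat, ih]
  | or φ ψ ih₁ ih₂ => simp only [SatIn, Sat, ih₁, ih₂]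
  | ex y φ ih =>
    simp only [SatIn, Sat, ih]
    have : ∀ b : (A.induce D hD).Univ, (fun x => (update β y b x).val) =
        update (fun x => (β x).val) y b.val := fun b => by
      ext x
      by_cases hx : x = y
      · subst hx; simp
      · simp [hx]
    simp only [this]
    exact ⟨fun ⟨b, hb⟩ => ⟨b.val, b.property, hb⟩, fun ⟨b, hb, h⟩ => ⟨⟨b, hb⟩, h⟩⟩
  | sumEq a hfin s ys φ ih =>
    simp only [SatIn, Sat, ih, PreStructure.wsum]
    have hext : ∀ b : Fin (V.wtArity a) → (A.induce D hD).Univ,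
        (fun x => (extend ys b β x).val) = extend ys (fun j => (b j).val) (fun x => (β x).val) :=
      fun b => by
        ext x
        by_cases hj : ∃ j, ys j = x
        · obtain ⟨j, rfl⟩ := hj
          simp [ys.injective.extend_apply]
        · simp [extend_apply' _ _ _ hj]
    rw [Eq.congr_right]
    -- Inclusion maps the tuples of the substructure bijectively onto the tuples of `A` with all
    -- entries in `D`, and it preserves weights.
    refine finsum_mem_eq_of_bijOn (fun b j => (b j).val) ⟨?_, ?_, ?_⟩ fun _ _ => rfl
    · intro b hb
      exact ⟨fun j => (b j).property, by simpa only [Set.mem_ofPred_eq, hext] using hb⟩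
    · intro b _ b' _ h
      exact funext fun j => Subtype.ext (congrFun h j)
    · rintro b ⟨hb, h⟩
      refine ⟨fun j => ⟨b j, hb j⟩, ?_, rfl⟩
      exact Eq.mpr (congrArg (SatIn A D φ) (hext fun j => ⟨b j, hb j⟩)) h
  | pred P ts h => simp only [SatIn, Sat, WTerm.eval_induce]

theorem free_rename (π : Equiv.Perm ℕ) (φ : WFormula V) :
    (φ.rename π).free = φ.free.image π := by
  induction φ with
  | eq x y => simp [rename, free, Finset.image_insert]
  | rel R xs => ext y; simp [rename, free]
  | wtEq a s xs => ext y; simp [rename, free]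
  | not φ ih => simp [rename, free, ih]
  | or φ ψ ih₁ ih₂ => simp [rename, free, ih₁, ih₂, Finset.image_union]
  | ex y φ ih => simp [rename, free, ih, Finset.image_sdiff _ _ π.injective]
  | sumEq a hfin s ys φ ih =>
    simp only [rename, free, ih, Finset.image_sdiff _ _ π.injective, Finset.image_image]
    rfl
  | pred P ts h =>
    simp only [rename, free, WTerm.free_rename, Finset.biUnion_image]

/-! ### Connectives -/

/-- Truth, as the empty conjunction. -/
def tt : WFormula V := conj []

def ff : WFormula V := not tt

/-- Disjunction of a list of formulas. -/
def disj (l : List (WFormula V)) : WFormula V := l.foldr or ff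

variable {β : ℕ → A.Univ} {φ ψ : WFormula V}

@[simp] theorem satIn_not : (not φ).SatIn A D β ↔ ¬ φ.SatIn A D β := Iff.rfl

@[simp] theorem satIn_or : (or φ ψ).SatIn A D β ↔ φ.SatIn A D β ∨ ψ.SatIn A D β := Iff.rfl

@[simp] theorem satIn_and : (and φ ψ).SatIn A D β ↔ φ.SatIn A D β ∧ ψ.SatIn A D β := by
  simp [and]

-- As a negated existential statement, truth survives an empty `D`.
@[simp] theorem satIn_tt : (tt : WFormula V).SatIn A D β := by
  simp [tt, conj, SatIn]

@[simp] theorem satIn_ff : ¬ (ff : WFormula V).SatIn A D β := by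
  simp [ff]

@[simp] theorem satIn_disj {l : List (WFormula V)} :
    (disj l).SatIn A D β ↔ ∃ φ ∈ l, φ.SatIn A D β := by
  induction l with
  | nil => simp [disj]
  | cons φ l ih => simpa [disj] using or_congr Iff.rfl ih

@[simp] theorem satIn_conj {l : List (WFormula V)} :
    (conj l).SatIn A D β ↔ ∀ φ ∈ l, φ.SatIn A D β := by
  induction l with
  | nil => exact iff_of_true satIn_tt (by simp)
  | cons φ l ih =>
    cases l with
    | nil => simp [conj]
    | cons ψ l => simp only [conj, satIn_and, ih, List.forall_mem_cons]

@[simp] theorem free_and : (and φ ψ).free = φ.free ∪ ψ.free := rfl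

@[simp] theorem free_tt : (tt : WFormula V).free = ∅ := by simp [tt, conj, free]

@[simp] theorem free_ff : (ff : WFormula V).free = ∅ := free_tt

theorem mem_free_disj {l : List (WFormula V)} {x : ℕ} :
    x ∈ (disj l).free ↔ ∃ φ ∈ l, x ∈ φ.free := by
  induction l with
  | nil => simp [disj]
  | cons φ l ih =>
    simp only [disj, List.foldr_cons, free, Finset.mem_union, List.exists_mem_cons_iff] at ih ⊢
    rw [ih]

theorem mem_free_conj {l : List (WFormula V)} {x : ℕ} :
    x ∈ (conj l).free ↔ ∃ φ ∈ l, x ∈ φ.free := by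
  induction l with
  | nil => exact iff_of_false (by simp [conj, free]) (by simp)
  | cons φ l ih =>
    cases l with
    | nil => simp [conj]
    | cons ψ l => simp only [conj, free_and, Finset.mem_union, ih, List.exists_mem_cons_iff]

theorem mem_free_exs {l : List ℕ} {x : ℕ} : x ∈ (exs l φ).free ↔ x ∈ φ.free ∧ x ∉ l := by
  induction l with
  | nil => simp [exs]
  | cons y l ih =>
    simp only [exs, List.foldr_cons, free, Finset.mem_sdiff, Finset.mem_singleton,
      List.mem_cons, not_or] at ih ⊢
    rw [ih]; tauto

/-- A block of quantifiers becomes one choice of an assignment that may differ from `β` on the block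
only; the variables need not be distinct. -/
theorem satIn_exs {l : List ℕ} :
    (exs l φ).SatIn A D β ↔
      ∃ β' : ℕ → A.Univ, (∀ x ∉ l, β' x = β x) ∧ (∀ x ∈ l, β' x ∈ D) ∧ φ.SatIn A D β' := by
  induction l generalizing β with
  | nil =>
    simp only [exs, List.foldr_nil, List.not_mem_nil, not_false_eq_true, true_imp_iff,
      false_imp_iff, implies_true, true_and]
    exact ⟨fun h => ⟨β, fun _ => rfl, h⟩, fun ⟨β', h, h'⟩ => (funext h : β' = β) ▸ h'⟩
  | cons y l ih =>
    change (∃ b ∈ D, (exs l φ).SatIn A D (update β y b)) ↔ _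
    simp only [ih]
    constructor
    · rintro ⟨b, hb, β', h₁, h₂, h₃⟩
      refine ⟨β', fun x hx => ?_, fun x hx => ?_, h₃⟩
      · simp only [List.mem_cons, not_or] at hx
        rw [h₁ x hx.2, update_of_ne hx.1]
      · by_cases hl : x ∈ l
        · exact h₂ x hl
        · obtain rfl : x = y := by simpa [hl] using hx
          rw [h₁ x hl, update_self]; exact hb
    · rintro ⟨β', h₁, h₂, h₃⟩
      refine ⟨β' y, h₂ y (by simp), β', fun x hx => ?_, fun x hx => h₂ x (by simp [hx]), h₃⟩
      by_cases hxy : x = y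
      · subst hxy; simp
      · rw [update_of_ne hxy]; exact h₁ x (by simp [hxy, hx])

end WFormula

/-! ### Assignments on blocks of variables; distances and balls -/

/-- The assignment that sends `N, …, N + k - 1` to the entries of `t` and agrees with `β`
elsewhere. -/
def assignBlock {α : Type*} (β : ℕ → α) (N : ℕ) {k : ℕ} (t : Fin k → α) (v : ℕ) : α :=
  if h : N ≤ v ∧ v < N + k then t ⟨v - N, by omega⟩ else β v

theorem assignBlock_add {α : Type*} (β : ℕ → α) (N : ℕ) {k : ℕ} (t : Fin k → α) (l : Fin k) :
    assignBlock β N t (N + l) = t l := by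
  rw [assignBlock, dif_pos (by omega)]
  congr 1
  ext; simp

theorem assignBlock_of_not_mem {α : Type*} {β : ℕ → α} {N : ℕ} {k : ℕ} {t : Fin k → α} {v : ℕ}
    (h : ¬ (N ≤ v ∧ v < N + k)) : assignBlock β N t v = β v :=
  dif_neg h

namespace PreStructure

variable {V : Vocabulary.{u, v, w}} {A : PreStructure V}

/-- Splits off the last edge of a walk. As walks are built from their first vertex, the proof takes
a walk from `b` to `a` and removes its first edge. -/
theorem edist_le_succ_iff {α : Type*} (G : SimpleGraph α) (a b : α) (r : ℕ) :
    G.edist a b ≤ (r + 1 : ℕ) ↔ ∃ z, G.edist a z ≤ r ∧ (z = b ∨ G.Adj z b) := by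
  constructor
  · intro h
    have htop : G.edist b a ≠ ⊤ := by
      rw [SimpleGraph.edist_comm]
      exact ne_top_of_le_ne_top (ENat.natCast_ne_top _) h
    obtain ⟨p, hp⟩ := SimpleGraph.exists_walk_of_edist_ne_top htop
    rw [SimpleGraph.edist_comm, ← hp] at h
    cases p with
    | nil => exact ⟨a, by simp, .inl rfl⟩
    | @cons _ z _ hadj q =>
      refine ⟨z, ?_, .inr hadj.symm⟩
      rw [SimpleGraph.edist_comm]
      refine q.edist_le.trans ?_
      simp only [SimpleGraph.Walk.length_cons] at h
      exact_mod_cast Nat.le_of_succ_le_succ (by exact_mod_cast h)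
  · rintro ⟨z, hz, rfl | hadj⟩
    · exact hz.trans (by exact_mod_cast Nat.le_succ r)
    · refine G.edist_triangle.trans
        ((add_le_add hz (SimpleGraph.edist_eq_one_iff_adj.2 hadj).le).trans ?_)
      exact_mod_cast le_rfl

theorem edist_le_add {a b c : A.Univ} {m n k : ℕ} (h₁ : A.gaifman.edist a b ≤ m)
    (h₂ : A.gaifman.edist b c ≤ n) (h : m + n ≤ k) : A.gaifman.edist a c ≤ k :=
  A.gaifman.edist_triangle.trans ((add_le_add h₁ h₂).trans (by exact_mod_cast h))

theorem edist_le_one_of_mem_rel {R : Fin V.numRel} {t : Fin (V.relArity R) → A.Univ}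
    (ht : t ∈ A.rel R) (i j : Fin (V.relArity R)) : A.gaifman.edist (t i) (t j) ≤ (1 : ℕ) := by
  by_cases h : t i = t j
  · simp [h]
  · have hadj : A.gaifman.Adj (t i) (t j) := ⟨h, R, t, ht, ⟨i, rfl⟩, ⟨j, rfl⟩⟩
    exact (SimpleGraph.edist_eq_one_iff_adj.2 hadj).le

theorem ball_mono {r s : ℕ} {X Y : Set A.Univ} (hr : r ≤ s) (hX : X ⊆ Y) :
    A.ball r X ⊆ A.ball s Y :=
  fun _ ⟨a, ha, h⟩ => ⟨a, hX ha, h.trans (by exact_mod_cast hr)⟩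

theorem subset_ball (r : ℕ) (X : Set A.Univ) : X ⊆ A.ball r X :=
  fun a ha => ⟨a, ha, by simp⟩

theorem ball_union (r : ℕ) (X Y : Set A.Univ) : A.ball r (X ∪ Y) = A.ball r X ∪ A.ball r Y := by
  ext b
  simp only [ball, Set.mem_ofPred_eq, Set.mem_union, or_and_right, exists_or]

theorem ball_ball_subset {r s k : ℕ} {X Y : Set A.Univ} (h : r + s ≤ k) (hY : Y ⊆ A.ball r X) :
    A.ball s Y ⊆ A.ball k X := by
  rintro b ⟨a, ha, hab⟩
  obtain ⟨x, hx, hxa⟩ := hY ha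
  exact ⟨x, hx, edist_le_add hxa hab h⟩

end PreStructure

namespace WFormula

variable {V : Vocabulary.{u, v, w}} {A : PreStructure V} {D : Set A.Univ}
  {β : ℕ → A.Univ} {φ ψ : WFormula V}

/-! ### Distance formulas -/

/-- `z` and `y` occur in a common tuple of `R`. -/
def link (R : Fin V.numRel) (z y : ℕ) : WFormula V :=
  exs (List.range' (z + y + 1) (V.relArity R)) (and (rel R fun l => z + y + 1 + l)
    (and (disj ((List.range (V.relArity R)).map fun l => eq (z + y + 1 + l) z))
      (disj ((List.range (V.relArity R)).map fun l => eq (z + y + 1 + l) y))))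

/-- `z` and `y` are equal or adjacent. -/
def distLEOne (z y : ℕ) : WFormula V :=
  or (eq z y) (disj ((List.finRange V.numRel).map fun R => link R z y))

/-- The variable `x + y + 1` is fresh because it exceeds both `x` and `y`. Splitting off the last
edge keeps `x` fixed in the recursion, so that everything happens in balls around its value. -/
def distLE : ℕ → ℕ → ℕ → WFormula V
  | 0, x, y => eq x y
  | r + 1, x, y => ex (x + y + 1) (and (distLE r x (x + y + 1)) (distLEOne (x + y + 1) y))

theorem isFO_exs (l : List ℕ) : (exs l φ).IsFO ↔ φ.IsFO := by
  induction l with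
  | nil => rfl
  | cons y l ih => exact ih

theorem isFO_disj {l : List (WFormula V)} (h : ∀ φ ∈ l, φ.IsFO) : (disj l).IsFO := by
  induction l with
  | nil => simp [disj, ff, tt, conj, IsFO]
  | cons φ l ih => exact ⟨h φ (by simp), ih fun ψ hψ => h ψ (by simp [hψ])⟩

theorem isFO_distLE (r x y : ℕ) : (distLE r x y : WFormula V).IsFO := by
  induction r generalizing y with
  | zero => trivial
  | succ r ih =>
    refine ⟨ih _, trivial, isFO_disj fun φ hφ => ?_⟩
    simp only [List.mem_map, List.mem_finRange, true_and] at hφ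
    obtain ⟨R, rfl⟩ := hφ
    rw [link, isFO_exs]
    refine ⟨trivial, isFO_disj ?_, isFO_disj ?_⟩ <;>
    · intro φ hφ
      simp only [List.mem_map] at hφ
      obtain ⟨l, -, rfl⟩ := hφ
      trivial

theorem free_link_subset (R : Fin V.numRel) (z y : ℕ) :
    (link R z y : WFormula V).free ⊆ {z, y} := by
  intro x hx
  rw [link, mem_free_exs] at hx
  obtain ⟨hx, hx'⟩ := hx
  simp only [free_and, Finset.mem_union, mem_free_disj, List.mem_map, List.mem_range,
    exists_exists_and_eq_and, free, Finset.mem_insert, Finset.mem_singleton, Finset.mem_image,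
    Finset.mem_univ, true_and] at hx
  simp only [List.mem_range'_1] at hx'
  simp only [Finset.mem_insert, Finset.mem_singleton]
  rcases hx with ⟨l, hl⟩ | ⟨l, hl, h⟩ | ⟨l, hl, h⟩
  · have := l.2
    omega
  · omega
  · omega

theorem free_distLE_subset (r x y : ℕ) : (distLE r x y : WFormula V).free ⊆ {x, y} := by
  induction r generalizing y with
  | zero => exact Finset.Subset.refl _
  | succ r ih =>
    intro v hv
    simp only [distLE, distLEOne, free, free_and, Finset.mem_sdiff, Finset.mem_union,
      Finset.mem_singleton, mem_free_disj, List.mem_map, List.mem_finRange, true_and,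
      exists_exists_eq_and, Finset.mem_insert] at hv
    obtain ⟨h, hv⟩ := hv
    simp only [Finset.mem_insert, Finset.mem_singleton]
    rcases h with h | h | ⟨R, h⟩
    · have := ih _ h
      simp only [Finset.mem_insert, Finset.mem_singleton] at this
      tauto
    · tauto
    · have := free_link_subset R _ _ h
      simp only [Finset.mem_insert, Finset.mem_singleton] at this
      tauto

theorem satIn_link {R : Fin V.numRel} {z y : ℕ} :
    (link R z y).SatIn A D β ↔
      ∃ t ∈ A.rel R, (∀ i, t i ∈ D) ∧ β z ∈ Set.range t ∧ β y ∈ Set.range t := by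
  rw [link, satIn_exs]
  simp only [satIn_and, satIn_disj, List.mem_map, List.mem_range, exists_exists_and_eq_and,
    List.mem_range'_1, SatIn]
  constructor
  · rintro ⟨β', h₁, h₂, h₃, ⟨i, hi, hiz⟩, ⟨j, hj, hjy⟩⟩
    refine ⟨_, h₃, fun l => h₂ _ (by omega), ⟨⟨i, hi⟩, ?_⟩, ⟨⟨j, hj⟩, ?_⟩⟩
    · exact hiz.trans (h₁ z (by omega))
    · exact hjy.trans (h₁ y (by omega))
  · rintro ⟨t, ht, hD, ⟨i, hi⟩, ⟨j, hj⟩⟩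
    refine ⟨assignBlock β (z + y + 1) t, fun v hv => assignBlock_of_not_mem hv, fun v hv => ?_,
      ?_, ⟨i, i.2, ?_⟩, ⟨j, j.2, ?_⟩⟩
    · obtain ⟨l, hl⟩ := Nat.exists_eq_add_of_le hv.1
      rw [hl, assignBlock_add _ _ _ ⟨l, by omega⟩]; exact hD _
    · simpa only [assignBlock_add] using ht
    · rw [assignBlock_add, assignBlock_of_not_mem (by omega), hi]
    · rw [assignBlock_add, assignBlock_of_not_mem (by omega), hj]

theorem edist_le_one_of_satIn_distLEOne {z y : ℕ} (h : (distLEOne z y).SatIn A D β) :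
    β z = β y ∨ A.gaifman.Adj (β z) (β y) := by
  simp only [distLEOne, satIn_or, satIn_disj, List.mem_map, List.mem_finRange, true_and,
    exists_exists_eq_and, satIn_link] at h
  rcases h with h | ⟨R, t, ht, -, hz, hy⟩
  · exact .inl h
  · by_cases he : β z = β y
    · exact .inl he
    · exact .inr ⟨he, R, t, ht, hz, hy⟩

theorem edist_le_of_satIn_distLE {r x y : ℕ} (h : (distLE r x y).SatIn A D β) :
    A.gaifman.edist (β x) (β y) ≤ r := by
  induction r generalizing y β with
  | zero =>
    simp only [distLE, SatIn] at h
    simp [h]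
  | succ r ih =>
    simp only [distLE, SatIn, satIn_and] at h
    obtain ⟨b, -, h₁, h₂⟩ := h
    have h₁ := ih h₁
    have h₂ := edist_le_one_of_satIn_distLEOne h₂
    rw [update_self, update_of_ne (by omega)] at h₁ h₂
    exact (PreStructure.edist_le_succ_iff _ _ _ _).2 ⟨b, h₁, h₂⟩

/-- A path of length at most `r` from `β x`, together with the relation tuples that witness its
edges, stays inside the `r`-ball. The hypothesis on `D` is needed only for finding these witnesses;
the other implication holds for every `D`. -/
theorem satIn_distLE {r x y : ℕ} (hD : A.ball r {β x} ⊆ D) :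
    (distLE r x y).SatIn A D β ↔ A.gaifman.edist (β x) (β y) ≤ r := by
  refine ⟨edist_le_of_satIn_distLE, fun h => ?_⟩
  induction r generalizing y β with
  | zero => simpa [distLE, SatIn] using h
  | succ r ih =>
    obtain ⟨z, hz, hzy⟩ := (PreStructure.edist_le_succ_iff _ _ _ _).1 h
    simp only [distLE, SatIn, satIn_and]
    have hx : update β (x + y + 1) z x = β x := update_of_ne (by omega) _ _
    have hy : update β (x + y + 1) z y = β y := update_of_ne (by omega) _ _
    refine ⟨z, hD ⟨_, rfl, hz.trans (by exact_mod_cast Nat.le_succ r)⟩, ih ?_ ?_, ?_⟩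
    · rw [hx]
      exact (PreStructure.ball_mono (Nat.le_succ r) subset_rfl).trans hD
    · rw [hx, update_self]; exact hz
    · simp only [distLEOne, satIn_or, satIn_disj, List.mem_map, List.mem_finRange, true_and,
        exists_exists_eq_and, satIn_link, hy, update_self, SatIn]
      refine hzy.imp_right fun ⟨_, R, t, ht, htz, hty⟩ => ⟨R, t, ht, fun i => ?_, htz, hty⟩
      obtain ⟨j, rfl⟩ := htz
      exact hD ⟨_, rfl, PreStructure.edist_le_add hz
        (PreStructure.edist_le_one_of_mem_rel ht j i) le_rfl⟩

theorem isDistLE_distLE (r x y : ℕ) : (distLE r x y : WFormula V).IsDistLE r x y :=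
  ⟨isFO_distLE r x y, free_distLE_subset r x y, fun _ _ _ =>
    (satIn_univ _ _).symm.trans (satIn_distLE (Set.subset_univ _))⟩

/-- `y` is at distance at most `r` from one of the variables in `X`. -/
def near (r : ℕ) (X : List ℕ) (y : ℕ) : WFormula V := disj (X.map fun x => distLE r x y)

theorem satIn_near {r y : ℕ} {X : List ℕ} (hD : A.ball r (β '' {x | x ∈ X}) ⊆ D) :
    (near r X y).SatIn A D β ↔ β y ∈ A.ball r (β '' {x | x ∈ X}) := by
  simp only [near, satIn_disj, List.mem_map, exists_exists_and_eq_and, PreStructure.ball,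
    Set.mem_ofPred_eq, Set.exists_mem_image]
  refine exists_congr fun x => and_congr_right fun hx => satIn_distLE ?_
  exact (PreStructure.ball_mono le_rfl (by simpa using ⟨x, hx, rfl⟩)).trans hD

theorem free_near_subset (r : ℕ) (X : List ℕ) (y : ℕ) :
    (near r X y : WFormula V).free ⊆ insert y X.toFinset := by
  intro v hv
  simp only [near, mem_free_disj, List.mem_map, exists_exists_and_eq_and] at hv
  obtain ⟨x, hx, hv⟩ := hv
  have := free_distLE_subset r x y hv
  simp only [Finset.mem_insert, Finset.mem_singleton, List.mem_toFinset] at this ⊢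
  rcases this with rfl | rfl <;> tauto

/-! ### Strong locality -/

/-- Locality of `φ` around a possibly empty set of variables, with respect to all substructures
that contain the ball, and without the locality condition on weights. -/
def StronglyLocal (r : ℕ) (X : Set ℕ) (φ : WFormula V) : Prop :=
  ↑φ.free ⊆ X ∧ ∀ (A : PreStructure V) (D : Set A.Univ) (β : ℕ → A.Univ),
    A.ball r (β '' X) ⊆ D → (φ.SatIn A D β ↔ φ.SatIn A Set.univ β)

theorem StronglyLocal.mono {r s : ℕ} {X Y : Set ℕ} (h : φ.StronglyLocal r X) (hr : r ≤ s)
    (hX : X ⊆ Y) : φ.StronglyLocal s Y :=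
  ⟨h.1.trans hX, fun A D β hD =>
    h.2 A D β ((PreStructure.ball_mono hr (Set.image_mono hX)).trans hD)⟩

theorem StronglyLocal.not {r : ℕ} {X : Set ℕ} (h : φ.StronglyLocal r X) :
    (not φ).StronglyLocal r X :=
  ⟨h.1, fun A D β hD => not_congr (h.2 A D β hD)⟩

theorem StronglyLocal.or {r : ℕ} {X : Set ℕ} (h : φ.StronglyLocal r X)
    (h' : ψ.StronglyLocal r X) : (or φ ψ).StronglyLocal r X :=
  ⟨by simpa [free] using ⟨h.1, h'.1⟩,
    fun A D β hD => or_congr (h.2 A D β hD) (h'.2 A D β hD)⟩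

theorem StronglyLocal.and {r : ℕ} {X : Set ℕ} (h : φ.StronglyLocal r X)
    (h' : ψ.StronglyLocal r X) : (and φ ψ).StronglyLocal r X :=
  (h.not.or h'.not).not

theorem StronglyLocal.tt {r : ℕ} {X : Set ℕ} : (tt : WFormula V).StronglyLocal r X :=
  ⟨by simp, by simp⟩

theorem StronglyLocal.ff {r : ℕ} {X : Set ℕ} : (ff : WFormula V).StronglyLocal r X :=
  StronglyLocal.tt.not

theorem StronglyLocal.disj {r : ℕ} {X : Set ℕ} {l : List (WFormula V)}
    (h : ∀ φ ∈ l, φ.StronglyLocal r X) : (disj l).StronglyLocal r X := by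
  induction l with
  | nil => exact StronglyLocal.ff
  | cons φ l ih => exact (h φ (by simp)).or (ih fun ψ hψ => h ψ (by simp [hψ]))

/-- Take `D` to be the ball itself. Non-emptiness of `X` is asked for only by the target notion. -/
theorem StronglyLocal.isLocalAround {r : ℕ} {X : Finset ℕ} (h : φ.StronglyLocal r X)
    (hX : X.Nonempty) : φ.IsLocalAround r X := by
  refine ⟨hX, by exact_mod_cast h.1, fun A _ β hB β' hβ => ?_⟩
  rw [← satIn_univ, sat_induce, ← h.2 A _ β subset_rfl]
  exact satIn_congr φ fun x hx => (hβ x (h.1 hx)).symm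

theorem StronglyLocal.congr {r : ℕ} {X : Set ℕ} (h : φ.StronglyLocal r X)
    {β β' : ℕ → A.Univ} (hβ : ∀ x ∈ X, β x = β' x) :
    φ.SatIn A D β ↔ φ.SatIn A D β' :=
  satIn_congr φ fun x hx => hβ x (h.1 hx)

end WFormula

/-! ### Lists of variables and bounds for fresh variables -/

/-- A strict upper bound for the entries of a list. -/
def listBound (l : List ℕ) : ℕ := l.foldr max 0 + 1

theorem lt_listBound {l : List ℕ} {x : ℕ} (h : x ∈ l) : x < listBound l := by
  induction l with
  | nil => simp at h
  | cons y l ih =>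
    simp only [listBound, List.foldr_cons] at ih ⊢
    rcases List.mem_cons.1 h with rfl | h
    · omega
    · have := ih h
      omega

/-- The list of the variables that occur in a term. -/
def WTerm.vars {V : Vocabulary.{u, v, w}} : {i : V.Ix} → WTerm V i → List ℕ
  | _, const _ => []
  | _, wt _ xs => List.ofFn xs
  | _, add t₁ t₂ => t₁.vars ++ t₂.vars
  | _, sub t₁ t₂ => t₁.vars ++ t₂.vars
  | _, mul _ t₁ t₂ => t₁.vars ++ t₂.vars

theorem WTerm.mem_vars {V : Vocabulary.{u, v, w}} {i : V.Ix} (t : WTerm V i) {x : ℕ} :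
    x ∈ t.vars ↔ x ∈ t.free := by
  induction t with
  | const s => simp [vars, free]
  | wt a xs => simp [vars, free, List.mem_ofFn]
  | add t₁ t₂ h₁ h₂ | sub t₁ t₂ h₁ h₂ | mul _ t₁ t₂ h₁ h₂ => simp [vars, free, h₁, h₂]

namespace WFormula

variable {V : Vocabulary.{u, v, w}} {A : PreStructure V} {D : Set A.Univ}
  {β : ℕ → A.Univ} {φ ψ : WFormula V}

/-- The variables of an atomic formula (none for other formulas). -/
def leafVars : WFormula V → List ℕ
  | eq x y => [x, y]
  | rel _ xs => List.ofFn xs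
  | wtEq _ _ xs => List.ofFn xs
  | pred _ ts _ => (List.ofFn fun j => (ts j).vars).flatten
  | _ => []

/-- The free variables as a list. -/
def freeList : WFormula V → List ℕ
  | not φ => φ.freeList
  | or φ ψ => φ.freeList ++ ψ.freeList
  | ex y φ => φ.freeList.filter fun x => decide (x ∉ [y])
  | sumEq _ _ _ ys φ => φ.freeList.filter fun x => decide (x ∉ List.ofFn ys)
  | φ => φ.leafVars

/-- A strict upper bound for all variables that occur in a formula. -/
def bound : WFormula V → ℕ
  | not φ => φ.bound
  | or φ ψ => max φ.bound ψ.bound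
  | ex y φ => max (listBound [y]) φ.bound
  | sumEq _ _ _ ys φ => max (listBound (List.ofFn ys)) φ.bound
  | φ => listBound φ.leafVars

theorem mem_leafVars_pred {P : V.Pred} {ts : (j : Fin (V.predArity P)) → WTerm V (V.predType P j)}
    {h : (Finset.univ.biUnion fun j => (ts j).free).card ≤ 1} {x : ℕ} :
    x ∈ (pred P ts h).leafVars ↔ x ∈ (pred P ts h).free := by
  simp [leafVars, free, List.mem_flatten, List.mem_ofFn, WTerm.mem_vars]

theorem mem_freeList (φ : WFormula V) {x : ℕ} : x ∈ φ.freeList ↔ x ∈ φ.free := by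
  induction φ with
  | eq x y => simp [freeList, leafVars, free]
  | rel R xs => simp [freeList, leafVars, free, List.mem_ofFn]
  | wtEq a s xs => simp [freeList, leafVars, free, List.mem_ofFn]
  | not φ ih => simpa [freeList, free] using ih
  | or φ ψ ih₁ ih₂ => simp [freeList, free, ih₁, ih₂]
  | ex y φ ih => simp [freeList, free, ih]
  | sumEq a hfin s ys φ ih => simp [freeList, free, ih, List.mem_ofFn]
  | pred P ts h => exact mem_leafVars_pred

theorem toFinset_freeList (φ : WFormula V) : φ.freeList.toFinset = φ.free := by
  ext x; simp [mem_freeList]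

/-! ### Relativization to balls -/

/-- Relativization of all quantifiers and sums to the `r`-ball around the variables in `C`,
which must not be bound in the formula. -/
def relat (C : List ℕ) (r : ℕ) : WFormula V → WFormula V
  | not φ => not (φ.relat C r)
  | or φ ψ => or (φ.relat C r) (ψ.relat C r)
  | ex y φ => ex y (and (conj ([y].map (near r C))) (φ.relat C r))
  | sumEq a hfin s ys φ =>
      sumEq a hfin s ys (and (conj ((List.ofFn ys).map (near r C))) (φ.relat C r))
  | φ => φ

theorem image_update_of_notMem {α : Type*} {β : ℕ → α} {y : ℕ} {b : α} {X : Set ℕ}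
    (hy : y ∉ X) : update β y b '' X = β '' X :=
  Set.image_congr fun x hx => update_of_ne (by rintro rfl; exact hy hx) _ _

theorem image_extend_of_disjoint {α : Type*} {β : ℕ → α} {k : ℕ} {ys : Fin k ↪ ℕ} {b : Fin k → α}
    {X : Set ℕ} (hy : ∀ j, ys j ∉ X) : extend ys b β '' X = β '' X :=
  Set.image_congr fun x hx => extend_apply' _ _ _ (by rintro ⟨j, rfl⟩; exact hy j hx)

/-- The variables in `C` lie above all bound variables of `φ`, so binders change neither their
values nor the ball `B` around them, and `B` stays fixed throughout the induction. -/
theorem satIn_relat {C : List ℕ} {r : ℕ} {B : Set A.Univ} (φ : WFormula V)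
    (hC : ∀ x ∈ C, φ.bound ≤ x) (hB : A.ball r (β '' {x | x ∈ C}) = B) (hD : B ⊆ D) :
    (φ.relat C r).SatIn A D β ↔ φ.SatIn A B β := by
  induction φ generalizing β with
  | eq x y => rfl
  | rel R xs => rfl
  | wtEq a s xs => rfl
  | not φ ih => exact not_congr (ih hC hB)
  | or φ ψ ih₁ ih₂ =>
    exact or_congr (ih₁ (fun x hx => (le_max_left _ _).trans (hC x hx)) hB)
      (ih₂ (fun x hx => (le_max_right _ _).trans (hC x hx)) hB)
  | ex y φ ih =>
    have hy : y ∉ {x | x ∈ C} := fun h => by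
      have := (le_max_left _ _).trans (hC y h)
      exact absurd (lt_listBound (l := [y]) (x := y) (by simp)) (by omega)
    have hB' : ∀ b, A.ball r (update β y b '' {x | x ∈ C}) = B := fun b => by
      rw [image_update_of_notMem hy, hB]
    have := fun b => ih (β := update β y b) (fun x hx => (le_max_right _ _).trans (hC x hx)) (hB' b)
    simp only [relat, SatIn, satIn_and, satIn_conj, List.map_cons, List.map_nil,
      List.mem_singleton, forall_eq, this]
    refine exists_congr fun b => ?_
    rw [satIn_near ((hB' b).trans_subset hD), hB', update_self]
    exact ⟨fun h => ⟨h.2.1, h.2.2⟩, fun h => ⟨hD h.1, h.1, h.2⟩⟩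
  | sumEq a hfin s ys φ ih =>
    have hy : ∀ j, ys j ∉ {x | x ∈ C} := fun j h => by
      have := (le_max_left _ _).trans (hC (ys j) h)
      exact absurd (lt_listBound (l := List.ofFn ys) (x := ys j) (by simp)) (by omega)
    have hB' : ∀ b, A.ball r (extend ys b β '' {x | x ∈ C}) = B := fun b => by
      rw [image_extend_of_disjoint hy, hB]
    have := fun b => ih (β := extend ys b β)
      (fun x hx => (le_max_right _ _).trans (hC x hx)) (hB' b)
    simp only [relat, SatIn, satIn_and, satIn_conj, List.mem_map, List.mem_ofFn,
      exists_exists_eq_and, forall_exists_index, forall_apply_eq_imp_iff, this]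
    rw [Eq.congr_right]
    congr 1
    ext b
    simp only [Set.mem_ofPred_eq, satIn_near ((hB' b).trans_subset hD), hB',
      ys.injective.extend_apply]
    exact ⟨fun h => ⟨h.2.1, h.2.2⟩, fun h => ⟨fun j => hD (h.1 j), h.1, h.2⟩⟩
  | pred P ts h => rfl

theorem free_relat_subset (C : List ℕ) (r : ℕ) (φ : WFormula V) :
    (φ.relat C r).free ⊆ φ.free ∪ C.toFinset := by
  induction φ with
  | eq x y => exact Finset.subset_union_left
  | rel R xs => exact Finset.subset_union_left
  | wtEq a s xs => exact Finset.subset_union_left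
  | not φ ih => exact ih
  | or φ ψ ih₁ ih₂ =>
    simp only [relat, free]
    grind
  | ex y φ ih =>
    intro x hx
    simp only [relat, free, free_and, Finset.mem_sdiff, Finset.mem_union, mem_free_conj,
      List.map_cons, List.map_nil, List.mem_singleton, exists_eq_left, List.mem_toFinset] at hx ⊢
    obtain ⟨h | h, hx⟩ := hx
    · have := free_near_subset _ _ _ h
      simp at this hx
      tauto
    · have := ih h
      simp only [Finset.mem_union, List.mem_toFinset] at this
      tauto
  | sumEq a hfin s ys φ ih =>
    intro x hx
    simp only [relat, free, free_and, Finset.mem_sdiff, Finset.mem_union, mem_free_conj,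
      List.mem_map, exists_exists_and_eq_and, List.mem_toFinset] at hx ⊢
    obtain ⟨⟨y, hy, h⟩ | h, hx⟩ := hx
    · have := free_near_subset _ _ _ h
      simp only [List.mem_ofFn, Finset.mem_image, Finset.mem_univ, true_and,
        Finset.mem_insert, List.mem_toFinset] at this hx hy
      rcases this with rfl | h
      · exact absurd hy hx
      · exact .inr h
    · have := ih h
      simp only [Finset.mem_union, List.mem_toFinset] at this
      tauto
  | pred P ts h => exact Finset.subset_union_left

/-- `∃ x̂ (x̂ = x ∧ φ)` for all `x` in `X`, where `x̂ = x + N`. -/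
def withCopies (X : List ℕ) (N : ℕ) (φ : WFormula V) : WFormula V :=
  X.foldr (fun x ψ => ex (x + N) (and (eq (x + N) x) ψ)) φ

theorem satIn_withCopies {X : List ℕ} {N : ℕ} (hX : ∀ x ∈ X, x < N) (hD : ∀ x ∈ X, β x ∈ D) :
    (withCopies X N φ).SatIn A D β ↔
      φ.SatIn A D fun v => if v ∈ X.map (· + N) then β (v - N) else β v := by
  induction X generalizing β with
  | nil => simp [withCopies]
  | cons x X ih =>
    have hx : x < N := hX x (by simp)
    have hX' : ∀ z ∈ X, z < N := fun z hz => hX z (by simp [hz])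
    have hD' : ∀ b, ∀ z ∈ X, update β (x + N) b z ∈ D := fun b z hz => by
      rw [update_of_ne (by have := hX' z hz; omega)]
      exact hD z (by simp [hz])
    change (∃ b ∈ D, (and (eq (x + N) x) (withCopies X N φ)).SatIn A D _) ↔ _
    simp only [satIn_and, ih hX' (hD' _), SatIn, update_self]
    have hne : ∀ b, update β (x + N) b x = β x := fun b => update_of_ne (by omega) _ _
    simp only [hne]
    have hval : (fun v => if v ∈ X.map (· + N) then update β (x + N) (β x) (v - N)
        else update β (x + N) (β x) v) =
        fun v => if v ∈ (x :: X).map (· + N) then β (v - N) else β v := by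
      ext v
      by_cases hv : v ∈ X.map (· + N)
      · have : v - N ≠ x + N := by
          obtain ⟨z, hz, rfl⟩ := List.mem_map.1 hv
          have := hX' z hz
          omega
        simp [hv, update_of_ne this]
      · by_cases hvx : v = x + N
        · subst hvx; simp [hv]
        · simp [hv, hvx]
    constructor
    · rintro ⟨b, -, rfl, h⟩
      rwa [hval] at h
    · intro h
      exact ⟨β x, hD x (by simp), rfl, by rwa [hval]⟩

theorem free_withCopies_subset {X : List ℕ} {N : ℕ} :
    (withCopies X N φ).free ⊆ (φ.free \ (X.map (· + N)).toFinset) ∪ X.toFinset := by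
  induction X with
  | nil => simp [withCopies]
  | cons x X ih =>
    intro v hv
    change v ∈ (ex (x + N) (and (eq (x + N) x) (withCopies X N φ))).free at hv
    simp only [free, free_and, Finset.mem_sdiff, Finset.mem_union, Finset.mem_insert,
      Finset.mem_singleton] at hv
    obtain ⟨(h | h) | h, hv⟩ := hv
    · exact absurd h hv
    · simp [h]
    · have := ih h
      simp only [Finset.mem_sdiff, Finset.mem_union, List.mem_toFinset, List.map_cons,
        List.mem_cons] at this ⊢
      tauto

/-- The formula that says that `φ` holds in the `r`-ball around the variables in `X`. -/
def inBall (r : ℕ) (X : List ℕ) (φ : WFormula V) : WFormula V :=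
  withCopies X (max φ.bound (listBound X))
    (φ.relat (X.map (· + max φ.bound (listBound X))) r)

theorem free_inBall_subset {r : ℕ} {X : List ℕ} (h : φ.free ⊆ X.toFinset) :
    (inBall r X φ).free ⊆ X.toFinset := by
  refine free_withCopies_subset.trans ?_
  have := free_relat_subset (X.map (· + max φ.bound (listBound X))) r φ
  grind

/-- Variables in `X` may also occur bound in `φ`. Therefore the ball is taken around copies `x + N`
with the same values, where `N` exceeds every variable of `φ` and of `X`, so that no binder of `φ`
captures a copy. -/
theorem satIn_inBall {r : ℕ} {X : List ℕ} (hφ : φ.free ⊆ X.toFinset)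
    (hD : A.ball r (β '' {x | x ∈ X}) ⊆ D) :
    (inBall r X φ).SatIn A D β ↔ φ.SatIn A (A.ball r (β '' {x | x ∈ X})) β := by
  set N := max φ.bound (listBound X) with hN
  have hXN : ∀ x ∈ X, x < N := fun x hx => (lt_listBound hx).trans_le (le_max_right _ _)
  rw [inBall, satIn_withCopies hXN
    fun x hx => hD (PreStructure.subset_ball _ _ ⟨x, hx, rfl⟩)]
  rw [satIn_relat (B := A.ball r (β '' {x | x ∈ X})) φ _ _ hD]
  · refine satIn_congr φ fun x hx => if_neg fun h => ?_
    obtain ⟨z, hz, h⟩ := List.mem_map.1 h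
    have := hXN x (by simpa using hφ hx)
    omega
  · intro x hx
    obtain ⟨z, hz, rfl⟩ := List.mem_map.1 hx
    exact (le_max_left _ _).trans (Nat.le_add_left _ _)
  · congr 1
    ext a
    simp only [Set.mem_image, Set.mem_ofPred_eq]
    constructor
    · rintro ⟨v, hv, rfl⟩
      obtain ⟨z, hz, rfl⟩ := List.mem_map.1 hv
      refine ⟨z, hz, ?_⟩
      rw [if_pos hv, Nat.add_sub_cancel]
    · rintro ⟨z, hz, rfl⟩
      have : z + N ∈ X.map (· + N) := List.mem_map.2 ⟨z, hz, rfl⟩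
      exact ⟨z + N, this, by simp only [if_pos this, Nat.add_sub_cancel]⟩

/-- Relativized to the ball, any formula with free variables in `X` is blind to the rest of the
structure. -/
theorem stronglyLocal_inBall {r : ℕ} {X : List ℕ} (hφ : φ.free ⊆ X.toFinset) :
    (inBall r X φ).StronglyLocal r {x | x ∈ X} := by
  refine ⟨fun x hx => by simpa using free_inBall_subset hφ hx, fun A D β hD => ?_⟩
  rw [satIn_inBall hφ hD, satIn_inBall hφ (Set.subset_univ _)]

end WFormula

namespace WFormula

variable {V : Vocabulary.{u, v, w}} {A : PreStructure V} {D D₁ D₂ : Set A.Univ}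
  {β β' : ℕ → A.Univ} {φ ψ : WFormula V}

/-! ### Case distinctions -/

/-- A case distinction: a list of pairs of a guard and a body. -/
abbrev Cases (V : Vocabulary.{u, v, w}) : Type (max u v w) := List (WFormula V × WFormula V)

/-- The guards (evaluated in `D₁`) exhaust all cases, and under each of them the truth value `T`
is that of the body (evaluated in `D₂`). -/
def Cases.Decides (l : Cases V) (A : PreStructure V) (D₁ D₂ : Set A.Univ) (β : ℕ → A.Univ)
    (T : Prop) : Prop :=
  (∃ c ∈ l, c.1.SatIn A D₁ β) ∧ ∀ c ∈ l, c.1.SatIn A D₁ β → (T ↔ c.2.SatIn A D₂ β)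

namespace Cases

/-- Case distinction over the second components `θ` of the list, for the formula
`base ∨ ⋁ (μ ∧ θ)`, where `(μ, θ)` runs through the list. -/
def expand (base : WFormula V) (l : Cases V) : Cases V :=
  l.foldr (fun c acc => acc.flatMap fun d =>
    [(and c.2 d.1, or c.1 d.2), (and (not c.2) d.1, d.2)]) [(tt, base)]

/-- Exchange of the roles of guards and bodies. -/
def swap (l : Cases V) : Cases V := expand ff l

def neg (l : Cases V) : Cases V := l.map fun c => (c.1, not c.2)

def both (l m : Cases V) : Cases V :=
  l.flatMap fun c => m.map fun d => (and c.1 d.1, and c.2 d.2)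

def either (l m : Cases V) : Cases V :=
  l.flatMap fun c => m.map fun d => (and c.1 d.1, or c.2 d.2)

/-- Disjunction of a list of case distinctions. -/
def any (ls : List (Cases V)) : Cases V := ls.foldr either [(tt, ff)]

variable {l m : Cases V} {T S : Prop}

theorem exists_expand (base : WFormula V) (l : Cases V) :
    ∃ d ∈ expand base l, d.1.SatIn A D β := by
  induction l with
  | nil => exact ⟨_, List.mem_singleton_self _, satIn_tt⟩
  | cons c l ih =>
    obtain ⟨d, hd, h⟩ := ih
    by_cases hc : c.2.SatIn A D β
    · exact ⟨(and c.2 d.1, or c.1 d.2), List.mem_flatMap.2 ⟨d, hd, by simp⟩, by simp [hc, h]⟩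
    · exact ⟨(and (not c.2) d.1, d.2), List.mem_flatMap.2 ⟨d, hd, by simp⟩, by simp [hc, h]⟩

/-- A guard of the expanded list fixes the truth value of every `θ`; the corresponding body keeps
exactly those `μ` whose `θ` was declared true. -/
theorem satIn_expand {base : WFormula V} {d : WFormula V × WFormula V}
    (hd : d ∈ expand base l) (h : d.1.SatIn A D₂ β) :
    d.2.SatIn A D₁ β' ↔
      base.SatIn A D₁ β' ∨ ∃ c ∈ l, c.2.SatIn A D₂ β ∧ c.1.SatIn A D₁ β' := by
  induction l generalizing d with
  | nil =>
    obtain rfl := List.mem_singleton.1 hd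
    simp
  | cons c l ih =>
    obtain ⟨e, he, hd⟩ := List.mem_flatMap.1 hd
    simp only [List.mem_cons, List.not_mem_nil, or_false] at hd
    simp only [List.exists_mem_cons_iff]
    rcases hd with rfl | rfl
    · simp only [satIn_and] at h
      simp only [satIn_or, ih he h.2, h.1, true_and]
      tauto
    · simp only [satIn_and, satIn_not] at h
      simp only [ih he h.2, h.1, false_and, false_or]

theorem mem_free_fst_expand {base : WFormula V} {d : WFormula V × WFormula V}
    (hd : d ∈ expand base l) {x : ℕ} (hx : x ∈ d.1.free) : ∃ c ∈ l, x ∈ c.2.free := by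
  induction l generalizing d with
  | nil =>
    obtain rfl := List.mem_singleton.1 hd
    simp at hx
  | cons c l ih =>
    obtain ⟨e, he, hd⟩ := List.mem_flatMap.1 hd
    simp only [List.mem_cons, List.not_mem_nil, or_false] at hd
    simp only [List.exists_mem_cons_iff]
    rcases hd with rfl | rfl <;> simp only [free_and, free, Finset.mem_union] at hx <;>
      exact hx.imp id (ih he)

theorem mem_free_snd_expand {base : WFormula V} {d : WFormula V × WFormula V}
    (hd : d ∈ expand base l) {x : ℕ} (hx : x ∈ d.2.free) :
    x ∈ base.free ∨ ∃ c ∈ l, x ∈ c.1.free := by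
  induction l generalizing d with
  | nil =>
    obtain rfl := List.mem_singleton.1 hd
    exact .inl hx
  | cons c l ih =>
    obtain ⟨e, he, hd⟩ := List.mem_flatMap.1 hd
    simp only [List.mem_cons, List.not_mem_nil, or_false] at hd
    simp only [List.exists_mem_cons_iff]
    rcases hd with rfl | rfl
    · simp only [free, Finset.mem_union] at hx
      rcases hx with hx | hx
      · exact .inr (.inl hx)
      · exact (ih he hx).imp id .inr
    · exact (ih he hx).imp id .inr

theorem Decides.iff_exists (h : l.Decides A D₁ D₂ β T) :
    T ↔ ∃ c ∈ l, c.1.SatIn A D₁ β ∧ c.2.SatIn A D₂ β := by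
  obtain ⟨⟨c, hc, h₁⟩, h⟩ := h
  exact ⟨fun hT => ⟨c, hc, h₁, (h c hc h₁).1 hT⟩, fun ⟨d, hd, h₁, h₂⟩ => (h d hd h₁).2 h₂⟩

/-- The proposition `T` amounts to the disjunction of all "guard and body", where both sides play
symmetric roles; expanding over the bodies turns them into guards. -/
theorem Decides.swap (h : l.Decides A D₁ D₂ β T) : l.swap.Decides A D₂ D₁ β T := by
  refine ⟨exists_expand _ _, fun d hd h₁ => ?_⟩
  rw [satIn_expand hd h₁, h.iff_exists]
  simp [and_comm]

theorem Decides.neg (h : l.Decides A D₁ D₂ β T) : l.neg.Decides A D₁ D₂ β (¬ T) := by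
  obtain ⟨⟨c, hc, h₁⟩, h⟩ := h
  refine ⟨⟨_, List.mem_map_of_mem hc, h₁⟩, fun d hd h₁ => ?_⟩
  obtain ⟨c, hc, rfl⟩ := List.mem_map.1 hd
  exact not_congr (h c hc h₁)

theorem mem_both {d : WFormula V × WFormula V} :
    d ∈ l.both m ↔ ∃ c ∈ l, ∃ e ∈ m, (and c.1 e.1, and c.2 e.2) = d := by
  simp [both, List.mem_flatMap]

theorem mem_either {d : WFormula V × WFormula V} :
    d ∈ l.either m ↔ ∃ c ∈ l, ∃ e ∈ m, (and c.1 e.1, or c.2 e.2) = d := by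
  simp [either, List.mem_flatMap]

theorem Decides.both (h : l.Decides A D₁ D₂ β T) (h' : m.Decides A D₁ D₂ β S) :
    (l.both m).Decides A D₁ D₂ β (T ∧ S) := by
  obtain ⟨⟨c, hc, h₁⟩, h⟩ := h
  obtain ⟨⟨c', hc', h₁'⟩, h'⟩ := h'
  refine ⟨⟨_, mem_both.2 ⟨c, hc, c', hc', rfl⟩, by simp [h₁, h₁']⟩, fun d hd hd₁ => ?_⟩
  obtain ⟨c, hc, c', hc', rfl⟩ := mem_both.1 hd
  rw [satIn_and] at hd₁
  rw [h c hc hd₁.1, h' c' hc' hd₁.2, satIn_and]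

theorem Decides.either (h : l.Decides A D₁ D₂ β T) (h' : m.Decides A D₁ D₂ β S) :
    (l.either m).Decides A D₁ D₂ β (T ∨ S) := by
  obtain ⟨⟨c, hc, h₁⟩, h⟩ := h
  obtain ⟨⟨c', hc', h₁'⟩, h'⟩ := h'
  refine ⟨⟨_, mem_either.2 ⟨c, hc, c', hc', rfl⟩, by simp [h₁, h₁']⟩, fun d hd hd₁ => ?_⟩
  obtain ⟨c, hc, c', hc', rfl⟩ := mem_either.1 hd
  rw [satIn_and] at hd₁
  rw [h c hc hd₁.1, h' c' hc' hd₁.2, satIn_or]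

theorem Decides.any {ι : Type*} {L : List ι} {f : ι → Cases V} {T : ι → Prop}
    (h : ∀ i ∈ L, (f i).Decides A D₁ D₂ β (T i)) :
    (any (L.map f)).Decides A D₁ D₂ β (∃ i ∈ L, T i) := by
  induction L with
  | nil => exact ⟨⟨_, List.mem_singleton_self _, satIn_tt⟩, by simp [Cases.any]⟩
  | cons i L ih =>
    simp only [List.exists_mem_cons_iff]
    exact (h i (by simp)).either (ih fun j hj => h j (by simp [hj]))

/-- The bodies are put under a binder. -/
def mapBody (f : WFormula V → WFormula V) (l : Cases V) : Cases V := l.map fun c => (c.1, f c.2)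

/-- The free variables of the guards lie in `X`, those of the bodies in `Y`. -/
def FreeIn (l : Cases V) (X Y : Set ℕ) : Prop :=
  ∀ c ∈ l, (∀ x ∈ c.1.free, x ∈ X) ∧ ∀ x ∈ c.2.free, x ∈ Y

variable {X Y : Set ℕ}

theorem FreeIn.swap (h : l.FreeIn X Y) : l.swap.FreeIn Y X := fun d hd =>
  ⟨fun x hx => by
    obtain ⟨c, hc, hx⟩ := mem_free_fst_expand hd hx
    exact (h c hc).2 x hx,
   fun x hx => by
    obtain hx | ⟨c, hc, hx⟩ := mem_free_snd_expand hd hx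
    · simp at hx
    · exact (h c hc).1 x hx⟩

theorem FreeIn.mono {X' Y' : Set ℕ} (h : l.FreeIn X Y) (hX : X ⊆ X') (hY : Y ⊆ Y') :
    l.FreeIn X' Y' :=
  fun c hc => ⟨fun x hx => hX ((h c hc).1 x hx), fun x hx => hY ((h c hc).2 x hx)⟩

theorem FreeIn.both (h : l.FreeIn X Y) (h' : m.FreeIn X Y) : (l.both m).FreeIn X Y := by
  intro d hd
  obtain ⟨c, hc, e, he, rfl⟩ := mem_both.1 hd
  have := h c hc
  have := h' e he
  simp only [free_and, Finset.mem_union]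
  grind

theorem FreeIn.either (h : l.FreeIn X Y) (h' : m.FreeIn X Y) : (l.either m).FreeIn X Y := by
  intro d hd
  obtain ⟨c, hc, e, he, rfl⟩ := mem_either.1 hd
  have := h c hc
  have := h' e he
  simp only [free_and, free, Finset.mem_union]
  grind

theorem FreeIn.any {ι : Type*} {L : List ι} {f : ι → Cases V}
    (h : ∀ i ∈ L, (f i).FreeIn X Y) : (any (L.map f)).FreeIn X Y := by
  induction L with
  | nil =>
    intro c hc
    obtain rfl := List.mem_singleton.1 hc
    simp
  | cons i L ih => exact (h i (by simp)).either (ih fun j hj => h j (by simp [hj]))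

theorem FreeIn.mapBody {Y' : Set ℕ} {f : WFormula V → WFormula V} (h : l.FreeIn X Y)
    (hf : ∀ φ : WFormula V, (∀ x ∈ φ.free, x ∈ Y) → ∀ x ∈ (f φ).free, x ∈ Y') :
    (l.mapBody f).FreeIn X Y' := by
  intro d hd
  obtain ⟨c, hc, rfl⟩ := List.mem_map.1 hd
  exact ⟨(h c hc).1, hf _ (h c hc).2⟩

end Cases

/-! ### Decomposition over two separated parts -/

/-- No tuple of a relation, and no tuple of non-zero weight, meets both parts. -/
structure Separated (A : PreStructure V) (D₁ D₂ : Set A.Univ) : Prop where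
  disjoint : Disjoint D₁ D₂
  rel : ∀ R, ∀ t ∈ A.rel R, ∀ i j, t i ∈ D₁ → t j ∉ D₂
  wt : ∀ a t, A.wt a t ≠ 0 → ∀ i j, t i ∈ D₁ → t j ∉ D₂

/-- The formulas `(s₁ = ∑ …)`, `(s₂ = ∑ …)` with `s₁ + s₂ = s`, for a formula `(s = ∑ …)`. -/
noncomputable def sumSplits : WFormula V → List (WFormula V × WFormula V)
  | sumEq a hfin s ys φ =>
      have := Fintype.ofFinite (V.Elem (V.wtType a))
      Finset.univ.toList.map fun s₁ =>
        (sumEq a hfin s₁ ys φ, sumEq a hfin (s - s₁) ys φ)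
  | _ => []

/-- Replaces the immediate subformula of a formula that starts with `¬` or a binder. -/
def setBody : WFormula V → WFormula V → WFormula V
  | not _, ψ => not ψ
  | ex y _, ψ => ex y ψ
  | sumEq a hfin s ys _, ψ => sumEq a hfin s ys ψ
  | φ, _ => φ

open Classical in
/-- The formula `0 = w(x)`. -/
noncomputable def isWtEqZero : WFormula V → Bool
  | wtEq _ s _ => decide (s = 0)
  | _ => false

/-- An atom over the first part is settled by the guard, an atom over the second part becomes the
body. An atom that mixes the parts has a fixed truth value, and only `0 = w(x̄)` is then true. An
atom without variables falls under the first case. -/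
noncomputable def splitLeaf (L : List ℕ) (φ : WFormula V) : Cases V :=
  if ∀ x ∈ φ.leafVars, x ∈ L then [(φ, tt), (not φ, ff)]
  else if ∀ x ∈ φ.leafVars, x ∉ L then [(tt, φ)]
  else [(tt, if φ.isWtEqZero then tt else ff)]

/-- The cases for a formula `φ` that starts with a binder, from the cases `l` and `m` for its body
where the bound variables range over the first and over the second part, respectively. -/
noncomputable def splitEx (φ : WFormula V) (l m : Cases V) : Cases V :=
  ((l.swap.mapBody φ.setBody).swap).either (m.mapBody φ.setBody)

/-- A disjunction over the ways to write the value as the sum of two partial sums. As in `splitEx`,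
a binder may be put in front of bodies only if the guards do not mention its variables. For
variables in the first part the cases are therefore swapped, bound, and swapped back. -/
noncomputable def splitSum (φ : WFormula V) (l m : Cases V) : Cases V :=
  Cases.any (φ.sumSplits.map fun p =>
    ((l.swap.mapBody p.1.setBody).swap).both (m.mapBody p.2.setBody))

/-- The decomposition of a formula over two separated parts of a structure: the variables in `L`
range over the first part, the others over the second part. -/
noncomputable def split : WFormula V → List ℕ → Cases V
  | not φ, L => (φ.split L).neg
  | or φ ψ, L => (φ.split L).either (ψ.split L)
  | ex y φ, L => splitEx (ex y φ) (φ.split ([y] ++ L))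
      (φ.split (L.filter fun x => decide (x ∉ [y])))
  | sumEq a hfin s ys φ, L => splitSum (sumEq a hfin s ys φ) (φ.split (List.ofFn ys ++ L))
      (φ.split (L.filter fun x => decide (x ∉ List.ofFn ys)))
  | φ, L => φ.splitLeaf L

theorem freeIn_splitLeaf {L : List ℕ} (h : ∀ x, x ∈ φ.leafVars ↔ x ∈ φ.free) :
    (φ.splitLeaf L).FreeIn {x | x ∈ φ.free ∧ x ∈ L} {x | x ∈ φ.free ∧ x ∉ L} := by
  intro c hc
  simp only [splitLeaf, h] at hc
  split_ifs at hc with h₁ h₂ <;>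
    simp only [List.mem_cons, List.not_mem_nil, or_false] at hc
  · rcases hc with rfl | rfl <;> simpa [free] using fun x hx => ⟨hx, h₁ x hx⟩
  · subst hc; simpa using fun x hx => ⟨hx, h₂ x hx⟩
  all_goals subst hc; simp

/-- The guards avoid variables of the second part and, after a swap, those of the first. This is
what lets a binder over one part pass the guards. -/
theorem freeIn_split (φ : WFormula V) (L : List ℕ) :
    (φ.split L).FreeIn {x | x ∈ φ.free ∧ x ∈ L} {x | x ∈ φ.free ∧ x ∉ L} := by
  induction φ generalizing L with
  | eq x y => exact freeIn_splitLeaf fun x => mem_freeList (eq _ _)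
  | rel R xs => exact freeIn_splitLeaf fun x => mem_freeList (rel _ _)
  | wtEq a s xs => exact freeIn_splitLeaf fun x => mem_freeList (wtEq _ _ _)
  | pred P ts h => exact freeIn_splitLeaf fun x => mem_freeList (pred _ _ _)
  | not φ ih => exact (ih L).mapBody fun _ h => h
  | or φ ψ ih₁ ih₂ =>
    refine ((ih₁ L).mono ?_ ?_).either ((ih₂ L).mono ?_ ?_) <;> intro x <;>
      simp +contextual [free]
  | ex y φ ih =>
    refine Cases.FreeIn.either (((ih _).swap.mapBody
      (Y' := {x | x ∈ φ.free ∧ x ≠ y ∧ x ∈ L}) ?_).swap.mono ?_ ?_)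
      (((ih _).mapBody (Y' := {x | x ∈ φ.free ∧ x ≠ y ∧ x ∉ L}) ?_).mono ?_ ?_)
    · intro ψ hψ x hx
      simp only [setBody, free, Finset.mem_sdiff, Finset.mem_singleton] at hx
      have := hψ x hx.1
      simp_all
    · intro x; simp +contextual [free]
    · intro x; simp +contextual [free]
    · intro ψ hψ x hx
      simp only [setBody, free, Finset.mem_sdiff, Finset.mem_singleton] at hx
      have := hψ x hx.1
      simp_all
    · intro x; simp +contextual [free]
    · intro x; simp +contextual [free]
  | sumEq a hfin s ys φ ih =>
    refine Cases.FreeIn.any fun p hp => ?_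
    simp only [sumSplits, List.mem_map] at hp
    obtain ⟨s₁, -, rfl⟩ := hp
    refine Cases.FreeIn.both (((ih _).swap.mapBody
      (Y' := {x | x ∈ φ.free ∧ x ∉ List.ofFn ys ∧ x ∈ L}) ?_).swap.mono ?_ ?_)
      (((ih _).mapBody (Y' := {x | x ∈ φ.free ∧ x ∉ List.ofFn ys ∧ x ∉ L}) ?_).mono ?_ ?_)
    · intro ψ hψ x hx
      simp only [setBody, free, Finset.mem_sdiff, Finset.mem_image, Finset.mem_univ,
        true_and] at hx
      have := hψ x hx.1
      simp only [List.mem_append, List.mem_ofFn, Set.mem_ofPred_eq] at this ⊢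
      tauto
    · intro x; simp +contextual [free]
    · intro x; simp +contextual [free]
    · intro ψ hψ x hx
      simp only [setBody, free, Finset.mem_sdiff, Finset.mem_image, Finset.mem_univ,
        true_and] at hx
      have := hψ x hx.1
      simp only [List.mem_filter, decide_eq_true_eq, List.mem_ofFn, Set.mem_ofPred_eq] at this ⊢
      tauto
    · intro x; simp +contextual [free]
    · intro x; simp +contextual [free]

theorem exists_splitLeaf (L : List ℕ) (φ : WFormula V) :
    ∃ c ∈ φ.splitLeaf L, c.1.SatIn A D β := by
  unfold splitLeaf
  split_ifs <;> simp
  exact em _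

theorem Cases.exists_either {l m : Cases V} (h : ∃ c ∈ l, c.1.SatIn A D β)
    (h' : ∃ c ∈ m, c.1.SatIn A D β) : ∃ c ∈ l.either m, c.1.SatIn A D β := by
  obtain ⟨c, hc, h⟩ := h
  obtain ⟨d, hd, h'⟩ := h'
  exact ⟨_, mem_either.2 ⟨c, hc, d, hd, rfl⟩, by simp [h, h']⟩

theorem Cases.exists_both {l m : Cases V} (h : ∃ c ∈ l, c.1.SatIn A D β)
    (h' : ∃ c ∈ m, c.1.SatIn A D β) : ∃ c ∈ l.both m, c.1.SatIn A D β := by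
  obtain ⟨c, hc, h⟩ := h
  obtain ⟨d, hd, h'⟩ := h'
  exact ⟨_, mem_both.2 ⟨c, hc, d, hd, rfl⟩, by simp [h, h']⟩

theorem Cases.exists_any {ι : Type*} {L : List ι} {f : ι → Cases V}
    (h : ∀ i, ∃ c ∈ f i, c.1.SatIn A D β) : ∃ c ∈ any (L.map f), c.1.SatIn A D β := by
  induction L with
  | nil => exact ⟨_, List.mem_singleton_self _, satIn_tt⟩
  | cons i L ih => exact exists_either (h i) ih

theorem Cases.exists_mapBody {l : Cases V} {f : WFormula V → WFormula V}
    (h : ∃ c ∈ l, c.1.SatIn A D β) : ∃ c ∈ l.mapBody f, c.1.SatIn A D β := by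
  obtain ⟨c, hc, h⟩ := h
  exact ⟨_, List.mem_map_of_mem hc, h⟩

/-- The guards of a decomposition are exhaustive, whatever the structure. -/
theorem exists_split (φ : WFormula V) (L : List ℕ) : ∃ c ∈ φ.split L, c.1.SatIn A D β := by
  induction φ generalizing L with
  | eq x y => exact exists_splitLeaf _ _
  | rel R xs => exact exists_splitLeaf _ _
  | wtEq a s xs => exact exists_splitLeaf _ _
  | pred P ts h => exact exists_splitLeaf _ _
  | not φ ih => exact Cases.exists_mapBody (ih L)
  | or φ ψ ih₁ ih₂ => exact Cases.exists_either (ih₁ L) (ih₂ L)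
  | ex y φ ih => exact Cases.exists_either (Cases.exists_expand _ _) (Cases.exists_mapBody (ih _))
  | sumEq a hfin s ys φ ih =>
    exact Cases.exists_any fun p =>
      Cases.exists_both (Cases.exists_expand _ _) (Cases.exists_mapBody (ih _))

/-- Case distinctions whose guards do not depend on the bound variables, under a binder. -/
theorem Cases.Decides.mapBody {l : Cases V} {f : WFormula V → WFormula V} {T : Prop}
    (hl : ∃ c ∈ l, c.1.SatIn A D₁ β)
    (h : ∀ c ∈ l, c.1.SatIn A D₁ β → (T ↔ (f c.2).SatIn A D₂ β)) :
    (l.mapBody f).Decides A D₁ D₂ β T := by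
  refine ⟨Cases.exists_mapBody hl, fun d hd h₁ => ?_⟩
  obtain ⟨c, hc, rfl⟩ := List.mem_map.1 hd
  exact h c hc h₁

theorem decides_splitLeaf {L : List ℕ} (h : ∀ x, x ∈ φ.leafVars ↔ x ∈ φ.free)
    (hD : φ.SatIn A (D₁ ∪ D₂) β ↔ φ.SatIn A D₁ β) (hD' : φ.SatIn A D₁ β ↔ φ.SatIn A D₂ β)
    (hmix : ∀ x ∈ φ.free, x ∈ L → ∀ y ∈ φ.free, y ∉ L →
      (φ.SatIn A (D₁ ∪ D₂) β ↔ φ.isWtEqZero = true)) :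
    (φ.splitLeaf L).Decides A D₁ D₂ β (φ.SatIn A (D₁ ∪ D₂) β) := by
  refine ⟨exists_splitLeaf _ _, fun c hc h₁ => ?_⟩
  simp only [splitLeaf, h] at hc
  split_ifs at hc with h₂ h₃ h₄ <;>
    simp only [List.mem_cons, List.not_mem_nil, or_false] at hc
  · rcases hc with rfl | rfl
    · simpa [hD] using h₁
    · simpa [hD] using h₁
  · subst hc
    rw [hD, hD']
  · push Not at h₂ h₃
    obtain ⟨y, hy, hyL⟩ := h₂
    obtain ⟨x, hx, hxL⟩ := h₃
    subst hc
    simpa [h₄] using hmix x hx hxL y hy hyL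
  · push Not at h₂ h₃
    obtain ⟨y, hy, hyL⟩ := h₂
    obtain ⟨x, hx, hxL⟩ := h₃
    subst hc
    simpa [h₄] using hmix x hx hxL y hy hyL

/-- A Feferman–Vaught argument for the union of two separated parts: mixed atoms are trivial, and a
bound variable, or a bound tuple of non-zero weight, ranges over one of the two parts. -/
theorem decides_split (hsep : Separated A D₁ D₂) (φ : WFormula V) (L : List ℕ)
    (hβ : ∀ x ∈ φ.free, (x ∈ L → β x ∈ D₁) ∧ (x ∉ L → β x ∈ D₂)) :
    (φ.split L).Decides A D₁ D₂ β (φ.SatIn A (D₁ ∪ D₂) β) := by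
  induction φ generalizing L β with
  | eq x y =>
    refine decides_splitLeaf (fun x => mem_freeList (eq _ _)) Iff.rfl Iff.rfl ?_
    intro x' hx' hL y' hy' hL'
    have h₁ := (hβ x' hx').1 hL
    have h₂ := (hβ y' hy').2 hL'
    simp only [SatIn, isWtEqZero, Bool.false_eq_true, iff_false]
    intro h
    have : β x' = β y' := by
      simp only [free, Finset.mem_insert, Finset.mem_singleton] at hx' hy'
      rcases hx' with rfl | rfl <;> rcases hy' with rfl | rfl <;> simp [h]
    rw [this] at h₁
    exact Set.disjoint_left.1 hsep.disjoint h₁ h₂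
  | rel R xs =>
    refine decides_splitLeaf (fun x => mem_freeList (rel _ _)) Iff.rfl Iff.rfl ?_
    intro x' hx' hL y' hy' hL'
    have h₁ := (hβ x' hx').1 hL
    have h₂ := (hβ y' hy').2 hL'
    simp only [SatIn, isWtEqZero, Bool.false_eq_true, iff_false]
    intro h
    simp only [free, Finset.mem_image, Finset.mem_univ, true_and] at hx' hy'
    obtain ⟨i, rfl⟩ := hx'
    obtain ⟨j, rfl⟩ := hy'
    exact hsep.rel R _ h i j h₁ h₂
  | wtEq a s xs =>
    refine decides_splitLeaf (fun x => mem_freeList (wtEq _ _ _)) Iff.rfl Iff.rfl ?_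
    intro x' hx' hL y' hy' hL'
    have h₁ := (hβ x' hx').1 hL
    have h₂ := (hβ y' hy').2 hL'
    simp only [free, Finset.mem_image, Finset.mem_univ, true_and] at hx' hy'
    obtain ⟨i, rfl⟩ := hx'
    obtain ⟨j, rfl⟩ := hy'
    -- The tuple meets both parts, so its weight vanishes and the atom says `s = 0`.
    have : A.wt a (fun j => β (xs j)) = 0 := by
      by_contra hne
      exact hsep.wt a _ hne i j h₁ h₂
    simp [SatIn, isWtEqZero, this]
  | pred P ts h =>
    refine decides_splitLeaf (fun x => mem_freeList (pred _ _ _)) Iff.rfl Iff.rfl ?_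
    intro x' hx' hL y' hy' hL'
    -- A predicate atom has at most one variable, which cannot lie both in `L` and outside it.
    have : x' = y' := Finset.card_le_one.1 h _ hx' _ hy'
    exact absurd hL (this ▸ hL')
  | not φ ih => exact (ih L hβ).neg
  | or φ ψ ih₁ ih₂ =>
    simp only [free, Finset.mem_union] at hβ
    exact (ih₁ L fun x hx => hβ x (.inl hx)).either (ih₂ L fun x hx => hβ x (.inr hx))
  | ex y φ ih =>
    have hβ' : ∀ x ∈ φ.free, x ≠ y → (x ∈ L → β x ∈ D₁) ∧ (x ∉ L → β x ∈ D₂) :=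
      fun x hx hxy => hβ x (by simp [free, hx, hxy])
    have h₁ : ∀ b ∈ D₁, (φ.split ([y] ++ L)).Decides A D₁ D₂ (update β y b)
        (φ.SatIn A (D₁ ∪ D₂) (update β y b)) := fun b hb => ih _ fun x hx => by
      by_cases hxy : x = y
      · subst hxy; simpa using hb
      · simpa [hxy] using hβ' x hx hxy
    have h₂ : ∀ b ∈ D₂, (φ.split (L.filter fun x => decide (x ∉ [y]))).Decides A D₁ D₂
        (update β y b) (φ.SatIn A (D₁ ∪ D₂) (update β y b)) := fun b hb => ih _ fun x hx => by
      by_cases hxy : x = y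
      · subst hxy; simpa using hb
      · simpa [hxy] using hβ' x hx hxy
    have hex : (ex y φ).SatIn A (D₁ ∪ D₂) β ↔
        (∃ b ∈ D₁, φ.SatIn A (D₁ ∪ D₂) (update β y b)) ∨
          ∃ b ∈ D₂, φ.SatIn A (D₁ ∪ D₂) (update β y b) := by
      simp only [SatIn, Set.mem_union, or_and_right, exists_or]
    rw [hex]
    refine Cases.Decides.either (Cases.Decides.swap (Cases.Decides.mapBody
      (Cases.exists_expand _ _) fun c hc hc₁ => ?_))
      (Cases.Decides.mapBody (exists_split _ _) fun c hc hc₁ => ?_)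
    · refine exists_congr fun b => and_congr_right fun hb => (h₁ b hb).swap.2 c hc ?_
      -- The guard is known to hold under `β`; as it does not mention `y`, it also holds under the
      -- updated assignment.
      refine (satIn_congr (β := β) _ fun x hx => (update_of_ne ?_ _ _).symm).1 hc₁
      rintro rfl
      exact ((freeIn_split φ _).swap c hc).1 _ hx |>.2 (by simp)
    · refine exists_congr fun b => and_congr_right fun hb => (h₂ b hb).2 c hc ?_
      refine (satIn_congr (β := β) _ fun x hx => (update_of_ne ?_ _ _).symm).1 hc₁
      rintro rfl
      simpa using ((freeIn_split φ _) c hc).1 _ hx |>.2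
  | sumEq a hfin s ys φ ih =>
    have hβ' : ∀ x ∈ φ.free, (¬ ∃ j, ys j = x) → (x ∈ L → β x ∈ D₁) ∧ (x ∉ L → β x ∈ D₂) :=
      fun x hx hxy => hβ x (by simpa [free, hx] using hxy)
    have h₁ : ∀ b : Fin (V.wtArity a) → A.Univ, (∀ j, b j ∈ D₁) →
        (φ.split (List.ofFn ys ++ L)).Decides A D₁ D₂ (extend ys b β)
        (φ.SatIn A (D₁ ∪ D₂) (extend ys b β)) := fun b hb => ih _ fun x hx => by
      by_cases hxy : ∃ j, ys j = x
      · obtain ⟨j, rfl⟩ := hxy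
        simpa [ys.injective.extend_apply] using hb j
      · rw [extend_apply' _ _ _ hxy]
        simpa [List.mem_ofFn, hxy] using hβ' x hx hxy
    have h₂ : ∀ b : Fin (V.wtArity a) → A.Univ, (∀ j, b j ∈ D₂) →
        (φ.split (L.filter fun x => decide (x ∉ List.ofFn ys))).Decides A D₁ D₂
        (extend ys b β) (φ.SatIn A (D₁ ∪ D₂) (extend ys b β)) := fun b hb => ih _ fun x hx => by
      by_cases hxy : ∃ j, ys j = x
      · obtain ⟨j, rfl⟩ := hxy
        simpa [ys.injective.extend_apply] using hb j
      · rw [extend_apply' _ _ _ hxy]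
        simpa [List.mem_ofFn, not_exists.1 hxy] using hβ' x hx hxy
    let P := fun D : Set A.Univ => {b : Fin (V.wtArity a) → A.Univ |
      (∀ j, b j ∈ D) ∧ φ.SatIn A (D₁ ∪ D₂) (extend ys b β)}
    -- Mixed tuples have weight zero. Disjointness of the two remaining index sets uses that the
    -- arity is positive.
    have hsum : A.wsum a (P (D₁ ∪ D₂)) = A.wsum a (P D₁) + A.wsum a (P D₂) := by
      rw [← PreStructure.wsum_union]
      · refine PreStructure.wsum_congr fun b hb => ?_
        simp only [P, Set.mem_union, Set.mem_ofPred_eq, ← or_and_right]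
        refine and_congr_left fun _ => ⟨fun h => ?_, ?_⟩
        · by_cases h₁ : ∀ j, b j ∈ D₁
          · exact .inl h₁
          · push Not at h₁
            obtain ⟨i, hi⟩ := h₁
            exact .inr fun j => (h j).resolve_left fun hj =>
              hsep.wt a b hb j i hj ((h i).resolve_left hi)
        · rintro (h | h) j
          · exact .inl (h j)
          · exact .inr (h j)
      · rw [Set.disjoint_left]
        intro b hb hb'
        exact Set.disjoint_left.1 hsep.disjoint (hb.1 ⟨0, V.wtArity_pos a⟩)
          (hb'.1 ⟨0, V.wtArity_pos a⟩)
    -- The first partial sum is guessed among the finitely many elements of the type; the second is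
    -- then determined.
    have hsat : (sumEq a hfin s ys φ).SatIn A (D₁ ∪ D₂) β ↔
        ∃ p ∈ (sumEq a hfin s ys φ).sumSplits, ∃ s₁, p = (sumEq a hfin s₁ ys φ,
          sumEq a hfin (s - s₁) ys φ) ∧ s₁ = A.wsum a (P D₁) ∧ s - s₁ = A.wsum a (P D₂) := by
      change s = A.wsum a (P (D₁ ∪ D₂)) ↔ _
      rw [hsum]
      simp only [sumSplits, List.mem_map, Finset.mem_toList, Finset.mem_univ, true_and]
      constructor
      · rintro h
        exact ⟨_, ⟨_, rfl⟩, _, rfl, rfl, by rw [h]; abel⟩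
      · rintro ⟨p, -, s₁, -, h, h'⟩
        rw [← h, ← h']; abel
    rw [hsat]
    refine Cases.Decides.any fun p hp => ?_
    simp only [sumSplits, List.mem_map, Finset.mem_toList, Finset.mem_univ, true_and] at hp
    obtain ⟨s₁, rfl⟩ := hp
    have hone : (∃ s₁', (sumEq a hfin s₁ ys φ, sumEq a hfin (s - s₁) ys φ) =
        (sumEq a hfin s₁' ys φ, sumEq a hfin (s - s₁') ys φ) ∧
          s₁' = A.wsum a (P D₁) ∧ s - s₁' = A.wsum a (P D₂)) ↔
        (s₁ = A.wsum a (P D₁) ∧ s - s₁ = A.wsum a (P D₂)) := by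
      constructor
      · rintro ⟨s₁', h, h'⟩
        simp only [Prod.mk.injEq, sumEq.injEq, heq_eq_eq, true_and, and_true] at h
        rwa [h.1]
      · exact fun h => ⟨s₁, rfl, h⟩
    rw [hone]
    refine Cases.Decides.both (Cases.Decides.swap (Cases.Decides.mapBody
      (Cases.exists_expand _ _) fun c hc hc₁ => ?_))
      (Cases.Decides.mapBody (exists_split _ _) fun c hc hc₁ => ?_)
    · refine Eq.congr_right (congrArg _ (Set.ext fun b => ?_))
      refine and_congr_right fun hb => (h₁ b hb).swap.2 c hc ?_
      refine (satIn_congr (β := β) _ fun x hx => (extend_apply' _ _ _ ?_).symm).1 hc₁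
      rintro ⟨j, rfl⟩
      exact ((freeIn_split φ _).swap c hc).1 _ hx |>.2 (by simp)
    · refine Eq.congr_right (congrArg _ (Set.ext fun b => ?_))
      refine and_congr_right fun hb => (h₂ b hb).2 c hc ?_
      refine (satIn_congr (β := β) _ fun x hx => (extend_apply' _ _ _ ?_).symm).1 hc₁
      rintro ⟨j, rfl⟩
      simpa using ((freeIn_split φ _) c hc).1 _ hx |>.2

end WFormula

/-! ### Balls at great distance are separated -/

namespace PreStructure

variable {V : Vocabulary.{u, v, w}} {A : PreStructure V}

/-- Each clause of the locality condition (arity one, constant tuple, common relation tuple) bounds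
the diameter of a tuple of non-zero weight by 1. -/
theorem IsWeighted.edist_le_one (hA : A.IsWeighted) {a : Fin V.numWt}
    {t : Fin (V.wtArity a) → A.Univ} (h : A.wt a t ≠ 0) (i j : Fin (V.wtArity a)) :
    A.gaifman.edist (t i) (t j) ≤ (1 : ℕ) := by
  rcases hA a t h with h | h | ⟨R, b, hb, h⟩
  · have : i = j := by ext; omega
    simp [this]
  · simp [h i j]
  · obtain ⟨i', hi⟩ := h ⟨i, rfl⟩
    obtain ⟨j', hj⟩ := h ⟨j, rfl⟩
    rw [← hi, ← hj]
    exact edist_le_one_of_mem_rel hb i' j'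

/-- Centres at distance greater than `2 * r + 1` leave distance at least 2 between points of the two
balls, whereas tuples of relations and of non-zero weight have diameter at most 1. -/
theorem IsWeighted.separated (hA : A.IsWeighted) {r : ℕ} {X Y : Set A.Univ}
    (h : ∀ x ∈ X, ∀ y ∈ Y, ¬ A.gaifman.edist x y ≤ (2 * r + 1 : ℕ)) :
    WFormula.Separated A (A.ball r X) (A.ball r Y) := by
  have key : ∀ u ∈ A.ball r X, ∀ v ∈ A.ball r Y, ¬ A.gaifman.edist u v ≤ (1 : ℕ) := by
    rintro u ⟨x, hx, hxu⟩ v ⟨y, hy, hyv⟩ huv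
    rw [SimpleGraph.edist_comm] at hyv
    exact h x hx y hy (edist_le_add (edist_le_add hxu huv le_rfl) hyv (by omega))
  exact ⟨Set.disjoint_left.2 fun u hu hu' => key u hu u hu' (by simp),
    fun R t ht i j hi hj => key _ hi _ hj (edist_le_one_of_mem_rel ht i j),
    fun a t ht i j hi hj => key _ hi _ hj (hA.edist_le_one ht i j)⟩

end PreStructure

namespace WFormula

variable {V : Vocabulary.{u, v, w}} {A : PreStructure V} {D : Set A.Univ}
  {β : ℕ → A.Univ} {φ ψ lam : WFormula V} {r R : ℕ} {X Y : List ℕ}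

/-! ### Decomposition of local formulas -/

/-- The decomposition of a local formula with variables `X` and `Y` at great distance. -/
noncomputable def splitBalls (r : ℕ) (X Y : List ℕ) (lam : WFormula V) : Cases V :=
  (lam.split X).map fun c => (inBall r X c.1, inBall r Y c.2)

theorem exists_splitBalls : ∃ c ∈ splitBalls r X Y lam, c.1.SatIn A Set.univ β := by
  obtain ⟨c, hc, h⟩ := exists_split (A := A) (D := A.ball r (β '' {x | x ∈ X})) (β := β) lam X
  refine ⟨_, List.mem_map_of_mem hc, (satIn_inBall ?_ (Set.subset_univ _)).2 h⟩
  intro x hx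
  simpa using ((freeIn_split lam X c hc).1 x hx).2

theorem free_subset_of_mem_split (hlam : lam.StronglyLocal r {x | x ∈ X ∨ x ∈ Y})
    {c : WFormula V × WFormula V} (hc : c ∈ lam.split X) :
    c.1.free ⊆ X.toFinset ∧ c.2.free ⊆ Y.toFinset := by
  refine ⟨fun x hx => by simpa using ((freeIn_split lam X c hc).1 x hx).2, fun x hx => ?_⟩
  have := (freeIn_split lam X c hc).2 x hx
  exact List.mem_toFinset.2 ((hlam.1 this.1).resolve_left this.2)

/-- By locality `lam` may be evaluated in the union of the two balls, which are separated, so the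
decomposition applies. -/
theorem satIn_splitBalls (hA : A.IsWeighted) (hlam : lam.StronglyLocal r {x | x ∈ X ∨ x ∈ Y})
    (hfar : ∀ x ∈ X, ∀ y ∈ Y, ¬ A.gaifman.edist (β x) (β y) ≤ (2 * r + 1 : ℕ))
    {c : WFormula V × WFormula V} (hc : c ∈ splitBalls r X Y lam)
    (h : c.1.SatIn A Set.univ β) : lam.SatIn A Set.univ β ↔ c.2.SatIn A Set.univ β := by
  obtain ⟨c, hc', rfl⟩ := List.mem_map.1 hc
  obtain ⟨h₁, h₂⟩ := free_subset_of_mem_split hlam hc'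
  rw [satIn_inBall h₁ (Set.subset_univ _)] at h
  rw [satIn_inBall h₂ (Set.subset_univ _)]
  have hsep : Separated A (A.ball r (β '' {x | x ∈ X})) (A.ball r (β '' {x | x ∈ Y})) := by
    apply hA.separated
    rintro _ ⟨x, hx, rfl⟩ _ ⟨y, hy, rfl⟩
    exact hfar x hx y hy
  rw [← (decides_split hsep lam X ?_).2 c hc' h, ← PreStructure.ball_union, ← Set.image_union]
  · exact (hlam.2 A _ β subset_rfl).symm
  · intro x hx
    refine ⟨fun hX => PreStructure.subset_ball _ _ ⟨x, hX, rfl⟩, fun hX => ?_⟩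
    exact PreStructure.subset_ball _ _ ⟨x, (hlam.1 hx).resolve_left hX, rfl⟩

theorem stronglyLocal_splitBalls (hlam : lam.StronglyLocal r {x | x ∈ X ∨ x ∈ Y})
    {c : WFormula V × WFormula V} (hc : c ∈ splitBalls r X Y lam) :
    c.1.StronglyLocal r {x | x ∈ X} ∧ c.2.StronglyLocal r {x | x ∈ Y} := by
  obtain ⟨c, hc', rfl⟩ := List.mem_map.1 hc
  obtain ⟨h₁, h₂⟩ := free_subset_of_mem_split hlam hc'
  exact ⟨stronglyLocal_inBall h₁, stronglyLocal_inBall h₂⟩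

theorem stronglyLocal_near (r : ℕ) (X : List ℕ) (y : ℕ) :
    (near r X y : WFormula V).StronglyLocal r {x | x ∈ X ∨ x ∈ [y]} := by
  refine ⟨fun x hx => ?_, fun A D β hD => ?_⟩
  · have := free_near_subset _ _ _ hx
    simp only [Finset.mem_insert, List.mem_toFinset] at this
    simpa using this.symm
  · rw [satIn_near, satIn_near (Set.subset_univ _)]
    exact (PreStructure.ball_mono le_rfl (Set.image_mono fun x hx => .inl hx)).trans hD

/-- A witness within `R` of `X` has its `r`-ball inside the `(R + r)`-ball around `X`. -/
theorem StronglyLocal.ex_near {y k : ℕ} (h : φ.StronglyLocal r {x | x ∈ X ∨ x ∈ [y]})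
    (hy : y ∉ X) (hk : R + r ≤ k) :
    (ex y (WFormula.and (near R X y) φ)).StronglyLocal k {x | x ∈ X} := by
  refine ⟨fun x hx => ?_, fun A D β hD => ?_⟩
  · simp only [free, free_and, Finset.coe_sdiff, Finset.coe_union, Finset.coe_singleton,
      Set.mem_sdiff, Set.mem_union, Finset.mem_coe, Set.mem_singleton_iff] at hx
    obtain ⟨hx | hx, hxy⟩ := hx
    · simpa [hxy] using free_near_subset _ _ _ hx
    · simpa [hxy] using h.1 hx
  · simp only [SatIn, satIn_and, Set.mem_univ, true_and]
    have himg : ∀ b, update β y b '' {x | x ∈ X} = β '' {x | x ∈ X} :=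
      fun b => image_update_of_notMem hy
    have hball : A.ball R (β '' {x | x ∈ X}) ⊆ D :=
      (PreStructure.ball_mono (by omega) subset_rfl).trans hD
    refine exists_congr fun b => ?_
    rw [satIn_near (by rwa [himg]), satIn_near (Set.subset_univ _), himg, update_self]
    have key : b ∈ A.ball R (β '' {x | x ∈ X}) →
        (φ.SatIn A D (update β y b) ↔ φ.SatIn A Set.univ (update β y b)) := fun hb => by
      refine h.2 A D _ ((PreStructure.ball_ball_subset hk ?_).trans hD)
      rintro _ ⟨x, hx | hx, rfl⟩
      · rw [update_of_ne (by rintro rfl; exact hy hx)]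
        exact PreStructure.subset_ball _ _ ⟨x, hx, rfl⟩
      · obtain rfl := List.mem_singleton.1 hx
        simpa using hb
    exact ⟨fun ⟨_, h₁, h₂⟩ => ⟨h₁, (key h₁).1 h₂⟩, fun ⟨h₁, h₂⟩ => ⟨hball h₁, h₁, (key h₁).2 h₂⟩⟩

theorem StronglyLocal.sumEq_near {k : ℕ} {a : Fin V.numWt} {hfin : Finite (V.Elem (V.wtType a))}
    {s : V.Elem (V.wtType a)} {ys : Fin (V.wtArity a) ↪ ℕ}
    (h : φ.StronglyLocal r {x | x ∈ X ∨ x ∈ List.ofFn ys})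
    (hy : ∀ j, ys j ∉ X) (hk : R + r ≤ k) :
    (sumEq a hfin s ys (WFormula.and (conj ((List.ofFn ys).map (near R X))) φ)).StronglyLocal k
      {x | x ∈ X} := by
  refine ⟨fun x hx => ?_, fun A D β hD => ?_⟩
  · simp only [free, free_and, Finset.coe_sdiff, Finset.coe_union, Set.mem_sdiff, Set.mem_union,
      Finset.mem_coe, mem_free_conj, List.mem_map, exists_exists_and_eq_and, Finset.mem_image,
      Finset.mem_univ, true_and] at hx
    obtain ⟨⟨y, hy', hx⟩ | hx, hxy⟩ := hx
    · have := free_near_subset _ _ _ hx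
      simp only [Finset.mem_insert, List.mem_toFinset] at this
      refine this.resolve_left ?_
      rintro rfl
      exact hxy (by simpa [List.mem_ofFn] using hy')
    · exact (h.1 hx).resolve_right (by simpa [List.mem_ofFn] using hxy)
  · simp only [SatIn, satIn_and, Set.mem_univ, implies_true, true_and, satIn_conj, List.mem_map,
      List.mem_ofFn, exists_exists_eq_and, forall_exists_index, forall_apply_eq_imp_iff]
    refine Eq.congr_right (congrArg _ (Set.ext fun b => ?_))
    have himg : extend ys b β '' {x | x ∈ X} = β '' {x | x ∈ X} := image_extend_of_disjoint hy
    have hball : A.ball R (β '' {x | x ∈ X}) ⊆ D :=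
      (PreStructure.ball_mono (by omega) subset_rfl).trans hD
    have h₁ : ∀ j, (near R X (ys j)).SatIn A D (extend ys b β) ↔
        b j ∈ A.ball R (β '' {x | x ∈ X}) := fun j => by
      rw [satIn_near (by rwa [himg]), himg, ys.injective.extend_apply]
    have h₂ : ∀ j, (near R X (ys j)).SatIn A Set.univ (extend ys b β) ↔
        b j ∈ A.ball R (β '' {x | x ∈ X}) := fun j => by
      rw [satIn_near (Set.subset_univ _), himg, ys.injective.extend_apply]
    simp only [Set.mem_ofPred_eq, h₁, h₂]
    have key : (∀ j, b j ∈ A.ball R (β '' {x | x ∈ X})) →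
        (φ.SatIn A D (extend ys b β) ↔ φ.SatIn A Set.univ (extend ys b β)) := fun hb => by
      refine h.2 A D _ ((PreStructure.ball_ball_subset hk ?_).trans hD)
      rintro _ ⟨x, hx | hx, rfl⟩
      · rw [extend_apply' _ _ _ (by rintro ⟨j, rfl⟩; exact hy j hx)]
        exact PreStructure.subset_ball _ _ ⟨x, hx, rfl⟩
      · obtain ⟨j, rfl⟩ := (List.mem_ofFn ..).1 hx
        simpa [ys.injective.extend_apply] using hb j
    exact ⟨fun ⟨_, h₁, h₂⟩ => ⟨h₁, (key h₁).1 h₂⟩,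
      fun ⟨h₁, h₂⟩ => ⟨fun j => hball (h₁ j), h₁, (key h₁).2 h₂⟩⟩

/-! ### Scattered sets -/

/-- The variables in `zs` are at pairwise distance more than `2 * R` and satisfy `lam`, a formula
in the variable `y`. -/
def scatteredBody (R : ℕ) (lam : WFormula V) (y : ℕ) (zs : List ℕ) : WFormula V :=
  conj (farApart (distLE (2 * R)) zs ++ zs.map fun z => lam.rename (Equiv.swap y z))

/-- There is a scattered set of size `k` of elements that satisfy `lam`. -/
def scattered (R : ℕ) (lam : WFormula V) (y N k : ℕ) : WFormula V :=
  exs (List.range' N k) (scatteredBody R lam y (List.range' N k))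

/-- There is a scattered set of size `k` of elements near `X` that satisfy `lam`. -/
def scatteredNear (R : ℕ) (X : List ℕ) (lam : WFormula V) (y N k : ℕ) : WFormula V :=
  exs (List.range' N k) (and (conj ((List.range' N k).map (near R X)))
    (scatteredBody R lam y (List.range' N k)))

theorem forall_mem_farApart {δ : ℕ → ℕ → WFormula V} {zs : List ℕ} :
    (∀ φ ∈ farApart δ zs, φ.SatIn A D β) ↔ zs.Pairwise fun y z => ¬ (δ y z).SatIn A D β := by
  induction zs with
  | nil => simp [farApart]
  | cons z zs ih =>
    simp only [farApart, List.mem_append, or_imp, forall_and, ih, List.pairwise_cons,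
      List.forall_mem_map, satIn_not]

theorem mem_free_farApart {R : ℕ} {zs : List ℕ} {φ : WFormula V}
    (hφ : φ ∈ farApart (distLE (2 * R)) zs) {x : ℕ} (hx : x ∈ φ.free) : x ∈ zs := by
  induction zs with
  | nil => simp [farApart] at hφ
  | cons z zs ih =>
    simp only [farApart, List.mem_append, List.mem_map] at hφ
    rcases hφ with ⟨y, hy, rfl⟩ | hφ
    · have := free_distLE_subset (V := V) _ _ _ hx
      simp only [Finset.mem_insert, Finset.mem_singleton] at this
      rcases this with rfl | rfl <;> simp [hy]
    · exact List.mem_cons_of_mem _ (ih hφ)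

/-- As nothing but `y` can be free, the swap acts as a substitution of `z` for `y`, and the base
assignment `β` is irrelevant. -/
theorem satIn_rename_swap {y z : ℕ} (hlam : lam.free ⊆ {y}) {β' : ℕ → A.Univ} :
    (lam.rename (Equiv.swap y z)).SatIn A D β' ↔ lam.SatIn A D (update β y (β' z)) := by
  rw [satIn_rename]
  refine satIn_congr _ fun x hx => ?_
  obtain rfl := Finset.mem_singleton.1 (hlam hx)
  simp

theorem free_scatteredBody_subset {y : ℕ} {zs : List ℕ} (hlam : lam.free ⊆ {y}) {x : ℕ}
    (hx : x ∈ (scatteredBody R lam y zs).free) : x ∈ zs := by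
  simp only [scatteredBody, mem_free_conj, List.mem_append, List.mem_map] at hx
  obtain ⟨φ, hφ | ⟨z, hz, rfl⟩, hx⟩ := hx
  · exact mem_free_farApart hφ hx
  · rw [free_rename] at hx
    obtain ⟨v, hv, rfl⟩ := Finset.mem_image.1 hx
    obtain rfl := Finset.mem_singleton.1 (hlam hv)
    simpa using hz

/-- Replaces quantification over a block of variables by quantification over lists of elements, in
which scattered sets are easier to handle. -/
theorem exists_assignBlock_iff {α : Type*} {β : ℕ → α} {N k : ℕ} {Q : List α → Prop} :
    (∃ β' : ℕ → α, (∀ x ∉ List.range' N k, β' x = β x) ∧ Q ((List.range' N k).map β')) ↔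
      ∃ l : List α, l.length = k ∧ Q l := by
  constructor
  · rintro ⟨β', -, h⟩
    exact ⟨_, by simp, h⟩
  · rintro ⟨l, rfl, h⟩
    refine ⟨assignBlock β N l.get, fun x hx => assignBlock_of_not_mem (by simpa using hx), ?_⟩
    convert h
    refine List.ext_getElem (by simp) fun i h₁ h₂ => ?_
    have := assignBlock_add β N l.get ⟨i, h₂⟩
    simpa using this

theorem satIn_scatteredBody {y : ℕ} {zs : List ℕ} (hlam : lam.free ⊆ {y}) {β' : ℕ → A.Univ} :
    (scatteredBody R lam y zs).SatIn A Set.univ β' ↔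
      (zs.map β').Pairwise (fun a b => ¬ A.gaifman.edist a b ≤ (2 * R : ℕ)) ∧
        ∀ b ∈ zs.map β', lam.SatIn A Set.univ (update β y b) := by
  simp only [scatteredBody, satIn_conj, List.mem_append, or_imp, forall_and, forall_mem_farApart,
    satIn_distLE (Set.subset_univ _), List.forall_mem_map, List.pairwise_map]
  refine and_congr_right fun _ => forall₂_congr fun z _ => satIn_rename_swap hlam

theorem satIn_scattered {y N k : ℕ} (hlam : lam.free ⊆ {y}) :
    (scattered R lam y N k).SatIn A Set.univ β ↔ ∃ l : List A.Univ, l.length = k ∧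
      l.Pairwise (fun a b => ¬ A.gaifman.edist a b ≤ (2 * R : ℕ)) ∧
        ∀ b ∈ l, lam.SatIn A Set.univ (update β y b) := by
  rw [scattered, satIn_exs]
  simp only [Set.mem_univ, implies_true, true_and, satIn_scatteredBody (β := β) hlam]
  exact exists_assignBlock_iff (Q := fun l =>
    l.Pairwise (fun a b => ¬ A.gaifman.edist a b ≤ (2 * R : ℕ)) ∧
        ∀ b ∈ l, lam.SatIn A Set.univ (update β y b))

theorem satIn_scatteredNear {y N k : ℕ} (hlam : lam.free ⊆ {y}) (hN : ∀ x ∈ X, x < N) :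
    (scatteredNear R X lam y N k).SatIn A Set.univ β ↔ ∃ l : List A.Univ, l.length = k ∧
      (∀ b ∈ l, b ∈ A.ball R (β '' {x | x ∈ X})) ∧
      l.Pairwise (fun a b => ¬ A.gaifman.edist a b ≤ (2 * R : ℕ)) ∧
        ∀ b ∈ l, lam.SatIn A Set.univ (update β y b) := by
  rw [scatteredNear, satIn_exs]
  simp only [Set.mem_univ, implies_true, true_and, satIn_and, satIn_scatteredBody (β := β) hlam]
  rw [← exists_assignBlock_iff (β := β) (N := N) (Q := fun l =>
    (∀ b ∈ l, b ∈ A.ball R (β '' {x | x ∈ X})) ∧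
    l.Pairwise (fun a b => ¬ A.gaifman.edist a b ≤ (2 * R : ℕ)) ∧
        ∀ b ∈ l, lam.SatIn A Set.univ (update β y b))]
  refine exists_congr fun β' => and_congr_right fun hβ' => and_congr_left fun _ => ?_
  have himg : β' '' {x | x ∈ X} = β '' {x | x ∈ X} := Set.image_congr fun x hx => hβ' x (by
    have := hN x hx
    simp only [List.mem_range'_1]
    omega)
  simp only [satIn_conj, List.forall_mem_map, satIn_near (Set.subset_univ _), himg]

/-- The chosen elements lie within `R` of `X`, and the distance formulas and `lam` look at balls of
radius at most `2 * R` around them. Radius `3 * R` would do; `4 * R` is the common radius in the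
elimination of a quantifier. -/
theorem stronglyLocal_scatteredNear {y N k : ℕ} (hlam : lam.StronglyLocal r {x | x ∈ [y]})
    (hr : r ≤ R) (hN : ∀ x ∈ X, x < N) :
    (scatteredNear R X lam y N k).StronglyLocal (4 * R) {x | x ∈ X} := by
  have hfree : lam.free ⊆ {y} := fun x hx => by simpa using hlam.1 hx
  refine ⟨fun x hx => ?_, fun A D β hD => ?_⟩
  · simp only [scatteredNear, Finset.mem_coe, mem_free_exs, free_and, Finset.mem_union,
      mem_free_conj, List.mem_map, exists_exists_and_eq_and] at hx
    obtain ⟨⟨z, hz, h⟩ | h, hx⟩ := hx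
    · have := free_near_subset _ _ _ h
      simp only [Finset.mem_insert, List.mem_toFinset] at this
      refine this.resolve_left ?_
      rintro rfl
      exact hx hz
    · exact absurd (free_scatteredBody_subset hfree h) hx
  · rw [scatteredNear, satIn_exs, satIn_exs]
    simp only [Set.mem_univ, implies_true, true_and, satIn_and]
    refine exists_congr fun β' => and_congr_right fun hβ' => ?_
    have himg : β' '' {x | x ∈ X} = β '' {x | x ∈ X} := Set.image_congr fun x hx => hβ' x (by
      have := hN x hx
      simp only [List.mem_range'_1]
      omega)
    have hball : A.ball R (β '' {x | x ∈ X}) ⊆ D :=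
      (PreStructure.ball_mono (by omega) subset_rfl).trans hD
    have h₁ : ∀ z, (near R X z).SatIn A D β' ↔ β' z ∈ A.ball R (β '' {x | x ∈ X}) := fun z => by
      rw [satIn_near (by rwa [himg]), himg]
    have h₂ : ∀ z, (near R X z).SatIn A Set.univ β' ↔
        β' z ∈ A.ball R (β '' {x | x ∈ X}) := fun z => by
      rw [satIn_near (Set.subset_univ _), himg]
    simp only [satIn_conj, List.forall_mem_map, h₁, h₂]
    have key : (∀ z ∈ List.range' N k, β' z ∈ A.ball R (β '' {x | x ∈ X})) →
        ((scatteredBody R lam y (List.range' N k)).SatIn A D β' ↔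
          (scatteredBody R lam y (List.range' N k)).SatIn A Set.univ β') := fun hz => by
      have hsub : ∀ z ∈ List.range' N k, ∀ s ≤ 3 * R, A.ball s {β' z} ⊆ D := fun z hz' s hs =>
        (PreStructure.ball_ball_subset (r := R) (by omega) (by simpa using hz z hz')).trans hD
      simp only [scatteredBody, satIn_conj, List.mem_append, or_imp, forall_and,
        forall_mem_farApart, List.forall_mem_map]
      refine and_congr (List.Pairwise.iff_of_mem fun {z z'} hz hz' => ?_)
        (forall₂_congr fun z hz => ?_)
      · rw [satIn_distLE (hsub z hz _ (by omega)), satIn_distLE (Set.subset_univ _)]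
      · rw [satIn_rename, satIn_rename]
        refine hlam.2 A D _ ?_
        convert hsub z hz r (by omega) using 2
        simp
    exact ⟨fun ⟨_, h₁, h₂⟩ => ⟨h₁, (key h₁).1 h₂⟩,
      fun ⟨h₁, h₂⟩ => ⟨fun z hz => hball (h₁ z hz), h₁, (key h₁).2 h₂⟩⟩

theorem isBasicLocal_scattered {y N k : ℕ} (hlam : lam.StronglyLocal r {x | x ∈ [y]})
    (hr : r ≤ R) (hk : k ≠ 0) : (scattered R lam y N k).IsBasicLocal := by
  refine ⟨R, y, lam, List.range' N k, distLE (2 * R), by simpa using hk, List.nodup_range',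
    ?_, fun y z => isDistLE_distLE _ _ _, rfl⟩
  exact (hlam.mono hr (by intro x; simp)).isLocalAround (Finset.singleton_nonempty y)

/-- If a graph has no scattered set of size `|X| + 1` near `X`, but one far away element, then
some scattered set is larger than all those near `X`. -/
theorem exists_scattered_not_near {P : A.Univ → Prop} {C : Finset A.Univ} {n : ℕ} {b : A.Univ}
    (hb : P b) (hfar : b ∉ A.ball (3 * R) C) (hn : C.card ≤ n) :
    ∃ k < n + 1, (∃ l : List A.Univ, l.length = k + 1 ∧
        l.Pairwise (fun a b => ¬ A.gaifman.edist a b ≤ (2 * R : ℕ)) ∧ ∀ b ∈ l, P b) ∧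
      ¬ ∃ l : List A.Univ, l.length = k + 1 ∧ (∀ b ∈ l, b ∈ A.ball R C) ∧
        l.Pairwise (fun a b => ¬ A.gaifman.edist a b ≤ (2 * R : ℕ)) ∧ ∀ b ∈ l, P b := by
  by_contra hcon
  have hcon : ∀ k < n + 1, _ → _ := fun k hk h => by_contra fun h' => hcon ⟨k, hk, h, h'⟩
  -- If the claim fails, each size up to `n + 1` that is realized at all is realized near `C`.
  -- Adding `b` to a near set and moving the result back near `C` then produces all sizes up to `n +
  -- 1`.
  have key : ∀ k ≤ n + 1, ∃ l : List A.Univ, l.length = k ∧ (∀ b ∈ l, b ∈ A.ball R C) ∧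
      l.Pairwise (fun a b => ¬ A.gaifman.edist a b ≤ (2 * R : ℕ)) ∧ ∀ b ∈ l, P b := by
    intro k
    induction k with
    | zero => exact fun _ => ⟨[], by simp⟩
    | succ k ih =>
      intro hk
      obtain ⟨l, hl, hnear, hpw, hP⟩ := ih (by omega)
      refine hcon k (by omega) ⟨b :: l, by simp [hl], ?_, by simpa using ⟨hb, hP⟩⟩
      · refine List.pairwise_cons.2 ⟨fun a ha hab => hfar ?_, hpw⟩
        obtain ⟨c, hc, hca⟩ := hnear a ha
        rw [SimpleGraph.edist_comm] at hab
        -- An element near `C` is within `R` of it; were it within `2 * R` of `b`, then `b` would be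
        -- within `3 * R` of `C`.
        exact ⟨c, hc, PreStructure.edist_le_add hca hab (by omega)⟩
  obtain ⟨l, hl, hnear, hpw, -⟩ := key (n + 1) le_rfl
  have hex : ∀ b, ∃ c, b ∈ l → c ∈ C ∧ A.gaifman.edist c b ≤ R := fun b => by
    by_cases hb : b ∈ l
    · obtain ⟨c, hc, h⟩ := hnear b hb
      exact ⟨c, fun _ => ⟨hc, h⟩⟩
    · exact ⟨b, fun h => absurd h hb⟩
  choose f hf using hex
  -- Two elements with the same centre would be within `2 * R` of each other, so centres are
  -- distinct and `C` has at least `n + 1` elements.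
  have hne : l.Pairwise fun a b => f a ≠ f b := by
    refine hpw.imp_of_mem fun {a b} ha hb h heq => h ?_
    have h₁ := (hf a ha).2
    have h₂ := (hf b hb).2
    rw [← heq] at h₂
    rw [SimpleGraph.edist_comm] at h₁
    exact PreStructure.edist_le_add h₁ h₂ (by omega)
  classical
  have hnd : (l.map f).Nodup := List.pairwise_map.2 hne
  have hsub : (l.map f).toFinset ⊆ C := fun c hc => by
    obtain ⟨b, hb, rfl⟩ := List.mem_map.1 (List.mem_toFinset.1 hc)
    exact (hf b hb).1
  have := Finset.card_le_card hsub
  rw [List.toFinset_card_of_nodup hnd, List.length_map] at this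
  omega

end WFormula

namespace WFormula

variable {V : Vocabulary.{u, v, w}} {A : PreStructure V} {D : Set A.Univ}
  {β : ℕ → A.Univ} {φ ψ lam : WFormula V} {r R : ℕ} {X Y : List ℕ}

theorem satIn_ex {y : ℕ} :
    (ex y φ).SatIn A D β ↔ ∃ b ∈ D, φ.SatIn A D (update β y b) := Iff.rfl

/-! ### Normal form of one binder in front of a local formula -/

/-- The radius of locality after the elimination of a binder. -/
def nextRadius (r : ℕ) : ℕ := 4 * (2 * r + 2)

/-- Case distinction for `∃ y lam`, where `lam` is `r`-local around `X` and `y`. -/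
noncomputable def exStep (r : ℕ) (X : List ℕ) (y : ℕ) (lam : WFormula V) : Cases V :=
  Cases.expand
    (or (ex y (and (near (2 * r + 2) X y) lam))
      (disj ((splitBalls r X [y] lam).map fun c =>
        and c.1 (ex y (and (near (3 * (2 * r + 2)) X y)
          (and (not (near (2 * r + 2) X y)) c.2))))))
    ((splitBalls r X [y] lam).flatMap fun c => (List.range (X.length + 1)).map fun k =>
      (and c.1 (not (scatteredNear (2 * r + 2) X c.2 y (listBound X) (k + 1))),
        scattered (2 * r + 2) c.2 y (listBound X) (k + 1)))

/-- The formulas `(s₁ = ∑ …)`, `(s₂ = ∑ …)`, `(s₃ = ∑ …)` with `s = s₁ - s₂ + s₃`, for a formula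
`(s = ∑ …)`. -/
noncomputable def sumTriples : WFormula V → List (WFormula V × WFormula V × WFormula V)
  | sumEq a hfin s ys φ =>
      have := Fintype.ofFinite (V.Elem (V.wtType a))
      Finset.univ.toList.flatMap fun s₁ => Finset.univ.toList.map fun s₂ =>
        (sumEq a hfin s₁ ys φ, sumEq a hfin s₂ ys φ, sumEq a hfin (s - s₁ + s₂) ys φ)
  | _ => []

/-- Case distinction for a formula `node` of the form `(s = ∑ w(Y).…)`, with body `lam` that is
`r`-local around `X` and `Y`. -/
noncomputable def sumStep (r : ℕ) (X Y : List ℕ) (node lam : WFormula V) : Cases V :=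
  Cases.expand ff ((splitBalls r X Y lam).flatMap fun c => node.sumTriples.map fun p =>
    (and c.1 (and (p.2.1.setBody (and (conj (Y.map (near (2 * r + 2) X))) c.2))
      (p.2.2.setBody (and (conj (Y.map (near (2 * r + 2) X))) lam))), p.1.setBody c.2))

/-- The guards are sentences in normal form, and the bodies are local. -/
def Cases.IsNormal (l : Cases V) (r : ℕ) (X : Set ℕ) : Prop :=
  ∀ c ∈ l, (c.1.IsGaifmanNF ∧ c.1.free = ∅) ∧ c.2.StronglyLocal r X

theorem IsGaifmanNF.and (h : φ.IsGaifmanNF) (h' : ψ.IsGaifmanNF) : (and φ ψ).IsGaifmanNF :=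
  (h.not.or h'.not).not

theorem _root_.WTerm.rename_refl {i : V.Ix} (t : WTerm V i) : t.rename (Equiv.refl ℕ) = t := by
  induction t with
  | const s => rfl
  | wt a xs => rfl
  | add t₁ t₂ h₁ h₂ | sub t₁ t₂ h₁ h₂ | mul _ t₁ t₂ h₁ h₂ => simp only [WTerm.rename, h₁, h₂]

theorem rename_refl (φ : WFormula V) : φ.rename (Equiv.refl ℕ) = φ := by
  induction φ with
  | eq x y => rfl
  | rel R xs => rfl
  | wtEq a s xs => rfl
  | not φ ih => simp only [rename, ih]
  | or φ ψ ih₁ ih₂ => simp only [rename, ih₁, ih₂]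
  | ex y φ ih => simp only [rename, ih, Equiv.refl_apply]
  | sumEq a hfin s ys φ ih => simp only [rename, ih]; rfl
  | pred P ts h => simp only [rename, WTerm.rename_refl]

/-- A basic-local sentence with a single variable: there is no distance condition, the conjunction
of one formula is that formula, and the renaming is trivial. -/
theorem isGaifmanNF_ex_zero (hloc : φ.StronglyLocal r {0}) : (ex 0 φ).IsGaifmanNF := by
  refine .basicLocal ⟨r, 0, φ, [0], distLE (2 * r), by simp, by simp, ?_,
    fun _ _ => isDistLE_distLE _ _ _, ?_⟩
  · exact (hloc.mono le_rfl (by simp)).isLocalAround (Finset.singleton_nonempty 0)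
  · simp [exs, farApart, conj, rename_refl]

theorem stronglyLocal_eq (x y : ℕ) : (eq x y : WFormula V).StronglyLocal 0 {x, y} :=
  ⟨by simp [free], fun _ _ _ _ => Iff.rfl⟩

theorem isGaifmanNF_tt : (tt : WFormula V).IsGaifmanNF :=
  .not (isGaifmanNF_ex_zero (((stronglyLocal_eq 0 0).mono le_rfl (by simp)).not))

namespace Cases

variable {l m : Cases V} {S : Set ℕ} {T : Prop}

/-- New guards are Boolean combinations of the second components, new bodies are disjunctions of
`base` and first components. Hence sentences have to be in second position before the expansion. -/
theorem IsNormal.expand {base : WFormula V} (hbase : base.StronglyLocal r S)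
    (h : ∀ c ∈ l, c.1.StronglyLocal r S ∧ c.2.IsGaifmanNF ∧ c.2.free = ∅) :
    (expand base l).IsNormal r S := by
  induction l with
  | nil =>
    intro c hc
    obtain rfl := List.mem_singleton.1 hc
    exact ⟨⟨isGaifmanNF_tt, free_tt⟩, hbase⟩
  | cons c l ih =>
    intro d hd
    obtain ⟨e, he, hd⟩ := List.mem_flatMap.1 hd
    simp only [List.mem_cons, List.not_mem_nil, or_false] at hd
    have h₁ := h c (by simp)
    have h₂ := ih (fun c hc => h c (by simp [hc])) e he
    rcases hd with rfl | rfl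
    · exact ⟨⟨h₁.2.1.and h₂.1.1, by simp [h₁.2.2, h₂.1.2]⟩, h₁.1.or h₂.2⟩
    · exact ⟨⟨h₁.2.1.not.and h₂.1.1, by simp [free, h₁.2.2, h₂.1.2]⟩, h₂.2⟩

theorem IsNormal.neg (h : l.IsNormal r S) : l.neg.IsNormal r S := by
  intro d hd
  obtain ⟨c, hc, rfl⟩ := List.mem_map.1 hd
  exact ⟨(h c hc).1, (h c hc).2.not⟩

theorem IsNormal.mono {r' : ℕ} {S' : Set ℕ} (h : l.IsNormal r S) (hr : r ≤ r') (hS : S ⊆ S') :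
    l.IsNormal r' S' :=
  fun c hc => ⟨(h c hc).1, (h c hc).2.mono hr hS⟩

theorem IsNormal.either (h : l.IsNormal r S) (h' : m.IsNormal r S) :
    (l.either m).IsNormal r S := by
  intro d hd
  obtain ⟨c, hc, e, he, rfl⟩ := mem_either.1 hd
  exact ⟨⟨(h c hc).1.1.and (h' e he).1.1, by simp [(h c hc).1.2, (h' e he).1.2]⟩,
    (h c hc).2.or (h' e he).2⟩

/-- Nested case distinction. -/
def bind (l : Cases V) (f : WFormula V → Cases V) : Cases V :=
  l.flatMap fun c => (f c.2).map fun d => (and c.1 d.1, d.2)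

theorem mem_bind {f : WFormula V → Cases V} {d : WFormula V × WFormula V} :
    d ∈ l.bind f ↔ ∃ c ∈ l, ∃ e ∈ f c.2, (and c.1 e.1, e.2) = d := by
  simp [bind, List.mem_flatMap]

theorem IsNormal.bind {r' : ℕ} {S' : Set ℕ} {f : WFormula V → Cases V} (h : l.IsNormal r S)
    (hf : ∀ φ : WFormula V, φ.StronglyLocal r S → (f φ).IsNormal r' S') :
    (l.bind f).IsNormal r' S' := by
  intro d hd
  obtain ⟨c, hc, e, he, rfl⟩ := mem_bind.1 hd
  have h₁ := h c hc
  have h₂ := hf _ h₁.2 e he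
  exact ⟨⟨h₁.1.1.and h₂.1.1, by simp [h₁.1.2, h₂.1.2]⟩, h₂.2⟩

theorem Decides.bind {D₁ D₂ : Set A.Univ} {f : WFormula V → Cases V}
    (hl : ∃ c ∈ l, c.1.SatIn A D₁ β)
    (h : ∀ c ∈ l, c.1.SatIn A D₁ β → (f c.2).Decides A D₁ D₂ β T) :
    (l.bind f).Decides A D₁ D₂ β T := by
  refine ⟨?_, fun d hd h₁ => ?_⟩
  · obtain ⟨c, hc, hc₁⟩ := hl
    obtain ⟨⟨e, he, he₁⟩, -⟩ := h c hc hc₁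
    exact ⟨_, mem_bind.2 ⟨c, hc, e, he, rfl⟩, by simp [hc₁, he₁]⟩
  · obtain ⟨c, hc, e, he, rfl⟩ := mem_bind.1 hd
    rw [satIn_and] at h₁
    exact (h c hc h₁.1).2 e he h₁.2

theorem Decides.expand {D₁ D₂ : Set A.Univ} {base : WFormula V}
    (h : T ↔ base.SatIn A D₂ β ∨ ∃ c ∈ l, c.2.SatIn A D₁ β ∧ c.1.SatIn A D₂ β) :
    (expand base l).Decides A D₁ D₂ β T :=
  ⟨exists_expand _ _, fun _ hd h₁ => h.trans (satIn_expand hd h₁).symm⟩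

end Cases

theorem isNormal_exStep {y : ℕ} (hlam : lam.StronglyLocal r {x | x ∈ X ∨ x ∈ [y]})
    (hy : y ∉ X) : (exStep r X y lam).IsNormal (nextRadius r) {x | x ∈ X} := by
  unfold exStep nextRadius
  refine Cases.IsNormal.expand (.or (hlam.ex_near hy (by omega)) (.disj fun φ hφ => ?_))
    fun c hc => ?_
  · obtain ⟨c, hc, rfl⟩ := List.mem_map.1 hφ
    obtain ⟨h₁, h₂⟩ := stronglyLocal_splitBalls hlam hc
    -- Origin of `nextRadius`: the witness is within `3 * (2 * r + 2)` of `X`, and the formula about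
    -- it is local with radius `2 * r + 2`, due to its distance condition.
    refine .and (h₁.mono (by omega) subset_rfl) (StronglyLocal.ex_near (r := 2 * r + 2)
      (.and (stronglyLocal_near _ _ _).not (h₂.mono (by omega) fun x hx => .inr hx)) hy (by omega))
  · obtain ⟨c, hc', hc⟩ := List.mem_flatMap.1 hc
    obtain ⟨k, -, rfl⟩ := List.mem_map.1 hc
    obtain ⟨h₁, h₂⟩ := stronglyLocal_splitBalls hlam hc'
    refine ⟨.and (h₁.mono (by omega) subset_rfl) (.not (stronglyLocal_scatteredNear h₂ (by omega)
      fun x hx => lt_listBound hx)),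
      .basicLocal (isBasicLocal_scattered h₂ (by omega) (by omega)), ?_⟩
    refine Finset.eq_empty_of_forall_notMem fun x hx => ?_
    rw [scattered, mem_free_exs] at hx
    exact hx.2 (free_scatteredBody_subset (fun x hx => by simpa using h₂.1 hx) hx.1)

/-- Witnesses in the `R`-ball, and in the shell between `R` and `3 * R`, are found by local
formulas. The existence of others is detected by comparing scattered sets in the whole structure
with scattered sets near `X`. -/
theorem decides_exStep (hA : A.IsWeighted) {y : ℕ}
    (hlam : lam.StronglyLocal r {x | x ∈ X ∨ x ∈ [y]}) (hy : y ∉ X) :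
    (exStep r X y lam).Decides A Set.univ Set.univ β ((ex y lam).SatIn A Set.univ β) := by
  refine Cases.Decides.expand ?_
  set R := 2 * r + 2 with hR
  set C : Set A.Univ := β '' {x | x ∈ X} with hC
  have himg : ∀ b, update β y b '' {x | x ∈ X} = C := fun b => image_update_of_notMem hy
  have hnear : ∀ b s, (near s X y).SatIn A Set.univ (update β y b) ↔ b ∈ A.ball s C :=
    fun b s => by rw [satIn_near (Set.subset_univ _), himg, update_self]
  have hguard : ∀ c ∈ splitBalls r X [y] lam, ∀ b, c.1.SatIn A Set.univ (update β y b) ↔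
      c.1.SatIn A Set.univ β := fun c hc b =>
    (stronglyLocal_splitBalls hlam hc).1.congr fun x hx =>
      update_of_ne (by rintro rfl; exact hy hx) _ _
  -- Outside the `R`-ball, with `R = 2 * r + 2`, the decomposition of `lam` is valid, so `lam` may
  -- be traded for the body, which does not depend on `X`.
  have hfar : ∀ c ∈ splitBalls r X [y] lam, c.1.SatIn A Set.univ β → ∀ b ∉ A.ball R C,
      (lam.SatIn A Set.univ (update β y b) ↔ c.2.SatIn A Set.univ (update β y b)) := by
    intro c hc h b hb
    refine satIn_splitBalls hA hlam ?_ hc ((hguard c hc b).2 h)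
    intro x hx y' hy' hle
    obtain rfl := List.mem_singleton.1 hy'
    rw [update_self, update_of_ne (by rintro rfl; exact hy hx)] at hle
    exact hb ⟨β x, ⟨x, hx, rfl⟩, hle.trans (by exact_mod_cast (by omega))⟩
  have hfree : ∀ c ∈ splitBalls r X [y] lam, c.2.free ⊆ {y} := fun c hc x hx => by
    simpa using (stronglyLocal_splitBalls hlam hc).2.1 hx
  have hN : ∀ x ∈ X, x < listBound X := fun x hx => lt_listBound hx
  simp only [satIn_or, satIn_disj, List.mem_map, List.mem_flatMap, exists_exists_and_eq_and,
    satIn_and, satIn_ex, satIn_not, Set.mem_univ, true_and, hnear, List.mem_range]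
  constructor
  · rintro ⟨b, hb⟩
    by_cases hbR : b ∈ A.ball R C
    · exact .inl (.inl ⟨b, hbR, hb⟩)
    obtain ⟨c, hc, hc₁⟩ := exists_splitBalls (A := A) (β := β) (r := r) (X := X) (Y := [y])
      (lam := lam)
    have hb₂ := (hfar c hc hc₁ b hbR).1 hb
    by_cases hb3 : b ∈ A.ball (3 * R) C
    · exact .inl (.inr ⟨c, hc, hc₁, b, hb3, hbR, hb₂⟩)
    · classical
      have hCf : ((X.map β).toFinset : Set A.Univ) = C := by ext; simp [hC]
      -- A witness beyond `3 * R` produces a size at which scattered sets exist, but none near `X`.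
      obtain ⟨k, hk, h₁, h₂⟩ := exists_scattered_not_near
        (P := fun b => c.2.SatIn A Set.univ (update β y b)) (C := (X.map β).toFinset)
        (n := X.length) hb₂ (by rwa [hCf])
        (by simpa using List.toFinset_card_le (X.map β))
      refine .inr ⟨_, ⟨c, hc, k, hk, rfl⟩, (satIn_scattered (hfree c hc)).2 h₁,
        satIn_and.2 ⟨hc₁, ?_⟩⟩
      rw [satIn_not, satIn_scatteredNear (hfree c hc) hN]
      rwa [hCf] at h₂
  · rintro ((⟨b, -, hb⟩ | ⟨c, hc, hc₁, b, -, hbR, hb⟩) | ⟨_, ⟨c, hc, k, hk, rfl⟩, hs, h⟩)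
    · exact ⟨b, hb⟩
    · exact ⟨b, (hfar c hc hc₁ b hbR).2 hb⟩
    · obtain ⟨hc₁, hn⟩ := satIn_and.1 h
      rw [satIn_scattered (hfree c hc)] at hs
      rw [satIn_not, satIn_scatteredNear (hfree c hc) hN] at hn
      -- Not all elements of this scattered set are near `X`; one that is not near satisfies `lam`
      -- as well.
      obtain ⟨l, hl, hpw, hP⟩ := hs
      by_contra hcon
      refine hn ⟨l, hl, fun b hb => ?_, hpw, hP⟩
      by_contra hbR
      exact hcon ⟨b, (hfar c hc hc₁ b hbR).2 (hP b hb)⟩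

theorem isNormal_sumStep {a : Fin V.numWt} {hfin : Finite (V.Elem (V.wtType a))}
    {s : V.Elem (V.wtType a)} {ys : Fin (V.wtArity a) ↪ ℕ}
    (hlam : lam.StronglyLocal r {x | x ∈ X ∨ x ∈ List.ofFn ys}) (hy : ∀ j, ys j ∉ X) :
    (sumStep r X (List.ofFn ys) (sumEq a hfin s ys φ) lam).IsNormal (nextRadius r)
      {x | x ∈ X} := by
  unfold sumStep nextRadius
  refine Cases.IsNormal.expand .ff fun c hc => ?_
  obtain ⟨c, hc', hc⟩ := List.mem_flatMap.1 hc
  obtain ⟨p, hp, rfl⟩ := List.mem_map.1 hc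
  simp only [sumTriples, List.mem_flatMap, List.mem_map, Finset.mem_toList, Finset.mem_univ,
    true_and] at hp
  obtain ⟨s₁, s₂, rfl⟩ := hp
  obtain ⟨h₁, h₂⟩ := stronglyLocal_splitBalls hlam hc'
  refine ⟨.and (h₁.mono (by omega) subset_rfl) (.and ?_ ?_), .aggregation ?_, ?_⟩
  · exact (h₂.mono le_rfl fun x hx => .inr hx).sumEq_near hy (by omega)
  · exact hlam.sumEq_near hy (by omega)
  · refine ⟨a, hfin, s₁, ys, c.2, r, (h₂.mono le_rfl fun x hx => ?_).isLocalAround ?_, rfl⟩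
    · simpa [List.mem_ofFn] using hx
    · exact ⟨ys ⟨0, V.wtArity_pos a⟩, by simp⟩
  · refine Finset.eq_empty_of_forall_notMem fun x hx => ?_
    simp only [setBody, free, Finset.mem_sdiff, Finset.mem_image, Finset.mem_univ, true_and] at hx
    exact hx.2 (by simpa [List.mem_ofFn] using h₂.1 hx.1)

/-- Away from `X` the formula `lam` may be traded for a body `c.2` that does not involve `X`. The
sum of the latter over the whole structure is the subject of an aggregation sentence, and the error
made near `X` is corrected by two sums that are local around `X`. -/
theorem decides_sumStep (hA : A.IsWeighted) {a : Fin V.numWt}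
    {hfin : Finite (V.Elem (V.wtType a))}
    {s : V.Elem (V.wtType a)} {ys : Fin (V.wtArity a) ↪ ℕ}
    (hlam : lam.StronglyLocal r {x | x ∈ X ∨ x ∈ List.ofFn ys}) (hy : ∀ j, ys j ∉ X) :
    (sumStep r X (List.ofFn ys) (sumEq a hfin s ys φ) lam).Decides A Set.univ Set.univ β
      ((sumEq a hfin s ys lam).SatIn A Set.univ β) := by
  refine Cases.Decides.expand ?_
  set R := 2 * r + 2 with hR
  set C : Set A.Univ := β '' {x | x ∈ X} with hC
  have himg : ∀ b, extend ys b β '' {x | x ∈ X} = C := fun b => image_extend_of_disjoint hy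
  have hnear : ∀ b, (conj ((List.ofFn ys).map (near R X))).SatIn A Set.univ (extend ys b β) ↔
      ∀ j, b j ∈ A.ball R C := fun b => by
    simp only [satIn_conj, List.forall_mem_map, satIn_near (Set.subset_univ _), himg,
      List.forall_mem_ofFn_iff, ys.injective.extend_apply]
  have hguard : ∀ c ∈ splitBalls r X (List.ofFn ys) lam, ∀ b,
      c.1.SatIn A Set.univ (extend ys b β) ↔ c.1.SatIn A Set.univ β := fun c hc b =>
    (stronglyLocal_splitBalls hlam hc).1.congr fun x hx =>
      extend_apply' _ _ _ (by rintro ⟨j, rfl⟩; exact hy j hx)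
  have hfar : ∀ c ∈ splitBalls r X (List.ofFn ys) lam, c.1.SatIn A Set.univ β →
      ∀ b, A.wt a b ≠ 0 → (¬ ∀ j, b j ∈ A.ball R C) →
      (lam.SatIn A Set.univ (extend ys b β) ↔ c.2.SatIn A Set.univ (extend ys b β)) := by
    intro c hc h b hb hbR
    refine satIn_splitBalls hA hlam ?_ hc ((hguard c hc b).2 h)
    intro x hx y' hy' hle
    push Not at hbR
    obtain ⟨i, hi⟩ := hbR
    obtain ⟨j, rfl⟩ := (List.mem_ofFn ..).1 hy'
    rw [ys.injective.extend_apply,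
      extend_apply' _ _ _ (by rintro ⟨j, rfl⟩; exact hy j hx)] at hle
    -- One entry is farther than `2 * r + 2` from `X` and the diameter is at most 1, so every entry
    -- is farther than `2 * r + 1`. This is the reason for the additional 1 in `R`.
    exact hi ⟨β x, ⟨x, hx, rfl⟩,
      PreStructure.edist_le_add hle (hA.edist_le_one hb j i) (by omega)⟩
  let N : Set (Fin (V.wtArity a) → A.Univ) := {b | ∀ j, b j ∈ A.ball R C}
  let P := fun φ : WFormula V => {b | φ.SatIn A Set.univ (extend ys b β)}
  have hsum : ∀ c ∈ splitBalls r X (List.ofFn ys) lam, c.1.SatIn A Set.univ β →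
      A.wsum a (P lam) = A.wsum a (P c.2) - A.wsum a (N ∩ P c.2) + A.wsum a (N ∩ P lam) := by
    intro c hc h
    rw [← PreStructure.wsum_inter_add_sdiff (P lam) N,
      ← PreStructure.wsum_inter_add_sdiff (P c.2) N,
      -- Outside `N` the two sums agree: tuples of non-zero weight that are not entirely near `X`
      -- are far from it.
      PreStructure.wsum_congr (P := P lam \ N) (Q := P c.2 \ N), Set.inter_comm N,
      Set.inter_comm N]
    · abel
    · intro b hb
      exact and_congr_left fun hbN => hfar c hc h b hb hbN
  have hlhs : (sumEq a hfin s ys lam).SatIn A Set.univ β ↔ s = A.wsum a (P lam) := by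
    simp [SatIn, P]
  have hsat : ∀ s' (ψ : WFormula V), (sumEq a hfin s' ys ψ).SatIn A Set.univ β ↔
      s' = A.wsum a (P ψ) := by
    simp [SatIn, P]
  have hand : ∀ ψ, P (and (conj ((List.ofFn ys).map (near R X))) ψ) = N ∩ P ψ := fun ψ => by
    ext b
    exact satIn_and.trans (and_congr_left fun _ => hnear b)
  rw [hlhs]
  simp only [satIn_ff, false_or, List.mem_flatMap, List.mem_map, sumTriples, Finset.mem_toList,
    Finset.mem_univ, true_and]
  constructor
  · intro h
    obtain ⟨c, hc, hc₁⟩ := exists_splitBalls (A := A) (β := β) (r := r) (X := X)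
      (Y := List.ofFn ys) (lam := lam)
    -- The guessed values are the actual sums of the body, over the whole structure and near `X`.
    refine ⟨_, ⟨c, hc, _, ⟨A.wsum a (P c.2), A.wsum a (N ∩ P c.2), rfl⟩, rfl⟩, ?_⟩
    simp only [setBody, satIn_and, hsat, hand, true_and, hc₁]
    rw [h, hsum c hc hc₁]
    abel
  · rintro ⟨_, ⟨c, hc, _, ⟨s₁, s₂, rfl⟩, rfl⟩, h⟩
    simp only [setBody, satIn_and, hsat, hand] at h
    obtain ⟨h₁, hc₁, h₂, h₃⟩ := h
    rw [hsum c hc hc₁, ← h₁, ← h₂, ← h₃]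
    abel

/-! ### The normal form -/

/-- A radius `r` and a case distinction with sentences in normal form as guards and `r`-local
formulas as bodies. -/
noncomputable def gnf : WFormula V → ℕ × Cases V
  | not φ => (φ.gnf.1, φ.gnf.2.neg)
  | or φ ψ => (max φ.gnf.1 ψ.gnf.1, φ.gnf.2.either ψ.gnf.2)
  | ex y φ => (nextRadius φ.gnf.1, φ.gnf.2.bind (exStep φ.gnf.1 (ex y φ).freeList y))
  | sumEq a hfin s ys φ => (nextRadius φ.gnf.1,
      φ.gnf.2.bind (sumStep φ.gnf.1 (sumEq a hfin s ys φ).freeList (List.ofFn ys)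
        (sumEq a hfin s ys φ)))
  | φ => (0, [(tt, φ)])

theorem stronglyLocal_of_satIn_iff
    (h : ∀ (A : PreStructure V) (D : Set A.Univ) β, φ.SatIn A D β ↔ φ.SatIn A Set.univ β) :
    φ.StronglyLocal 0 φ.free :=
  ⟨subset_rfl, fun A D β _ => h A D β⟩

theorem isNormal_singleton_tt {S : Set ℕ} (h : φ.StronglyLocal r S) :
    Cases.IsNormal [(tt, φ)] r S := by
  intro c hc
  obtain rfl := List.mem_singleton.1 hc
  exact ⟨⟨isGaifmanNF_tt, free_tt⟩, h⟩

theorem setOf_freeList_ex_subset (y : ℕ) (φ : WFormula V) :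
    (φ.free : Set ℕ) ⊆ {x | x ∈ (ex y φ).freeList ∨ x ∈ [y]} := by
  intro x hx
  simp only [Set.mem_ofPred_eq, mem_freeList, free, Finset.mem_sdiff, Finset.mem_singleton,
    List.mem_singleton]
  have : x ∈ φ.free := hx
  tauto

theorem setOf_freeList_sumEq_subset {a : Fin V.numWt} {hfin : Finite (V.Elem (V.wtType a))}
    {s : V.Elem (V.wtType a)} {ys : Fin (V.wtArity a) ↪ ℕ} (φ : WFormula V) :
    (φ.free : Set ℕ) ⊆ {x | x ∈ (sumEq a hfin s ys φ).freeList ∨ x ∈ List.ofFn ys} := by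
  intro x hx
  simp only [Set.mem_ofPred_eq, mem_freeList, free, Finset.mem_sdiff, Finset.mem_image,
    Finset.mem_univ, true_and, List.mem_ofFn]
  have : x ∈ φ.free := hx
  tauto

theorem setOf_freeList (φ : WFormula V) : {x | x ∈ φ.freeList} = (φ.free : Set ℕ) := by
  ext x
  exact mem_freeList φ

theorem isNormal_gnf (φ : WFormula V) : φ.gnf.2.IsNormal φ.gnf.1 φ.free := by
  induction φ with
  | eq x y => exact isNormal_singleton_tt (stronglyLocal_of_satIn_iff fun _ _ _ => Iff.rfl)
  | rel R xs => exact isNormal_singleton_tt (stronglyLocal_of_satIn_iff fun _ _ _ => Iff.rfl)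
  | wtEq a s xs => exact isNormal_singleton_tt (stronglyLocal_of_satIn_iff fun _ _ _ => Iff.rfl)
  | pred P ts h => exact isNormal_singleton_tt (stronglyLocal_of_satIn_iff fun _ _ _ => Iff.rfl)
  | not φ ih => exact ih.neg
  | or φ ψ ih₁ ih₂ =>
    exact (ih₁.mono (le_max_left _ _) (by simp [free])).either
      (ih₂.mono (le_max_right _ _) (by simp [free]))
  | ex y φ ih =>
    refine ih.bind fun lam hlam => ?_
    rw [← setOf_freeList]
    exact isNormal_exStep (hlam.mono le_rfl (setOf_freeList_ex_subset y φ))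
      (by simp [mem_freeList, free])
  | sumEq a hfin s ys φ ih =>
    refine ih.bind fun lam hlam => ?_
    rw [← setOf_freeList]
    exact isNormal_sumStep (hlam.mono le_rfl (setOf_freeList_sumEq_subset φ))
      (by simp [mem_freeList, free])

theorem decides_singleton_tt :
    Cases.Decides [(tt, φ)] A Set.univ Set.univ β (φ.SatIn A Set.univ β) :=
  ⟨⟨_, List.mem_singleton_self _, satIn_tt⟩, fun c hc _ => by
    obtain rfl := List.mem_singleton.1 hc
    exact Iff.rfl⟩

/-- Guards are sentences, so a guard that holds under `β` holds for all values of the bound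
variables. Under a binder `φ` may thus be replaced by one and the same local body, to which the
elimination step for that binder applies. -/
theorem decides_gnf (hA : A.IsWeighted) (φ : WFormula V) (β : ℕ → A.Univ) :
    φ.gnf.2.Decides A Set.univ Set.univ β (φ.SatIn A Set.univ β) := by
  induction φ generalizing β with
  | eq x y => exact decides_singleton_tt
  | rel R xs => exact decides_singleton_tt
  | wtEq a s xs => exact decides_singleton_tt
  | pred P ts h => exact decides_singleton_tt
  | not φ ih => exact (ih β).neg
  | or φ ψ ih₁ ih₂ => exact (ih₁ β).either (ih₂ β)
  | ex y φ ih =>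
    refine Cases.Decides.bind (ih β).1 fun c hc h₁ => ?_
    have hn := isNormal_gnf φ c hc
    have : (ex y φ).SatIn A Set.univ β ↔ (ex y c.2).SatIn A Set.univ β := by
      refine exists_congr fun b => and_congr_right fun _ => (ih _).2 c hc ?_
      exact (satIn_congr _ (by simp [hn.1.2])).1 h₁
    rw [this]
    exact decides_exStep hA (hn.2.mono le_rfl (setOf_freeList_ex_subset y φ))
      (by simp [mem_freeList, free])
  | sumEq a hfin s ys φ ih =>
    refine Cases.Decides.bind (ih β).1 fun c hc h₁ => ?_
    have hn := isNormal_gnf φ c hc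
    have : (sumEq a hfin s ys φ).SatIn A Set.univ β ↔
        (sumEq a hfin s ys c.2).SatIn A Set.univ β := by
      refine Eq.congr_right (congrArg _ (Set.ext fun b => ?_))
      refine and_congr_right fun _ => (ih _).2 c hc ?_
      exact (satIn_congr _ (by simp [hn.1.2])).1 h₁
    rw [this]
    exact decides_sumStep hA (hn.2.mono le_rfl (setOf_freeList_sumEq_subset φ))
      (by simp [mem_freeList, free])

/-- A formula with free variables `X` that is equivalent to the local formula `lam`. -/
def pad (X : List ℕ) (lam : WFormula V) : WFormula V :=
  if X = [] then ex 0 lam else and (conj (X.map fun x => eq x x)) lam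

/-- The Gaifman normal form of a formula. -/
noncomputable def gaifmanNF (φ : WFormula V) : WFormula V :=
  and (conj (φ.freeList.map fun x => eq x x))
    (disj (φ.gnf.2.map fun c => and c.1 (pad φ.freeList c.2)))

theorem satIn_conj_eq_self : (conj (X.map fun x => eq x x)).SatIn A D β := by
  simp only [satIn_conj, List.forall_mem_map, SatIn, implies_true]

theorem free_conj_eq_self : (conj (X.map fun x => eq x x) : WFormula V).free = X.toFinset := by
  ext v
  simp [mem_free_conj, free]

theorem stronglyLocal_conj_eq_self :
    (conj (X.map fun x => eq x x) : WFormula V).StronglyLocal r X.toFinset :=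
  ⟨by rw [free_conj_eq_self], fun _ _ _ _ => iff_of_true satIn_conj_eq_self satIn_conj_eq_self⟩

theorem isGaifmanNF_conj_eq_self :
    (conj (X.map fun x => eq x x) : WFormula V).IsGaifmanNF := by
  by_cases hX : X = []
  · subst hX
    exact isGaifmanNF_tt
  · refine .loc ⟨0, stronglyLocal_conj_eq_self.isLocalAround ?_ |> (by
      rw [free_conj_eq_self]; exact ·)⟩
    simpa [Finset.nonempty_iff_ne_empty] using hX

/-- A local formula needs a free variable, so for sentences a dummy quantifier produces a
basic-local sentence. Otherwise trivial equations make the free variables equal to the set around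
which `lam` is known to be local. -/
theorem isGaifmanNF_pad (h : lam.StronglyLocal r X.toFinset) : (pad X lam).IsGaifmanNF := by
  unfold pad
  split_ifs with hX
  · exact isGaifmanNF_ex_zero (h.mono le_rfl (by simp [hX]))
  · have hfree : (and (conj (X.map fun x => eq x x)) lam).free = X.toFinset := by
      rw [free_and, free_conj_eq_self]
      exact Finset.union_eq_left.2 (by exact_mod_cast h.1)
    refine .loc ⟨r, ?_⟩
    rw [hfree]
    exact (stronglyLocal_conj_eq_self.and h).isLocalAround
      (by simpa [Finset.nonempty_iff_ne_empty] using hX)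

theorem free_pad_subset (h : lam.StronglyLocal r X.toFinset) : (pad X lam).free ⊆ X.toFinset := by
  have h : lam.free ⊆ X.toFinset := by exact_mod_cast h.1
  unfold pad
  split_ifs with hX
  · exact Finset.sdiff_subset.trans h
  · rw [free_and, free_conj_eq_self]
    exact Finset.union_subset subset_rfl h

theorem satIn_pad (h : lam.StronglyLocal r X.toFinset) :
    (pad X lam).SatIn A Set.univ β ↔ lam.SatIn A Set.univ β := by
  unfold pad
  split_ifs with hX
  · have hfree : ∀ b, lam.SatIn A Set.univ (update β 0 b) ↔ lam.SatIn A Set.univ β := fun b =>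
      h.congr (by simp [hX])
    have := A.nonempty_univ
    simp [SatIn, hfree]
  · simp only [satIn_and, satIn_conj_eq_self, true_and]

/-- The trivial equations in front provide all free variables of `φ`, so for the disjunction only an
upper bound on its free variables is needed. -/
theorem gaifmanNF_spec (φ : WFormula V) :
    φ.gaifmanNF.IsGaifmanNF ∧ φ.Equivalent φ.gaifmanNF ∧ φ.gaifmanNF.free = φ.free := by
  have hn := isNormal_gnf φ
  rw [← toFinset_freeList] at hn
  refine ⟨isGaifmanNF_conj_eq_self.and ?_, fun A hA β => ?_, ?_⟩
  · have : ∀ l : List (WFormula V), (∀ φ ∈ l, φ.IsGaifmanNF) → (disj l).IsGaifmanNF := by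
      intro l
      induction l with
      | nil => exact fun _ => isGaifmanNF_tt.not
      | cons φ l ih =>
        exact fun h => (h φ (by simp)).or (ih fun ψ hψ => h ψ (by simp [hψ]))
    refine this _ fun ψ hψ => ?_
    obtain ⟨c, hc, rfl⟩ := List.mem_map.1 hψ
    exact (hn c hc).1.1.and (isGaifmanNF_pad (hn c hc).2)
  · rw [← satIn_univ, ← satIn_univ, (decides_gnf hA φ β).iff_exists]
    simp only [gaifmanNF, satIn_and, satIn_conj_eq_self, true_and, satIn_disj, List.mem_map,
      exists_exists_and_eq_and]
    refine exists_congr fun c => and_congr_right fun hc => and_congr_right fun _ => ?_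
    exact (satIn_pad (hn c hc).2).symm
  · rw [gaifmanNF, free_and, free_conj_eq_self, toFinset_freeList]
    refine Finset.union_eq_left.2 fun x hx => ?_
    simp only [mem_free_disj, List.mem_map, exists_exists_and_eq_and, free_and] at hx
    obtain ⟨c, hc, hx⟩ := hx
    rw [(hn c hc).1.2, Finset.empty_union] at hx
    simpa [toFinset_freeList] using free_pad_subset (hn c hc).2 hx

end WFormula

/-! ### Functions that are computable on codes -/

/-- A type whose elements have codes, possibly not unique ones. -/
class Coded (V : Vocabulary.{u, v, w}) (X : Type*) where
  rep : SymbolCoding V → X → ℕ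

namespace Coded

variable {V : Vocabulary.{u, v, w}} {X Y : Type*}

instance : Coded V ℕ := ⟨fun _ n => n⟩
instance : Coded V Bool := ⟨fun _ b => b.toNat⟩
instance [Coded V X] [Coded V Y] : Coded V (X × Y) :=
  ⟨fun c p => Nat.pair (rep c p.1) (rep c p.2)⟩
instance [Coded V X] : Coded V (List X) := ⟨fun c l => Encodable.encode (l.map (rep c))⟩
instance : Coded V (WFormula V) := ⟨fun c φ => c.code φ⟩
instance : Coded V (Σ i, WTerm V i) := ⟨fun c t => c.termCode t.2⟩

end Coded

open Coded

/-- The function `F` is induced by a primitive recursive function on codes. -/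
@[fun_prop]
def Tracked {V : Vocabulary.{u, v, w}} (c : SymbolCoding V) {X Y : Type*} [Coded V X] [Coded V Y]
    (F : X → Y) : Prop :=
  ∃ f : ℕ → ℕ, Primrec f ∧ ∀ x, f (rep c x) = rep c (F x)

namespace Tracked

variable {V : Vocabulary.{u, v, w}} {c : SymbolCoding V} {X Y Z W : Type*} [Coded V X] [Coded V Y]
  [Coded V Z] [Coded V W]

@[fun_prop]
theorem id' : Tracked c (fun x : X => x) := ⟨id, Primrec.id, fun _ => rfl⟩

-- A fixed element may be chosen without any algorithm, since only its code is built into the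
-- function.
@[fun_prop]
theorem const (y : Y) : Tracked c (fun _ : X => y) := ⟨_, Primrec.const (rep c y), fun _ => rfl⟩

@[fun_prop]
theorem comp {F : Y → Z} {G : X → Y} (hF : Tracked c F) (hG : Tracked c G) :
    Tracked c fun x => F (G x) := by
  obtain ⟨f, hf, hf'⟩ := hF
  obtain ⟨g, hg, hg'⟩ := hG
  exact ⟨fun n => f (g n), hf.comp hg, fun x => by simp only [hg', hf']⟩

@[fun_prop]
theorem prodMk {F : X → Y} {G : X → Z} (hF : Tracked c F) (hG : Tracked c G) :
    Tracked c fun x => (F x, G x) := by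
  obtain ⟨f, hf, hf'⟩ := hF
  obtain ⟨g, hg, hg'⟩ := hG
  exact ⟨fun n => Nat.pair (f n) (g n), Primrec₂.natPair.comp hf hg, fun x => by
    simp only [hf', hg']; rfl⟩

@[fun_prop]
theorem fst {F : X → Y × Z} (hF : Tracked c F) : Tracked c fun x => (F x).1 := by
  obtain ⟨f, hf, hf'⟩ := hF
  exact ⟨fun n => (f n).unpair.1, Primrec.fst.comp (Primrec.unpair.comp hf), fun x => by
    simp only [hf']; simp [rep]⟩

@[fun_prop]
theorem snd {F : X → Y × Z} (hF : Tracked c F) : Tracked c fun x => (F x).2 := by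
  obtain ⟨f, hf, hf'⟩ := hF
  exact ⟨fun n => (f n).unpair.2, Primrec.snd.comp (Primrec.unpair.comp hf), fun x => by
    simp only [hf']; simp [rep]⟩

theorem nat₂ {g : ℕ → ℕ → ℕ} (hg : Primrec₂ g) {F G : X → ℕ} (hF : Tracked c F)
    (hG : Tracked c G) : Tracked c fun x => g (F x) (G x) := by
  obtain ⟨f, hf, hf'⟩ := hF
  obtain ⟨g, hg, hg'⟩ := hG
  exact ⟨_, Primrec₂.comp ‹_› hf hg, fun x => by simp [hf', hg', rep]⟩

@[fun_prop]
theorem add {F G : X → ℕ} (hF : Tracked c F) (hG : Tracked c G) :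
    Tracked c fun x => F x + G x := nat₂ Primrec.nat_add hF hG

@[fun_prop]
theorem sub {F G : X → ℕ} (hF : Tracked c F) (hG : Tracked c G) :
    Tracked c fun x => F x - G x := nat₂ Primrec.nat_sub hF hG

@[fun_prop]
theorem mul {F G : X → ℕ} (hF : Tracked c F) (hG : Tracked c G) :
    Tracked c fun x => F x * G x := nat₂ Primrec.nat_mul hF hG

@[fun_prop]
theorem max {F G : X → ℕ} (hF : Tracked c F) (hG : Tracked c G) :
    Tracked c fun x => max (F x) (G x) := nat₂ Primrec.nat_max hF hG

@[fun_prop]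
theorem decide_eq {F G : X → ℕ} (hF : Tracked c F) (hG : Tracked c G) :
    Tracked c fun x => decide (F x = G x) := by
  obtain ⟨f, hf, hf'⟩ := hF
  obtain ⟨g, hg, hg'⟩ := hG
  refine ⟨fun n => if f n = g n then 1 else 0, Primrec.ite (Primrec.eq.comp hf hg)
    (Primrec.const 1) (Primrec.const 0), fun x => ?_⟩
  simp only [hf', hg']
  simp only [rep]
  split_ifs with h <;> simp [h]

@[fun_prop]
theorem bool_rec {b : X → Bool} {F G : X → Y} (hb : Tracked c b) (hF : Tracked c F)
    (hG : Tracked c G) : Tracked c fun x => if b x = true then F x else G x := by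
  obtain ⟨p, hp, hp'⟩ := hb
  obtain ⟨f, hf, hf'⟩ := hF
  obtain ⟨g, hg, hg'⟩ := hG
  refine ⟨fun n => if p n = 1 then f n else g n, Primrec.ite (Primrec.eq.comp hp
    (Primrec.const 1)) hf hg, fun x => ?_⟩
  simp only [hp', hf', hg']
  cases h : b x <;> simp [rep]

@[fun_prop]
theorem ite {p : X → Prop} [DecidablePred p] {F G : X → Y} (hb : Tracked c fun x => decide (p x))
    (hF : Tracked c F) (hG : Tracked c G) : Tracked c fun x => if p x then F x else G x := by
  simpa using hb.bool_rec hF hG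

-- The list operations below are mostly derived from this fold, which runs over the list of codes.
@[fun_prop]
theorem foldr {l : X → List Y} {h : X → Y → Z → Z} {z : X → Z} (hl : Tracked c l)
    (hh : Tracked c fun p : X × Y × Z => h p.1 p.2.1 p.2.2) (hz : Tracked c z) :
    Tracked c fun x => (l x).foldr (h x) (z x) := by
  obtain ⟨f, hf, hf'⟩ := hl
  obtain ⟨g, hg, hg'⟩ := hh
  obtain ⟨k, hk, hk'⟩ := hz
  refine ⟨fun n => (Denumerable.ofNat (List ℕ) (f n)).foldr
    (fun a b => g (Nat.pair n (Nat.pair a b))) (k n),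
    Primrec.list_foldr (h := fun n q => g (Nat.pair n (Nat.pair q.1 q.2)))
      ((Primrec.ofNat _).comp hf) hk
      (Primrec₂.mk (hg.comp (Primrec₂.natPair.comp Primrec.fst (Primrec₂.natPair.comp
        (Primrec.fst.comp Primrec.snd) (Primrec.snd.comp Primrec.snd))))), fun x => ?_⟩
  simp only [hf', hk']
  change List.foldr _ _ (Denumerable.ofNat (List ℕ) (Encodable.encode ((l x).map (rep c)))) = _
  rw [Denumerable.ofNat_encode]
  induction l x with
  | nil => rfl
  | cons y t ih =>
    simp only [List.map_cons, List.foldr_cons, ih]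
    exact hg' (x, y, t.foldr (h x) (z x))

@[fun_prop]
theorem cons {F : X → Y} {l : X → List Y} (hF : Tracked c F) (hl : Tracked c l) :
    Tracked c fun x => F x :: l x := by
  obtain ⟨f, hf, hf'⟩ := hF
  obtain ⟨g, hg, hg'⟩ := hl
  refine ⟨fun n => Nat.succ (Nat.pair (f n) (g n)),
    Primrec.succ.comp (Primrec₂.natPair.comp hf hg), fun x => ?_⟩
  simp only [hf', hg']
  simp [rep]

@[fun_prop]
theorem append {l m : X → List Y} (hl : Tracked c l) (hm : Tracked c m) :
    Tracked c fun x => l x ++ m x := by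
  have : (fun x => l x ++ m x) = fun x => (l x).foldr (fun y t => y :: t) (m x) := by
    ext1 x
    induction l x with
    | nil => rfl
    | cons y t ih => simp
  rw [this]
  fun_prop

@[fun_prop]
theorem map {l : X → List Y} {h : X → Y → Z} (hl : Tracked c l)
    (hh : Tracked c fun p : X × Y => h p.1 p.2) : Tracked c fun x => (l x).map (h x) := by
  have : (fun x => (l x).map (h x)) = fun x => (l x).foldr (fun y t => h x y :: t) [] := by
    ext1 x
    induction l x with
    | nil => rfl
    | cons y t ih => simp
  rw [this]
  have := hh.comp (G := fun p : X × Y × List Z => (p.1, p.2.1)) (by fun_prop)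
  fun_prop

@[fun_prop]
theorem flatMap {l : X → List Y} {h : X → Y → List Z} (hl : Tracked c l)
    (hh : Tracked c fun p : X × Y => h p.1 p.2) : Tracked c fun x => (l x).flatMap (h x) := by
  have : (fun x => (l x).flatMap (h x)) = fun x => (l x).foldr (fun y t => h x y ++ t) [] := by
    ext1 x
    induction l x with
    | nil => rfl
    | cons y t ih => simpa using ih
  rw [this]
  have := hh.comp (G := fun p : X × Y × List Z => (p.1, p.2.1)) (by fun_prop)
  fun_prop

@[fun_prop]
theorem flatten {l : X → List (List Y)} (hl : Tracked c l) : Tracked c fun x => (l x).flatten := by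
  have : (fun x => (l x).flatten) = fun x => (l x).flatMap fun y => y := by
    ext1 x; simp
  rw [this]
  fun_prop

@[fun_prop]
theorem filter {l : X → List Y} {p : X → Y → Bool} (hl : Tracked c l)
    (hp : Tracked c fun q : X × Y => p q.1 q.2) : Tracked c fun x => (l x).filter (p x) := by
  have : (fun x => (l x).filter (p x)) =
      fun x => (l x).flatMap fun y => if p x y = true then [y] else [] := by
    ext1 x
    induction l x with
    | nil => rfl
    | cons y t ih => by_cases h : p x y = true <;> simp [h, ih]
  rw [this]
  fun_prop

@[fun_prop]
theorem length {l : X → List Y} (hl : Tracked c l) : Tracked c fun x => (l x).length := by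
  have : (fun x => (l x).length) = fun x => (l x).foldr (fun _ n => n + 1) 0 := by
    ext1 x
    induction l x with
    | nil => rfl
    | cons y t ih => simp
  rw [this]
  fun_prop

@[fun_prop]
theorem not {p : X → Prop} [DecidablePred p] (hp : Tracked c fun x => decide (p x)) :
    Tracked c fun x => decide (¬ p x) := by
  have : (fun x => decide (¬ p x)) = fun x => if p x then false else true := by
    ext1 x; by_cases h : p x <;> simp [h]
  rw [this]
  fun_prop

@[fun_prop]
theorem decide_forall_mem {l : X → List Y} {p : X → Y → Prop} [∀ x y, Decidable (p x y)]
    (hl : Tracked c l) (hp : Tracked c fun q : X × Y => decide (p q.1 q.2)) :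
    Tracked c fun x => decide (∀ y ∈ l x, p x y) := by
  have : (fun x => decide (∀ y ∈ l x, p x y)) =
      fun x => (l x).foldr (fun y b => if p x y then b else false) true := by
    ext1 x
    induction l x with
    | nil => rfl
    | cons y t ih => rw [List.foldr_cons, ← ih]; by_cases h : p x y <;> simp [h]
  rw [this]
  have := hp.comp (G := fun q : X × Y × Bool => (q.1, q.2.1)) (by fun_prop)
  fun_prop

@[fun_prop]
theorem decide_mem {l : X → List ℕ} {F : X → ℕ} (hl : Tracked c l) (hF : Tracked c F) :
    Tracked c fun x => decide (F x ∈ l x) := by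
  have : (fun x => decide (F x ∈ l x)) = fun x => decide (¬ ∀ y ∈ l x, ¬ F x = y) := by
    ext1 x; simp
  rw [this]
  fun_prop

theorem of_nat_list {g : ℕ → List ℕ} (hg : Primrec g) {F : X → ℕ} (hF : Tracked c F) :
    Tracked c fun x => g (F x) := by
  obtain ⟨f, hf, hf'⟩ := hF
  exact ⟨_, Primrec.encode.comp (hg.comp hf), fun x => by simp [hf', rep]⟩

@[fun_prop]
theorem range {F : X → ℕ} (hF : Tracked c F) : Tracked c fun x => List.range (F x) :=
  of_nat_list Primrec.list_range hF

@[fun_prop]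
theorem range' {F G : X → ℕ} (hF : Tracked c F) (hG : Tracked c G) :
    Tracked c fun x => List.range' (F x) (G x) := by
  simp only [List.range'_eq_map_range]
  fun_prop

@[fun_prop]
theorem listBound {F : X → List ℕ} (hF : Tracked c F) : Tracked c fun x => listBound (F x) := by
  unfold _root_.listBound
  fun_prop

@[fun_prop]
theorem eq_nil {F : X → List Y} (hF : Tracked c F) : Tracked c fun x => decide (F x = []) := by
  have : (fun x => decide (F x = [])) = fun x => decide ((F x).length = 0) := by
    ext1 x; simp
  rw [this]
  fun_prop

/-- Maps over a fixed list. -/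
theorem map_const {ι : Type*} (L : List ι) {h : ι → X → Y} (hh : ∀ i, Tracked c (h i)) :
    Tracked c fun x => L.map fun i => h i x := by
  induction L with
  | nil => exact const []
  | cons i L ih => exact (hh i).cons ih

end Tracked

/-! ### Finite tables and recursion on codes -/

namespace Tracked

variable {V : Vocabulary.{u, v, w}} {c : SymbolCoding V} {X Y Z P : Type*} [Coded V X] [Coded V Y]
  [Coded V Z] [Coded V P]

/-- Lets a function on syntax be given by arithmetic on the code of its argument. The result may be
of another type, such as a list of numbers in place of a list of terms, as only codes are compared.
-/
theorem of_rep {F : X → Y} (f : ℕ → Z) (hf : Tracked c f)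
    (h : ∀ x, rep c (f (rep c x)) = rep c (F x)) : Tracked c F := by
  obtain ⟨g, hg, hg'⟩ := hf
  exact ⟨g, hg, fun x => (hg' (rep c x)).trans (h x)⟩

@[fun_prop]
theorem rep_comp {F : X → Y} (hF : Tracked c F) : Tracked c fun x => rep c (F x) := hF

@[fun_prop]
theorem unpair_fst {F : X → ℕ} (hF : Tracked c F) : Tracked c fun x => (F x).unpair.1 :=
  Tracked.comp (F := fun n : ℕ => n.unpair.1)
    ⟨_, Primrec.fst.comp Primrec.unpair, fun _ => rfl⟩ hF

@[fun_prop]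
theorem unpair_snd {F : X → ℕ} (hF : Tracked c F) : Tracked c fun x => (F x).unpair.2 :=
  Tracked.comp (F := fun n : ℕ => n.unpair.2)
    ⟨_, Primrec.snd.comp Primrec.unpair, fun _ => rfl⟩ hF

@[fun_prop]
theorem natPair {F G : X → ℕ} (hF : Tracked c F) (hG : Tracked c G) :
    Tracked c fun x => Nat.pair (F x) (G x) := nat₂ Primrec₂.natPair hF hG

/-- The list coded by a number. -/
@[fun_prop]
theorem ofNat_list {F : X → ℕ} (hF : Tracked c F) :
    Tracked c fun x => Denumerable.ofNat (List ℕ) (F x) :=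
  of_nat_list (Primrec.ofNat _) hF

/-- Look-up in a fixed table. -/
theorem table (l : List ℕ) {F : X → ℕ} (hF : Tracked c F) : Tracked c fun x => l.getD (F x) 0 :=
  Tracked.comp (F := fun n : ℕ => l.getD n 0)
    ⟨_, (Primrec.list_getD 0).comp (Primrec.const l) Primrec.id, fun _ => rfl⟩ hF

/-- On a finite type whose elements have different codes every function is a look-up, so no
effective presentation of the finite rings and groups is required. -/
theorem exists_table {K : Type*} [Finite K] (e g : K → ℕ) (he : Injective e) :
    ∃ l : List ℕ, ∀ k, l.getD (e k) 0 = g k := by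
  obtain ⟨N, hN⟩ := (Set.finite_range e).bddAbove
  refine ⟨(List.range (N + 1)).map (extend e g 0), fun k => ?_⟩
  have : e k < N + 1 := Nat.lt_succ_of_le (hN ⟨k, rfl⟩)
  rw [List.getD_eq_getElem _ _ (by simpa using this)]
  simp [he.extend_apply]

/-- Recursion on codes; recursive calls that do not decrease are ignored. -/
def codeRec (l : ℕ → List ℕ) (g : ℕ → ℕ) (n : ℕ) : ℕ :=
  g (Nat.pair n (Encodable.encode
    (((l n).filter fun m => m.unpair.1 < n.unpair.1).attach.map fun m => codeRec l g m.1)))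
termination_by n.unpair.1
decreasing_by
  have := m.2
  simp only [List.mem_filter, decide_eq_true_eq] at this
  exact this.2

theorem codeRec_eq (l : ℕ → List ℕ) (g : ℕ → ℕ) (n : ℕ) :
    codeRec l g n = g (Nat.pair n (Encodable.encode
      (((l n).filter fun m => m.unpair.1 < n.unpair.1).map (codeRec l g)))) := by
  rw [codeRec, List.attach_map_val]

/-- Course-of-values recursion along the first component only; parameters in the second component
may grow. -/
theorem primrec_codeRec {l : ℕ → List ℕ} {g : ℕ → ℕ} (hl : Primrec l) (hg : Primrec g) :
    Primrec (codeRec l g) := by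
  have hlt : PrimrecRel fun m n : ℕ => m.unpair.1 < n.unpair.1 :=
    Primrec.nat_lt.comp₂ (Primrec₂.mk (Primrec.fst.comp (Primrec.unpair.comp Primrec.fst)))
      (Primrec₂.mk (Primrec.fst.comp (Primrec.unpair.comp Primrec.snd)))
  refine Primrec.nat_omega_rec' (codeRec l g) (m := fun n => n.unpair.1)
    (l := fun n => (l n).filter fun m => m.unpair.1 < n.unpair.1)
    (g := fun n L => some (g (Nat.pair n (Encodable.encode L))))
    (Primrec.fst.comp Primrec.unpair) (hlt.listFilter.comp hl Primrec.id)
    (Primrec₂.mk (Primrec.option_some.comp (hg.comp (Primrec₂.natPair.comp Primrec.fst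
      (Primrec.encode.comp Primrec.snd))))) ?_ fun n =>
        congrArg some (codeRec_eq l g n).symm
  intro n m hm
  simpa using (List.mem_filter.1 hm).2

/-- Recursion along calls for which the code of the first component decreases. -/
theorem recursion {F : X × P → Y} (calls : X × P → List (X × P)) (G : (X × P) × List Y → Y)
    (hcalls : Tracked c calls) (hG : Tracked c G)
    (hlt : ∀ q, ∀ q' ∈ calls q, rep c q'.1 < rep c q.1)
    (hF : ∀ q, F q = G (q, (calls q).map F)) : Tracked c F := by
  obtain ⟨l, hl, hl'⟩ := hcalls
  obtain ⟨g, hg, hg'⟩ := hG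
  refine ⟨codeRec (fun n => Denumerable.ofNat (List ℕ) (l n)) g,
    primrec_codeRec ((Primrec.ofNat _).comp hl) hg, fun q => ?_⟩
  induction hn : rep c q.1 using Nat.strong_induction_on generalizing q with
  | _ n ih =>
    subst hn
    -- On genuine codes all calls decrease, so the filter removes nothing.
    have hfil : (Denumerable.ofNat (List ℕ) (l (rep c q))).filter
        (fun m => m.unpair.1 < (rep c q).unpair.1) = (calls q).map (rep c) := by
      rw [hl']
      change (Denumerable.ofNat (List ℕ) (Encodable.encode ((calls q).map (rep c)))).filter _ = _
      rw [Denumerable.ofNat_encode, List.filter_eq_self]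
      intro m hm
      obtain ⟨q', hq', rfl⟩ := List.mem_map.1 hm
      simpa [rep] using hlt q q' hq'
    rw [codeRec_eq, hfil, hF q, ← hg', List.map_map]
    congr 1
    change _ = Nat.pair (rep c q) (Encodable.encode (((calls q).map F).map (rep c)))
    rw [List.map_map]
    congr 2
    exact List.map_congr_left fun q' hq' => ih _ (hlt q q' hq') q' rfl

end Tracked

namespace WFormula

variable {V : Vocabulary.{u, v, w}} {c : SymbolCoding V}

/-! ### Access to the syntax tree -/

/-- The outermost constructor. -/
def tag : WFormula V → ℕ
  | eq _ _ => 0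
  | rel _ _ => 1
  | wtEq _ _ _ => 2
  | not _ => 3
  | or _ _ => 4
  | ex _ _ => 5
  | sumEq _ _ _ _ _ => 6
  | pred _ _ _ => 7

/-- The first immediate subformula. -/
def body : WFormula V → WFormula V
  | not φ => φ
  | or φ _ => φ
  | ex _ φ => φ
  | sumEq _ _ _ _ φ => φ
  | φ => φ

/-- The second immediate subformula. -/
def body₂ : WFormula V → WFormula V
  | or _ ψ => ψ
  | φ => φ

/-- The variables bound by the outermost constructor. -/
def boundVars : WFormula V → List ℕ
  | ex y _ => [y]
  | sumEq _ _ _ ys _ => List.ofFn ys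
  | _ => []

/-- The variables of an atomic formula that is not of the form `P(…)`. -/
def plainVars : WFormula V → List ℕ
  | eq x y => [x, y]
  | rel _ xs => List.ofFn xs
  | wtEq _ _ xs => List.ofFn xs
  | _ => []

/-- The terms of an atomic formula `P(…)`. -/
def predArgs : WFormula V → List (Σ i, WTerm V i)
  | pred _ ts _ => List.ofFn fun j => ⟨_, ts j⟩
  | _ => []

end WFormula

namespace Tracked

variable {V : Vocabulary.{u, v, w}} {c : SymbolCoding V} {X Y Z P : Type*} [Coded V X] [Coded V Y]
  [Coded V Z] [Coded V P] {F G : X → WFormula V}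

@[fun_prop]
theorem tag (hF : Tracked c F) : Tracked c fun x => (F x).tag := by
  refine Tracked.comp (of_rep (fun n => n.unpair.1) (by fun_prop) fun φ => ?_) hF
  cases φ <;> simp [rep, SymbolCoding.code, WFormula.tag]

@[fun_prop]
theorem body (hF : Tracked c F) : Tracked c fun x => (F x).body := by
  refine Tracked.comp (of_rep (fun n => if n.unpair.1 = 3 then n.unpair.2 else
    if n.unpair.1 = 4 then n.unpair.2.unpair.1 else
    if n.unpair.1 = 5 then n.unpair.2.unpair.2 else
    if n.unpair.1 = 6 then n.unpair.2.unpair.2.unpair.2.unpair.2 else n)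
    (by fun_prop) fun φ => ?_) hF
  cases φ <;> simp [rep, SymbolCoding.code, WFormula.body]

@[fun_prop]
theorem body₂ (hF : Tracked c F) : Tracked c fun x => (F x).body₂ := by
  refine Tracked.comp (of_rep (fun n =>
    if n.unpair.1 = 4 then n.unpair.2.unpair.2 else n) (by fun_prop) fun φ => ?_) hF
  cases φ <;> simp [rep, SymbolCoding.code, WFormula.body₂]

@[fun_prop]
theorem boundVars (hF : Tracked c F) : Tracked c fun x => (F x).boundVars := by
  refine Tracked.comp (of_rep (fun n => if n.unpair.1 = 5 then [n.unpair.2.unpair.1] else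
    if n.unpair.1 = 6 then
      Denumerable.ofNat (List ℕ) n.unpair.2.unpair.2.unpair.2.unpair.1 else [])
    (by fun_prop) fun φ => ?_) hF
  cases φ <;> simp [rep, SymbolCoding.code, WFormula.boundVars]

@[fun_prop]
theorem plainVars (hF : Tracked c F) : Tracked c fun x => (F x).plainVars := by
  refine Tracked.comp (of_rep (fun n =>
    if n.unpair.1 = 0 then [n.unpair.2.unpair.1, n.unpair.2.unpair.2] else
    if n.unpair.1 = 1 then Denumerable.ofNat (List ℕ) n.unpair.2.unpair.2 else
    if n.unpair.1 = 2 then Denumerable.ofNat (List ℕ) n.unpair.2.unpair.2.unpair.2 else [])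
    (by fun_prop) fun φ => ?_) hF
  cases φ <;> simp [rep, SymbolCoding.code, WFormula.plainVars]

@[fun_prop]
theorem predArgs (hF : Tracked c F) : Tracked c fun x => (F x).predArgs := by
  refine Tracked.comp (of_rep (fun n =>
    if n.unpair.1 = 7 then Denumerable.ofNat (List ℕ) n.unpair.2.unpair.2 else [])
    (by fun_prop) fun φ => ?_) hF
  cases φ <;> simp [rep, SymbolCoding.code, WFormula.predArgs, Function.comp_def]

-- The weight symbol, the constant and the bound variables are copied as raw codes; constants could
-- not be decoded in general.
@[fun_prop]
theorem setBody (hF : Tracked c F) (hG : Tracked c G) :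
    Tracked c fun x => (F x).setBody (G x) := by
  refine Tracked.comp (F := fun p : WFormula V × WFormula V => p.1.setBody p.2)
    (of_rep (fun n =>
      if n.unpair.1.unpair.1 = 3 then Nat.pair 3 n.unpair.2 else
      if n.unpair.1.unpair.1 = 5 then
        Nat.pair 5 (Nat.pair n.unpair.1.unpair.2.unpair.1 n.unpair.2) else
      if n.unpair.1.unpair.1 = 6 then
        Nat.pair 6 (Nat.pair n.unpair.1.unpair.2.unpair.1
          (Nat.pair n.unpair.1.unpair.2.unpair.2.unpair.1
            (Nat.pair n.unpair.1.unpair.2.unpair.2.unpair.2.unpair.1 n.unpair.2))) else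
      n.unpair.1)
    (by fun_prop) fun p => ?_) (hF.prodMk hG)
  obtain ⟨φ, ψ⟩ := p
  cases φ <;> simp [rep, SymbolCoding.code, WFormula.setBody]

theorem of_code {F : X → WFormula V} (h : Tracked c fun x => c.code (F x)) : Tracked c F := h

@[fun_prop]
theorem eq {F G : X → ℕ} (hF : Tracked c F) (hG : Tracked c G) :
    Tracked c fun x => (WFormula.eq (F x) (G x) : WFormula V) :=
  of_code (by simp only [SymbolCoding.code]; fun_prop)

end Tracked

namespace Tracked

variable {V : Vocabulary.{u, v, w}} {c : SymbolCoding V} {X Y Z P : Type*} [Coded V X] [Coded V Y]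
  [Coded V Z] [Coded V P] {F G : X → WFormula V}

/-! ### Building formulas -/

@[fun_prop]
theorem not_ (hF : Tracked c F) : Tracked c fun x => (F x).not :=
  of_code (by simp only [SymbolCoding.code]; exact natPair (const 3) hF)

@[fun_prop]
theorem or_ (hF : Tracked c F) (hG : Tracked c G) : Tracked c fun x => (F x).or (G x) :=
  of_code (by simp only [SymbolCoding.code]; exact natPair (const 4) (natPair hF hG))

@[fun_prop]
theorem and_ (hF : Tracked c F) (hG : Tracked c G) : Tracked c fun x => (F x).and (G x) := by
  unfold WFormula.and
  fun_prop

@[fun_prop]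
theorem ex_ {y : X → ℕ} (hy : Tracked c y) (hF : Tracked c F) :
    Tracked c fun x => WFormula.ex (y x) (F x) :=
  of_code (by simp only [SymbolCoding.code]; exact natPair (const 5) (natPair hy hF))

@[fun_prop]
theorem exs {l : X → List ℕ} (hl : Tracked c l) (hF : Tracked c F) :
    Tracked c fun x => WFormula.exs (l x) (F x) := by
  unfold WFormula.exs
  exact foldr (h := fun _ => WFormula.ex) hl (by fun_prop) hF

@[fun_prop]
theorem disj {l : X → List (WFormula V)} (hl : Tracked c l) :
    Tracked c fun x => WFormula.disj (l x) := by
  unfold WFormula.disj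
  exact foldr (h := fun _ => WFormula.or) hl (by fun_prop) (const _)

/-- A one-element conjunction is the formula itself, so the fold carries a flag telling whether the
remainder of the list is empty. -/
theorem conj_eq_foldr (l : List (WFormula V)) :
    WFormula.conj l = (l.foldr (fun φ (s : Bool × WFormula V) =>
      (false, if s.1 = true then φ else φ.and s.2)) (true, WFormula.tt)).2 := by
  induction l with
  | nil => rfl
  | cons φ l ih =>
    cases l with
    | nil => rfl
    | cons ψ l => rw [WFormula.conj, ih]; rfl

@[fun_prop]
theorem conj {l : X → List (WFormula V)} (hl : Tracked c l) :
    Tracked c fun x => WFormula.conj (l x) := by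
  simp only [conj_eq_foldr]
  fun_prop

/-- Each step needs the tail of the list, which the fold therefore rebuilds along the way. -/
theorem farApart_eq_foldr (δ : ℕ → ℕ → WFormula V) (l : List ℕ) :
    (l, WFormula.farApart δ l) = l.foldr (fun y (s : List ℕ × List (WFormula V)) =>
      (y :: s.1, s.1.map (fun z => (δ y z).not) ++ s.2)) ([], []) := by
  induction l with
  | nil => rfl
  | cons y l ih => rw [List.foldr_cons, ← ih]; rfl

theorem farApart {δ : X → ℕ → ℕ → WFormula V} {l : X → List ℕ}
    (hδ : Tracked c fun p : X × ℕ × ℕ => δ p.1 p.2.1 p.2.2) (hl : Tracked c l) :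
    Tracked c fun x => WFormula.farApart (δ x) (l x) := by
  have h : ∀ x, WFormula.farApart (δ x) (l x) =
      ((l x).foldr (fun y (s : List ℕ × List (WFormula V)) =>
        (y :: s.1, s.1.map (fun z => (δ x y z).not) ++ s.2)) ([], [])).2 := fun x => by
    rw [← farApart_eq_foldr]
  simp only [h]
  have := hδ.comp (G := fun p : (X × ℕ × List ℕ × List (WFormula V)) × ℕ => (p.1.1, p.1.2.1, p.2))
    (by fun_prop)
  fun_prop

@[fun_prop]
theorem encode_list {l : X → List ℕ} (hl : Tracked c l) :
    Tracked c fun x => Encodable.encode (l x) := by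
  obtain ⟨f, hf, hf'⟩ := hl
  exact ⟨f, hf, fun x => (hf' x).trans (by simp [rep])⟩

theorem rel_add (R : Fin V.numRel) {F : X → ℕ} (hF : Tracked c F) :
    Tracked c fun x => (WFormula.rel R fun l => F x + l : WFormula V) := by
  have : ∀ x, (List.ofFn fun l : Fin (V.relArity R) => F x + l) =
      (List.range (V.relArity R)).map fun l => F x + l := fun x => by
    rw [← List.map_coe_finRange_eq_range, List.map_map, List.ofFn_eq_map]; rfl
  refine of_code ?_
  simp only [SymbolCoding.code, this]
  fun_prop

theorem link (R : Fin V.numRel) {F G : X → ℕ} (hF : Tracked c F) (hG : Tracked c G) :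
    Tracked c fun x => (WFormula.link R (F x) (G x) : WFormula V) := by
  unfold WFormula.link
  have := rel_add (V := V) (c := c) R (F := fun x => F x + G x + 1) (by fun_prop)
  fun_prop

@[fun_prop]
theorem distLEOne {F G : X → ℕ} (hF : Tracked c F) (hG : Tracked c G) :
    Tracked c fun x => (WFormula.distLEOne (F x) (G x) : WFormula V) := by
  unfold WFormula.distLEOne
  have := map_const (c := c) (List.finRange V.numRel) (h := fun R x => WFormula.link R (F x) (G x))
    fun R => link R hF hG
  fun_prop

@[fun_prop]
theorem distLE {r F G : X → ℕ} (hr : Tracked c r) (hF : Tracked c F) (hG : Tracked c G) :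
    Tracked c fun x => (WFormula.distLE (r x) (F x) (G x) : WFormula V) := by
  refine Tracked.comp (F := fun q : ℕ × ℕ × ℕ => (WFormula.distLE q.1 q.2.1 q.2.2 : WFormula V))
    -- The recursion is on the radius, a number that is its own code. The only recursive result is
    -- read off by a fold whose default value plays no role.
    (recursion (fun q => if q.1 = 0 then [] else [(q.1 - 1, q.2.1, q.2.1 + q.2.2 + 1)])
      (fun q => if q.1.1 = 0 then WFormula.eq q.1.2.1 q.1.2.2 else
        WFormula.ex (q.1.2.1 + q.1.2.2 + 1) ((q.2.foldr (fun ψ _ => ψ) WFormula.ff).and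
          (WFormula.distLEOne (q.1.2.1 + q.1.2.2 + 1) q.1.2.2)))
      (by fun_prop) (by fun_prop) ?_ ?_) (hr.prodMk (hF.prodMk hG))
  · rintro ⟨_ | r, x, y⟩ q' hq'
    · simp at hq'
    · simp only [Nat.add_one_ne_zero, if_false, List.mem_singleton] at hq'
      subst hq'
      simp [rep]
  · rintro ⟨_ | r, x, y⟩
    · rfl
    · rfl

@[fun_prop]
theorem near {r F : X → ℕ} {l : X → List ℕ} (hr : Tracked c r) (hl : Tracked c l)
    (hF : Tracked c F) : Tracked c fun x => (WFormula.near (r x) (l x) (F x) : WFormula V) := by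
  unfold WFormula.near
  fun_prop

/-! ### Recursion on formulas and terms -/

/-- The first two entries of a list, with a default value. -/
def firstTwo (y : Y) (l : List Y) : Y × Y := l.foldr (fun z s => (z, s.1)) (y, y)

@[fun_prop]
theorem firstTwo_ {y : X → Y} {l : X → List Y} (hy : Tracked c y) (hl : Tracked c l) :
    Tracked c fun x => firstTwo (y x) (l x) := by
  unfold firstTwo
  fun_prop

/-- Compound formulas and terms have positive tags, hence larger codes than their immediate parts.
-/
theorem lt_natPair {a : ℕ} (b : ℕ) (ha : 0 < a) : b < Nat.pair a b := by
  unfold Nat.pair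
  split_ifs with h
  · nlinarith
  · nlinarith

/-- Recursion on formulas. Quantifiers and aggregation change the parameters, in two ways. -/
theorem formulaRec {F : WFormula V × P → Y} (leaf : WFormula V × P → Y)
    (n : (WFormula V × P) × Y → Y) (o : (WFormula V × P) × Y × Y → Y)
    (b : (WFormula V × P) × Y × Y → Y) (q₁ q₂ : WFormula V × P → P)
    (hleaf : Tracked c leaf) (hn : Tracked c n) (ho : Tracked c o) (hb : Tracked c b)
    (hq₁ : Tracked c q₁) (hq₂ : Tracked c q₂)
    (eq_eq : ∀ x y p, F (.eq x y, p) = leaf (.eq x y, p))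
    (eq_rel : ∀ R xs p, F (.rel R xs, p) = leaf (.rel R xs, p))
    (eq_wtEq : ∀ a s xs p, F (.wtEq a s xs, p) = leaf (.wtEq a s xs, p))
    (eq_pred : ∀ Q ts h p, F (.pred Q ts h, p) = leaf (.pred Q ts h, p))
    (eq_not : ∀ φ p, F (.not φ, p) = n ((.not φ, p), F (φ, p)))
    (eq_or : ∀ φ ψ p, F (.or φ ψ, p) = o ((.or φ ψ, p), F (φ, p), F (ψ, p)))
    (eq_ex : ∀ y φ p, F (.ex y φ, p) =
      b ((.ex y φ, p), F (φ, q₁ (.ex y φ, p)), F (φ, q₂ (.ex y φ, p))))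
    (eq_sumEq : ∀ a hfin s ys φ p, F (.sumEq a hfin s ys φ, p) =
      b ((.sumEq a hfin s ys φ, p), F (φ, q₁ (.sumEq a hfin s ys φ, p)),
        F (φ, q₂ (.sumEq a hfin s ys φ, p)))) : Tracked c F := by
  refine recursion (fun q => if q.1.tag = 3 then [(q.1.body, q.2)] else
      if q.1.tag = 4 then [(q.1.body, q.2), (q.1.body₂, q.2)] else
      if q.1.tag = 5 then [(q.1.body, q₁ q), (q.1.body, q₂ q)] else
      if q.1.tag = 6 then [(q.1.body, q₁ q), (q.1.body, q₂ q)] else [])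
    (fun z => if z.1.1.tag = 3 then n (z.1, (firstTwo (leaf z.1) z.2).1) else
      if z.1.1.tag = 4 then o (z.1, firstTwo (leaf z.1) z.2) else
      if z.1.1.tag = 5 then b (z.1, firstTwo (leaf z.1) z.2) else
      if z.1.1.tag = 6 then b (z.1, firstTwo (leaf z.1) z.2) else leaf z.1)
    (by fun_prop) (by fun_prop) ?_ ?_
  · rintro ⟨φ, p⟩ q' hq'
    cases φ with
    | eq x y => simp [WFormula.tag] at hq'
    | rel R xs => simp [WFormula.tag] at hq'
    | wtEq a s xs => simp [WFormula.tag] at hq'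
    | pred Q ts h => simp [WFormula.tag] at hq'
    | not φ =>
      simp only [WFormula.tag, WFormula.body, if_true, List.mem_singleton] at hq'
      subst hq'
      exact lt_natPair _ (by norm_num)
    | or φ ψ =>
      simp [WFormula.tag, WFormula.body, WFormula.body₂] at hq'
      rcases hq' with rfl | rfl
      · exact (Nat.left_le_pair _ _).trans_lt (lt_natPair _ (by norm_num))
      · exact (Nat.right_le_pair _ _).trans_lt (lt_natPair _ (by norm_num))
    | ex y φ =>
      have : q'.1 = φ := by
        simp [WFormula.tag, WFormula.body] at hq'
        rcases hq' with rfl | rfl <;> rfl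
      rw [this]
      exact (Nat.right_le_pair _ _).trans_lt (lt_natPair _ (by norm_num))
    | sumEq a hfin s ys φ =>
      have : q'.1 = φ := by
        simp [WFormula.tag, WFormula.body] at hq'
        rcases hq' with rfl | rfl <;> rfl
      rw [this]
      exact ((Nat.right_le_pair _ _).trans ((Nat.right_le_pair _ _).trans
        (Nat.right_le_pair _ _))).trans_lt (lt_natPair _ (by norm_num))
  · rintro ⟨φ, p⟩
    cases φ with
    | eq x y => exact eq_eq _ _ _
    | rel R xs => exact eq_rel _ _ _
    | wtEq a s xs => exact eq_wtEq _ _ _ _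
    | pred Q ts h => exact eq_pred _ _ _ _
    | not φ => exact eq_not _ _
    | or φ ψ => exact eq_or _ _ _
    | ex y φ => exact eq_ex _ _ _
    | sumEq a hfin s ys φ => exact eq_sumEq _ _ _ _ _ _

end Tracked

namespace WTerm

variable {V : Vocabulary.{u, v, w}}

/-- The outermost constructor. -/
def tag : (Σ i, WTerm V i) → ℕ
  | ⟨_, const _⟩ => 0
  | ⟨_, wt _ _⟩ => 1
  | ⟨_, add _ _⟩ => 2
  | ⟨_, sub _ _⟩ => 3
  | ⟨_, mul _ _ _⟩ => 4

/-- The immediate subterms. -/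
def children : (Σ i, WTerm V i) → List (Σ i, WTerm V i)
  | ⟨_, const _⟩ => []
  | ⟨_, wt _ _⟩ => []
  | ⟨_, add t₁ t₂⟩ => [⟨_, t₁⟩, ⟨_, t₂⟩]
  | ⟨_, sub t₁ t₂⟩ => [⟨_, t₁⟩, ⟨_, t₂⟩]
  | ⟨_, mul _ t₁ t₂⟩ => [⟨_, t₁⟩, ⟨_, t₂⟩]

/-- The variables of a term `w(x)`. -/
def wtVars : (Σ i, WTerm V i) → List ℕ
  | ⟨_, wt _ xs⟩ => List.ofFn xs
  | _ => []

end WTerm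

namespace Tracked

variable {V : Vocabulary.{u, v, w}} {c : SymbolCoding V} {X Y Z P : Type*} [Coded V X] [Coded V Y]
  [Coded V Z] [Coded V P] {F G : X → WFormula V} {t : X → Σ i, WTerm V i}

@[fun_prop]
theorem termTag (ht : Tracked c t) : Tracked c fun x => WTerm.tag (t x) := by
  refine Tracked.comp (of_rep (fun n => n.unpair.1) (by fun_prop) fun t => ?_) ht
  obtain ⟨i, t⟩ := t
  cases t <;> simp [rep, SymbolCoding.termCode, WTerm.tag]

@[fun_prop]
theorem children (ht : Tracked c t) : Tracked c fun x => WTerm.children (t x) := by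
  refine Tracked.comp (of_rep (fun n => if n.unpair.1 = 0 then [] else
    if n.unpair.1 = 1 then [] else [n.unpair.2.unpair.1, n.unpair.2.unpair.2])
    (by fun_prop) fun t => ?_) ht
  obtain ⟨i, t⟩ := t
  cases t <;> simp [rep, SymbolCoding.termCode, WTerm.children]

@[fun_prop]
theorem wtVars (ht : Tracked c t) : Tracked c fun x => WTerm.wtVars (t x) := by
  refine Tracked.comp (of_rep (fun n => if n.unpair.1 = 1 then
    Denumerable.ofNat (List ℕ) n.unpair.2.unpair.2 else [])
    (by fun_prop) fun t => ?_) ht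
  obtain ⟨i, t⟩ := t
  cases t <;> simp [rep, SymbolCoding.termCode, WTerm.wtVars]

/-- Recursion on terms. -/
theorem termRec {F : (Σ i, WTerm V i) × P → Y} (G : ((Σ i, WTerm V i) × P) × List Y → Y)
    (hG : Tracked c G)
    (hF : ∀ t p, F (t, p) = G ((t, p), (WTerm.children t).map fun t' => F (t', p))) :
    Tracked c F := by
  refine recursion (fun q => (WTerm.children q.1).map fun t' => (t', q.2)) G (by fun_prop) hG ?_ ?_
  · rintro ⟨⟨i, t⟩, p⟩ q' hq'
    obtain ⟨t', ht', rfl⟩ := List.mem_map.1 hq'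
    have key : ∀ {i : V.Ix} (t₁ t₂ : WTerm V i) (k : ℕ), 0 < k →
        t' ∈ ([⟨_, t₁⟩, ⟨_, t₂⟩] : List (Σ i, WTerm V i)) →
        c.termCode t'.2 < Nat.pair k (Nat.pair (c.termCode t₁) (c.termCode t₂)) := by
      intro i t₁ t₂ k hk ht
      refine lt_of_le_of_lt ?_ (lt_natPair _ hk)
      simp only [List.mem_cons, List.not_mem_nil, or_false] at ht
      rcases ht with rfl | rfl
      · exact Nat.left_le_pair _ _
      · exact Nat.right_le_pair _ _
    cases t with
    | const s => simp [WTerm.children] at ht'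
    | wt a xs => simp [WTerm.children] at ht'
    | add t₁ t₂ => exact key t₁ t₂ _ (by norm_num) ht'
    | sub t₁ t₂ => exact key t₁ t₂ _ (by norm_num) ht'
    | mul h t₁ t₂ => exact key t₁ t₂ _ (by norm_num) ht'
  · rintro ⟨t, p⟩
    rw [hF, List.map_map]
    rfl

@[fun_prop]
theorem vars (ht : Tracked c t) : Tracked c fun x => (t x).2.vars := by
  refine Tracked.comp (F := fun q : (Σ i, WTerm V i) × ℕ => q.1.2.vars)
    (termRec (fun z => WTerm.wtVars z.1.1 ++ z.2.flatten) (by fun_prop) ?_) (ht.prodMk (const 0))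
  rintro ⟨i, t⟩ p
  cases t <;> simp [WTerm.vars, WTerm.wtVars, WTerm.children]

/-- Only lists of variables change; constants and symbols are copied from the code. Taking the code
as the value avoids carrying the type of the renamed term. -/
theorem termRename {x y : X → ℕ} (ht : Tracked c t) (hx : Tracked c x) (hy : Tracked c y) :
    Tracked c fun z => c.termCode ((t z).2.rename (Equiv.swap (x z) (y z))) := by
  refine Tracked.comp (F := fun q : (Σ i, WTerm V i) × ℕ × ℕ =>
      c.termCode (q.1.2.rename (Equiv.swap q.2.1 q.2.2)))
    (termRec (fun z => if WTerm.tag z.1.1 = 0 then rep c z.1.1 else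
      if WTerm.tag z.1.1 = 1 then Nat.pair 1 (Nat.pair (rep c z.1.1).unpair.2.unpair.1
        (Encodable.encode ((WTerm.wtVars z.1.1).map fun v =>
          if v = z.1.2.1 then z.1.2.2 else if v = z.1.2.2 then z.1.2.1 else v))) else
      Nat.pair (WTerm.tag z.1.1) (Nat.pair (firstTwo 0 z.2).1 (firstTwo 0 z.2).2))
      (by fun_prop) ?_) (ht.prodMk (hx.prodMk hy))
  rintro ⟨i, t⟩ p
  cases t with
  | const s => rfl
  | wt a xs =>
    simp [WTerm.rename, WTerm.tag, WTerm.wtVars, rep, SymbolCoding.termCode, Function.comp_def,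
      Equiv.swap_apply_def]
  | add t₁ t₂ => rfl
  | sub t₁ t₂ => rfl
  | mul h t₁ t₂ => rfl

@[fun_prop]
theorem leafVars (hF : Tracked c F) : Tracked c fun x => (F x).leafVars := by
  have : ∀ φ : WFormula V, φ.leafVars =
      φ.plainVars ++ (φ.predArgs.map fun t => t.2.vars).flatten := by
    intro φ
    cases φ <;> simp [WFormula.leafVars, WFormula.plainVars, WFormula.predArgs,
      Function.comp_def]
  simp only [this]
  fun_prop

@[fun_prop]
theorem freeList (hF : Tracked c F) : Tracked c fun x => (F x).freeList := by
  refine Tracked.comp (F := fun q : WFormula V × ℕ => q.1.freeList)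
    (formulaRec (fun q => q.1.leafVars) (fun z => z.2) (fun z => z.2.1 ++ z.2.2)
      (fun z => z.2.1.filter fun x => decide (x ∉ z.1.1.boundVars)) (fun q => q.2) (fun q => q.2)
      (by fun_prop) (by fun_prop) (by fun_prop) (by fun_prop) (by fun_prop) (by fun_prop)
      ?_ ?_ ?_ ?_ ?_ ?_ ?_ ?_) (hF.prodMk (const 0)) <;> intros <;> rfl

@[fun_prop]
theorem bound (hF : Tracked c F) : Tracked c fun x => (F x).bound := by
  refine Tracked.comp (F := fun q : WFormula V × ℕ => q.1.bound)
    (formulaRec (fun q => _root_.listBound q.1.leafVars) (fun z => z.2)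
      (fun z => Max.max z.2.1 z.2.2)
      (fun z => Max.max (_root_.listBound z.1.1.boundVars) z.2.1) (fun q => q.2) (fun q => q.2)
      (by fun_prop) (by fun_prop) (by fun_prop) (by fun_prop) (by fun_prop) (by fun_prop)
      ?_ ?_ ?_ ?_ ?_ ?_ ?_ ?_) (hF.prodMk (const 0)) <;> intros <;> rfl

@[fun_prop]
theorem relat {l : X → List ℕ} {r : X → ℕ} (hl : Tracked c l) (hr : Tracked c r)
    (hF : Tracked c F) : Tracked c fun x => (F x).relat (l x) (r x) := by
  refine Tracked.comp (F := fun q : WFormula V × List ℕ × ℕ => q.1.relat q.2.1 q.2.2)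
    (formulaRec (fun q => q.1) (fun z => z.2.not) (fun z => z.2.1.or z.2.2)
      (fun z => z.1.1.setBody
        ((WFormula.conj (z.1.1.boundVars.map (WFormula.near z.1.2.2 z.1.2.1))).and z.2.1))
      (fun q => q.2) (fun q => q.2)
      (by fun_prop) (by fun_prop) (by fun_prop) (by fun_prop) (by fun_prop) (by fun_prop)
      ?_ ?_ ?_ ?_ ?_ ?_ ?_ ?_) (hF.prodMk (hl.prodMk hr)) <;> intros <;> rfl

end Tracked

namespace Tracked

variable {V : Vocabulary.{u, v, w}} {c : SymbolCoding V} {X Y Z P : Type*} [Coded V X] [Coded V Y]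
  [Coded V Z] [Coded V P] {F G : X → WFormula V} {r : X → ℕ} {S T : X → List ℕ}

/-! ### Computability of the normal form -/

@[fun_prop]
theorem rename {x y : X → ℕ} (hF : Tracked c F) (hx : Tracked c x) (hy : Tracked c y) :
    Tracked c fun z => (F z).rename (Equiv.swap (x z) (y z)) := by
  have hrename := termRename (c := c) (V := V) (X := (WFormula V × ℕ × ℕ) × Σ i, WTerm V i)
    (t := fun z => z.2) (x := fun z => z.1.2.1) (y := fun z => z.1.2.2)
    (by fun_prop) (by fun_prop) (by fun_prop)
  refine of_code (Tracked.comp (F := fun q : WFormula V × ℕ × ℕ =>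
      c.code (q.1.rename (Equiv.swap q.2.1 q.2.2)))
    (formulaRec
      (fun q =>
        if q.1.tag = 0 then Nat.pair 0 (Nat.pair
          (if (rep c q.1).unpair.2.unpair.1 = q.2.1 then q.2.2 else
            if (rep c q.1).unpair.2.unpair.1 = q.2.2 then q.2.1 else
              (rep c q.1).unpair.2.unpair.1)
          (if (rep c q.1).unpair.2.unpair.2 = q.2.1 then q.2.2 else
            if (rep c q.1).unpair.2.unpair.2 = q.2.2 then q.2.1 else
              (rep c q.1).unpair.2.unpair.2)) else
        if q.1.tag = 1 then Nat.pair 1 (Nat.pair (rep c q.1).unpair.2.unpair.1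
          (Encodable.encode (q.1.plainVars.map fun v =>
            if v = q.2.1 then q.2.2 else if v = q.2.2 then q.2.1 else v))) else
        if q.1.tag = 2 then Nat.pair 2 (Nat.pair (rep c q.1).unpair.2.unpair.1
          (Nat.pair (rep c q.1).unpair.2.unpair.2.unpair.1
          (Encodable.encode (q.1.plainVars.map fun v =>
            if v = q.2.1 then q.2.2 else if v = q.2.2 then q.2.1 else v)))) else
        Nat.pair 7 (Nat.pair (rep c q.1).unpair.2.unpair.1
          (Encodable.encode (q.1.predArgs.map fun t =>
            c.termCode (t.2.rename (Equiv.swap q.2.1 q.2.2))))))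
      (fun z => Nat.pair 3 z.2) (fun z => Nat.pair 4 (Nat.pair z.2.1 z.2.2))
      (fun z => if z.1.1.tag = 5 then Nat.pair 5 (Nat.pair
          (if (rep c z.1.1).unpair.2.unpair.1 = z.1.2.1 then z.1.2.2 else
            if (rep c z.1.1).unpair.2.unpair.1 = z.1.2.2 then z.1.2.1 else
              (rep c z.1.1).unpair.2.unpair.1) z.2.1) else
        Nat.pair 6 (Nat.pair (rep c z.1.1).unpair.2.unpair.1
          (Nat.pair (rep c z.1.1).unpair.2.unpair.2.unpair.1
            (Nat.pair (Encodable.encode (z.1.1.boundVars.map fun v =>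
              if v = z.1.2.1 then z.1.2.2 else if v = z.1.2.2 then z.1.2.1 else v)) z.2.1))))
      (fun q => q.2) (fun q => q.2)
      (by fun_prop) (by fun_prop) (by fun_prop) (by fun_prop) (by fun_prop) (by fun_prop)
      ?_ ?_ ?_ ?_ ?_ ?_ ?_ ?_) (hF.prodMk (hx.prodMk hy)))
  all_goals intros
  all_goals simp [WFormula.rename, WFormula.tag, WFormula.plainVars, WFormula.boundVars,
    WFormula.predArgs, rep, SymbolCoding.code, Function.comp_def, Equiv.swap_apply_def]

@[fun_prop]
theorem withCopies {N : X → ℕ} (hS : Tracked c S) (hN : Tracked c N) (hF : Tracked c F) :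
    Tracked c fun x => (F x).withCopies (S x) (N x) := by
  unfold WFormula.withCopies
  fun_prop

@[fun_prop]
theorem inBall (hr : Tracked c r) (hS : Tracked c S) (hF : Tracked c F) :
    Tracked c fun x => (F x).inBall (r x) (S x) := by
  unfold WFormula.inBall
  fun_prop

section Cases

open WFormula (Cases)

variable {l m : X → Cases V}

@[fun_prop]
theorem expand (hF : Tracked c F) (hl : Tracked c l) :
    Tracked c fun x => (l x).expand (F x) := by
  unfold WFormula.Cases.expand
  fun_prop

@[fun_prop]
theorem swap (hl : Tracked c l) : Tracked c fun x => (l x).swap := by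
  unfold WFormula.Cases.swap
  fun_prop

@[fun_prop]
theorem neg (hl : Tracked c l) : Tracked c fun x => (l x).neg := by
  unfold WFormula.Cases.neg
  fun_prop

@[fun_prop]
theorem both (hl : Tracked c l) (hm : Tracked c m) : Tracked c fun x => (l x).both (m x) := by
  unfold WFormula.Cases.both
  fun_prop

@[fun_prop]
theorem either (hl : Tracked c l) (hm : Tracked c m) : Tracked c fun x => (l x).either (m x) := by
  unfold WFormula.Cases.either
  fun_prop

@[fun_prop]
theorem any {ls : X → List (Cases V)} (hl : Tracked c ls) :
    Tracked c fun x => WFormula.Cases.any (ls x) := by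
  unfold WFormula.Cases.any
  exact foldr (h := fun _ => WFormula.Cases.either) hl (by fun_prop) (const _)

@[fun_prop]
theorem mapBody {f : X → WFormula V → WFormula V}
    (hf : Tracked c fun p : X × WFormula V => f p.1 p.2)
    (hl : Tracked c l) : Tracked c fun x => (l x).mapBody (f x) := by
  unfold WFormula.Cases.mapBody
  have := hf.comp (G := fun p : X × WFormula V × WFormula V => (p.1, p.2.2)) (by fun_prop)
  fun_prop

@[fun_prop]
theorem bind {f : X → WFormula V → Cases V} (hf : Tracked c fun p : X × WFormula V => f p.1 p.2)
    (hl : Tracked c l) : Tracked c fun x => (l x).bind (f x) := by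
  unfold WFormula.Cases.bind
  have := hf.comp (G := fun p : X × WFormula V × WFormula V => (p.1, p.2.2)) (by fun_prop)
  fun_prop

end Cases

/-- Weight symbols of finite type, paired with constants of that type, can share a single table. -/
theorem injective_natPair_const (c : SymbolCoding V) :
    Injective fun k : Σ a : {a : Fin V.numWt // Finite (V.Elem (V.wtType a))},
      V.Elem (V.wtType a.1) => Nat.pair (k.1.1 : ℕ) (c.const _ k.2) := by
  rintro ⟨⟨a, ha⟩, s⟩ ⟨⟨b, hb⟩, t⟩ h
  obtain ⟨h₁, h₂⟩ := Nat.pair_eq_pair.1 h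
  obtain rfl : a = b := Fin.ext h₁
  obtain rfl : s = t := c.const_injective _ ha h₂
  rfl

theorem finite_sigma_elem (V : Vocabulary.{u, v, w}) :
    Finite (Σ a : {a : Fin V.numWt // Finite (V.Elem (V.wtType a))}, V.Elem (V.wtType a.1)) := by
  have : ∀ a : {a : Fin V.numWt // Finite (V.Elem (V.wtType a))}, Finite (V.Elem (V.wtType a.1)) :=
    fun a => a.2
  infer_instance

-- The table lists, for each symbol and constant, the codes of all pairs of summands; the bound
-- variables and the body are copied unchanged.
@[fun_prop]
theorem sumSplits (hF : Tracked c F) : Tracked c fun x => (F x).sumSplits := by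
  have := finite_sigma_elem V
  obtain ⟨l, hl⟩ := exists_table _
    (fun k : Σ a : {a : Fin V.numWt // Finite (V.Elem (V.wtType a))}, V.Elem (V.wtType a.1) =>
      have := k.1.2
      have := Fintype.ofFinite (V.Elem (V.wtType k.1.1))
      Encodable.encode (Finset.univ.toList.map fun s₁ : V.Elem (V.wtType k.1.1) =>
        Nat.pair (c.const _ s₁) (c.const _ (k.2 - s₁))))
    (injective_natPair_const c)
  have htable := table (c := c) l (F := fun n : ℕ => Nat.pair n.unpair.2.unpair.1
    n.unpair.2.unpair.2.unpair.1) (by fun_prop)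
  refine Tracked.comp (of_rep (fun n => if n.unpair.1 = 6 then
    (Denumerable.ofNat (List ℕ) (l.getD (Nat.pair n.unpair.2.unpair.1
      n.unpair.2.unpair.2.unpair.1) 0)).map fun p => Nat.pair
        (Nat.pair 6 (Nat.pair n.unpair.2.unpair.1
          (Nat.pair p.unpair.1 n.unpair.2.unpair.2.unpair.2)))
        (Nat.pair 6 (Nat.pair n.unpair.2.unpair.1
          (Nat.pair p.unpair.2 n.unpair.2.unpair.2.unpair.2))) else [])
    (by fun_prop) fun φ => ?_) hF
  cases φ with
  | sumEq a hfin s ys φ =>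
    have h := hl ⟨⟨a, hfin⟩, s⟩
    simp only [] at h
    simp [rep, SymbolCoding.code, WFormula.sumSplits, h, Function.comp_def,
      -List.getD_eq_getElem?_getD]
  | _ => simp [rep, SymbolCoding.code, WFormula.sumSplits]

@[fun_prop]
theorem sumTriples (hF : Tracked c F) : Tracked c fun x => (F x).sumTriples := by
  have := finite_sigma_elem V
  obtain ⟨l, hl⟩ := exists_table _
    (fun k : Σ a : {a : Fin V.numWt // Finite (V.Elem (V.wtType a))}, V.Elem (V.wtType a.1) =>
      have := k.1.2
      have := Fintype.ofFinite (V.Elem (V.wtType k.1.1))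
      Encodable.encode (Finset.univ.toList.flatMap fun s₁ : V.Elem (V.wtType k.1.1) =>
        Finset.univ.toList.map fun s₂ : V.Elem (V.wtType k.1.1) =>
          Nat.pair (c.const _ s₁) (Nat.pair (c.const _ s₂) (c.const _ (k.2 - s₁ + s₂)))))
    (injective_natPair_const c)
  have htable := table (c := c) l (F := fun n : ℕ => Nat.pair n.unpair.2.unpair.1
    n.unpair.2.unpair.2.unpair.1) (by fun_prop)
  refine Tracked.comp (of_rep (fun n => if n.unpair.1 = 6 then
    (Denumerable.ofNat (List ℕ) (l.getD (Nat.pair n.unpair.2.unpair.1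
      n.unpair.2.unpair.2.unpair.1) 0)).map fun p => Nat.pair
        (Nat.pair 6 (Nat.pair n.unpair.2.unpair.1
          (Nat.pair p.unpair.1 n.unpair.2.unpair.2.unpair.2)))
        (Nat.pair
          (Nat.pair 6 (Nat.pair n.unpair.2.unpair.1
            (Nat.pair p.unpair.2.unpair.1 n.unpair.2.unpair.2.unpair.2)))
          (Nat.pair 6 (Nat.pair n.unpair.2.unpair.1
            (Nat.pair p.unpair.2.unpair.2 n.unpair.2.unpair.2.unpair.2)))) else [])
    (by fun_prop) fun φ => ?_) hF
  cases φ with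
  | sumEq a hfin s ys φ =>
    have h := hl ⟨⟨a, hfin⟩, s⟩
    simp only [] at h
    simp [rep, SymbolCoding.code, WFormula.sumTriples, h, Function.comp_def, List.map_flatMap,
      -List.getD_eq_getElem?_getD]
  | _ => simp [rep, SymbolCoding.code, WFormula.sumTriples]

-- The type may be infinite here, so the table holds only the code of zero for each weight symbol.
-- The comparison is correct because no other element of the type shares that code.
@[fun_prop]
theorem isWtEqZero (hF : Tracked c F) : Tracked c fun x => (F x).isWtEqZero := by
  obtain ⟨l, hl⟩ := exists_table (fun a : Fin V.numWt => (a : ℕ))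
    (fun a => c.const (V.wtType a) 0) Fin.val_injective
  have htable := table (c := c) l (F := fun n : ℕ => n.unpair.2.unpair.1) (by fun_prop)
  refine Tracked.comp (of_rep (fun n => if n.unpair.1 = 2 then
    decide (n.unpair.2.unpair.2.unpair.1 = l.getD n.unpair.2.unpair.1 0) else false)
    (by fun_prop) fun φ => ?_) hF
  cases φ with
  | wtEq a s xs =>
    have h : c.const _ s = c.const (V.wtType a) 0 ↔ s = 0 :=
      ⟨c.const_zero _ s, fun h => h ▸ rfl⟩
    by_cases hs : s = 0 <;>
      simp [rep, SymbolCoding.code, WFormula.isWtEqZero, hl, h, hs,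
        -List.getD_eq_getElem?_getD]
  | _ => simp [rep, SymbolCoding.code, WFormula.isWtEqZero]

@[fun_prop]
theorem splitLeaf (hS : Tracked c S) (hF : Tracked c F) :
    Tracked c fun x => (F x).splitLeaf (S x) := by
  unfold WFormula.splitLeaf
  fun_prop

section

open WFormula (Cases)

variable {l m : X → Cases V}

@[fun_prop]
theorem splitEx (hF : Tracked c F) (hl : Tracked c l) (hm : Tracked c m) :
    Tracked c fun x => (F x).splitEx (l x) (m x) := by
  unfold WFormula.splitEx
  fun_prop

@[fun_prop]
theorem splitSum (hF : Tracked c F) (hl : Tracked c l) (hm : Tracked c m) :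
    Tracked c fun x => (F x).splitSum (l x) (m x) := by
  unfold WFormula.splitSum
  fun_prop

end

@[fun_prop]
theorem split (hF : Tracked c F) (hS : Tracked c S) : Tracked c fun x => (F x).split (S x) := by
  refine Tracked.comp (F := fun q : WFormula V × List ℕ => q.1.split q.2)
    (formulaRec (fun q => q.1.splitLeaf q.2) (fun z => z.2.neg) (fun z => z.2.1.either z.2.2)
      (fun z => if z.1.1.tag = 5 then z.1.1.splitEx z.2.1 z.2.2 else
        z.1.1.splitSum z.2.1 z.2.2)
      (fun q => q.1.boundVars ++ q.2) (fun q => q.2.filter fun x => decide (x ∉ q.1.boundVars))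
      (by fun_prop) (by fun_prop) (by fun_prop) (by fun_prop) (by fun_prop) (by fun_prop)
      ?_ ?_ ?_ ?_ ?_ ?_ ?_ ?_) (hF.prodMk hS) <;> intros <;> rfl

@[fun_prop]
theorem splitBalls (hr : Tracked c r) (hS : Tracked c S) (hT : Tracked c T) (hF : Tracked c F) :
    Tracked c fun x => (F x).splitBalls (r x) (S x) (T x) := by
  unfold WFormula.splitBalls
  fun_prop

@[fun_prop]
theorem scatteredBody {y : X → ℕ} (hr : Tracked c r) (hF : Tracked c F) (hy : Tracked c y)
    (hS : Tracked c S) : Tracked c fun x => (F x).scatteredBody (r x) (y x) (S x) := by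
  unfold WFormula.scatteredBody
  have := farApart (c := c) (δ := fun x => WFormula.distLE (2 * r x)) (l := S)
    (by fun_prop) hS
  fun_prop

@[fun_prop]
theorem scattered {y N k : X → ℕ} (hr : Tracked c r) (hF : Tracked c F) (hy : Tracked c y)
    (hN : Tracked c N) (hk : Tracked c k) :
    Tracked c fun x => (F x).scattered (r x) (y x) (N x) (k x) := by
  unfold WFormula.scattered
  fun_prop

@[fun_prop]
theorem scatteredNear {y N k : X → ℕ} (hr : Tracked c r) (hS : Tracked c S) (hF : Tracked c F)
    (hy : Tracked c y) (hN : Tracked c N) (hk : Tracked c k) :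
    Tracked c fun x => (F x).scatteredNear (r x) (S x) (y x) (N x) (k x) := by
  unfold WFormula.scatteredNear
  fun_prop

@[fun_prop]
theorem exStep {y : X → ℕ} (hr : Tracked c r) (hS : Tracked c S) (hy : Tracked c y)
    (hF : Tracked c F) : Tracked c fun x => (F x).exStep (r x) (S x) (y x) := by
  unfold WFormula.exStep
  fun_prop

@[fun_prop]
theorem sumStep (hr : Tracked c r) (hS : Tracked c S) (hT : Tracked c T) (hF : Tracked c F)
    (hG : Tracked c G) : Tracked c fun x => (F x).sumStep (r x) (S x) (T x) (G x) := by
  unfold WFormula.sumStep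
  fun_prop

@[fun_prop]
theorem gnf (hF : Tracked c F) : Tracked c fun x => (F x).gnf := by
  refine Tracked.comp (F := fun q : WFormula V × ℕ => q.1.gnf)
    (formulaRec (fun q => (0, [(WFormula.tt, q.1)])) (fun z => (z.2.1, z.2.2.neg))
      (fun z => (Max.max z.2.1.1 z.2.2.1, z.2.1.2.either z.2.2.2))
      -- The first component is `nextRadius` unfolded. In the case of a quantifier the fold extracts
      -- the single bound variable, and its default 0 is not reached.
      (fun z => (4 * (2 * z.2.1.1 + 2), if z.1.1.tag = 5 then
        z.2.1.2.bind (fun φ =>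
          φ.exStep z.2.1.1 z.1.1.freeList (z.1.1.boundVars.foldr (fun y _ => y) 0)) else
        z.2.1.2.bind (fun φ => z.1.1.sumStep z.2.1.1 z.1.1.freeList z.1.1.boundVars φ)))
      (fun q => q.2) (fun q => q.2)
      (by fun_prop) (by fun_prop) (by fun_prop) (by fun_prop) (by fun_prop) (by fun_prop)
      ?_ ?_ ?_ ?_ ?_ ?_ ?_ ?_) (hF.prodMk (const 0)) <;> intros <;> rfl

@[fun_prop]
theorem pad (hS : Tracked c S) (hF : Tracked c F) : Tracked c fun x => (F x).pad (S x) := by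
  unfold WFormula.pad
  fun_prop

theorem gaifmanNF (c : SymbolCoding V) : Tracked c (WFormula.gaifmanNF (V := V)) := by
  unfold WFormula.gaifmanNF
  fun_prop

end Tracked

theorem mainTheorem4 (V : Vocabulary.{u, v, w}) :
    ∃ Γ : WFormula V → WFormula V,
      (∀ φ : WFormula V,
        (Γ φ).IsGaifmanNF ∧ φ.Equivalent (Γ φ) ∧ (Γ φ).free = φ.free) ∧
      ∀ c : SymbolCoding V, ∃ f : ℕ → ℕ, Computable f ∧
        ∀ φ : WFormula V, f (c.code φ) = c.code (Γ φ) := by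
  refine ⟨WFormula.gaifmanNF, WFormula.gaifmanNF_spec, fun c => ?_⟩
  obtain ⟨f, hf, h⟩ := Tracked.gaifmanNF c
  exact ⟨f, hf.to_comp, h⟩
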